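/- Setting. Let $\pi:E\to\mathbb R$ be a surjective submersion from a smooth manifold of dimension $n+1$, let $k\ge 1$, and let $J^r\pi$ be the manifold of $r$-jets of local sections of $\pi$, with natural coordinates $(t,q_0^A,\dots,q_r^A)$. Let $L\in C^\infty(J^k\pi)$ and $\mathcal L=L\,dt$. Let $\Theta$ be the canonical 1-form of $T^*(J^{k-1}\pi)$, $\Omega_{k-1}=-d\Theta$, and let $(t,q_i^A,p,p_A^i)$, $0\le i\le k-1$, be the natural coordinates of $T^*(J^{k-1}\pi)$. *Unified formalism.* Let $\mathcal W=J^{2k-1}\pi\times_{J^{k-1}\pi}T^*(J^{k-1}\pi)$ with projections $\rho_1,\rho_2$ to the two factors. Put $$\mathcal W_o=\{(\bar y,\alpha)\in\mathcal W:\ \langle\alpha,\,T(j^{k-1}\phi)(\partial_t)\rangle=L(\pi^{2k-1}_k(\bar y))\},$$ where $\phi$ is any section representing $\bar y$ and $\pi^{2k-1}_k:J^{2k-1}\pi\to J^k\pi$ is the projection. Put $\Omega_o=\rho_2^*\Omega_{k-1}|_{\mathcal W_o}$. The unified equation for a smooth section $\psi_o$ of $\mathcal W_o\to\mathbb R$ is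 $$\psi_o^*\,i(Y)\Omega_o=0\quad\text{for every vector field }Y\text{ on }\mathcal W_o.\tag{1}$$ *Legendre–Ostrogradsky maps.* The extended map $\widetilde{\mathcal{FL}}:J^{2k-1}\pi\to T^*(J^{k-1}\pi)$ covers the identity of $J^{k-1}\pi$ and is given in natural coordinates by $$p_A^{r-1}=\sum_{i=0}^{k-r}(-1)^i d_T^i\Big(\frac{\partial L}{\partial q^A_{r+i}}\Big)\ (1\le r\le k),\qquad p=L-\sum_{r=1}^{k}\sum_A q_r^A\,p_A^{r-1},$$ where $d_T$ is the total time derivative. Its graph is $\mathcal W_1\subset\mathcal W$. Let $J^{k-1}\pi^*=T^*(J^{k-1}\pi)/\langle dt\rangle$, with quotient map $\mu$, and let $\mathcal{FL}=\mu\circ\widetilde{\mathcal{FL}}$. Let $\mathcal P=\operatorname{Im}\mathcal{FL}$, with natural projection $\bar\tau_o:\mathcal P\to\mathbb R$, and let $\mathcal{FL}_o:J^{2k-1}\pi\to\mathcal P$ be the map induced by $\mathcal{FL}$. The Lagrangian $\mathcal L$ is almost-regular if (i) $\mathcal P$ is a closed (embedded) submanifold of $J^{k-1}\pi^*$, (ii)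 $\mathcal{FL}$ is a smooth submersion onto $\mathcal P$, and (iii) every fibre $\mathcal{FL}^{-1}(\mathcal{FL}(\bar y))$ is a connected submanifold of $J^{2k-1}\pi$. Theorem. Let $\mathcal L$ be almost-regular. Then $h\circ\mathcal{FL}=\widetilde{\mathcal{FL}}$ determines a well-defined smooth map $h:\mathcal P\to T^*(J^{k-1}\pi)$; put $\Omega_h^o=h^*\Omega_{k-1}$. Let $\psi_o$ be a smooth section of $\mathcal W_o\to\mathbb R$ that solves (1). Assume that $\psi_o$ is holonomic (that is, $\rho_1\circ\psi_o=j^{2k-1}\phi$, where $\phi$ is the projection of $\rho_1\circ\psi_o$ to $E$), or, more generally, that $\psi_o$ takes its values in $\mathcal W_1$. Then $\psi_h^o=\mathcal{FL}_o\circ\rho_1\circ\psi_o$ is a smooth section of $\bar\tau_o:\mathcal P\to\mathbb R$, and it solves the Hamilton equation $$(\psi_h^o)^*\,i(Y)\Omega_h^o=0\quad\text{for every vector field }Y\text{ on }\mathcal P.$$ -/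

import Mathlib

open Set Filter Topology
open scoped Manifold ContDiff

/-- The `i`-th derivative of `G ∘ f` at `t` depends only on the `i`-jet of `f` at `t`. -/
theorem iteratedDeriv_comp_congr {X Y : Type*} [NormedAddCommGroup X] [NormedSpace ℝ X]
    [NormedAddCommGroup Y] [NormedSpace ℝ Y] {G : X → Y} {f g : ℝ → X} {t : ℝ} {i : ℕ}
    (hG : ContDiffAt ℝ i G (f t)) (hf : ContDiffAt ℝ i f t) (hg : ContDiffAt ℝ i g t)
    (h0 : f t = g t)
    (h : ∀ j ≤ i, iteratedDeriv j f t = iteratedDeriv j g t) :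
    iteratedDeriv i (G ∘ f) t = iteratedDeriv i (G ∘ g) t := by
  rw [iteratedDeriv_vcomp_eq_sum_orderedFinpartition hG hf le_rfl,
    iteratedDeriv_vcomp_eq_sum_orderedFinpartition (h0 ▸ hG) hg le_rfl, h0]
  refine Finset.sum_congr rfl fun c _ => ?_
  congr 1
  ext1 j
  exact h _ (c.partSize_le j)

/-- The polynomial curve whose derivatives at time `z.1` are the entries of `z.2`. -/
noncomputable def taylorCurve {V : Type*} [NormedAddCommGroup V] [NormedSpace ℝ V] {r : ℕ}
    (z : ℝ × (Fin (r + 1) → V)) (s : ℝ) : V :=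
  ∑ j : Fin (r + 1), ((s - z.1) ^ (j : ℕ) / ((j : ℕ).factorial : ℝ)) • z.2 j

theorem contDiff_taylorCurve {V : Type*} [NormedAddCommGroup V] [NormedSpace ℝ V] {r : ℕ} :
    ContDiff ℝ ∞ (fun p : (ℝ × (Fin (r + 1) → V)) × ℝ => taylorCurve p.1 p.2) := by
  unfold taylorCurve
  refine ContDiff.sum fun j _ => ?_
  refine ContDiff.smul (by fun_prop) ?_
  fun_prop

theorem iteratedDeriv_taylorCurve {V : Type*} [NormedAddCommGroup V] [NormedSpace ℝ V] {r : ℕ}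
    (z : ℝ × (Fin (r + 1) → V)) (i : Fin (r + 1)) :
    iteratedDeriv i (taylorCurve z) z.1 = z.2 i := by
  unfold taylorCurve
  rw [iteratedDeriv_fun_sum (fun j _ => by fun_prop)]
  have : ∀ j : Fin (r + 1),
      iteratedDeriv i (fun s => ((s - z.1) ^ (j : ℕ) / ((j : ℕ).factorial : ℝ)) • z.2 j) z.1
        = if j = i then z.2 j else 0 := by
    intro j
    have h1 : ContDiffAt ℝ (i : ℕ) (fun s : ℝ => (s - z.1) ^ (j : ℕ) / ((j : ℕ).factorial : ℝ)) z.1 := by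
      fun_prop
    rw [iteratedDeriv_smul_const h1, iteratedDeriv_div_const,
      iteratedDeriv_comp_sub_const (f := fun s : ℝ => s ^ (j : ℕ))]
    simp only [sub_self, iteratedDeriv_fun_pow_zero]
    by_cases hji : j = i
    · subst hji
      simp [Nat.factorial_ne_zero]
    · have : (i : ℕ) ≠ j := fun h => hji (Fin.ext h.symm)
      simp [hji, this]
  simp [this]

/-- Iterated derivatives in the last variable of a smooth map are smooth. -/
theorem contDiffOn_iteratedDeriv_param {X Y : Type*} [NormedAddCommGroup X] [NormedSpace ℝ X]
    [NormedAddCommGroup Y] [NormedSpace ℝ Y] {G : X × ℝ → Y} {U : Set (X × ℝ)} (hU : IsOpen U)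
    (hG : ContDiffOn ℝ ∞ G U) (i : ℕ) :
    ContDiffOn ℝ ∞ (fun p : X × ℝ => iteratedDeriv i (fun s => G (p.1, s)) p.2) U := by
  induction i with
  | zero => simpa using hG
  | succ i ih =>
    have h1 : ContDiffOn ℝ ∞ (fun p => fderiv ℝ
        (fun p : X × ℝ => iteratedDeriv i (fun s => G (p.1, s)) p.2) p (0, 1)) U :=
      (ih.fderiv_of_isOpen hU (by simp)).clm_apply contDiffOn_const
    refine h1.congr fun p hp => ?_
    have h2 := ((ih.contDiffAt (hU.mem_nhds hp)).differentiableAt (by simp)).hasFDerivAt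
    have h3 : HasDerivAt (fun s : ℝ => (p.1, s)) ((0 : X), (1 : ℝ)) p.2 :=
      (hasDerivAt_const _ _).prodMk (hasDerivAt_id _)
    have h4 := h2.comp_hasDerivAt p.2 h3
    rw [iteratedDeriv_succ]
    exact HasDerivAt.deriv (by simpa [Function.comp_def] using h4)
/-- The model of the fibres. -/
abbrev Vec (n : ℕ) : Type := EuclideanSpace ℝ (Fin n)

/-- `π : E → ℝ` is a surjective submersion of a manifold of dimension `n + 1` onto the time line. -/
class IsFibredOverReal (n : ℕ) {E : Type*} [TopologicalSpace E] [ChartedSpace (ℝ × Vec n) E]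
    (π : E → ℝ) : Prop where
  isSubmersion : Manifold.IsSubmersion 𝓘(ℝ, ℝ × Vec n) 𝓘(ℝ, ℝ) ∞ π
  surjective : Function.Surjective π

/-- A chart `(t, q)` of `E` adapted to `π`: its first coordinate is `π` itself. -/
structure IsAdapted {n : ℕ} {E : Type*} [TopologicalSpace E] [ChartedSpace (ℝ × Vec n) E]
    (π : E → ℝ) (e : OpenPartialHomeomorph E (ℝ × Vec n)) : Prop where
  mem : e ∈ IsManifold.maximalAtlas 𝓘(ℝ, ℝ × Vec n) ∞ E
  fst_eq : ∀ x ∈ e.source, (e x).1 = π x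

theorem exists_isAdapted {n : ℕ} {E : Type*} [TopologicalSpace E] [ChartedSpace (ℝ × Vec n) E]
    (π : E → ℝ) [h : IsFibredOverReal n π] (x : E) :
    ∃ e : OpenPartialHomeomorph E (ℝ × Vec n), IsAdapted π e ∧ x ∈ e.source := by
  obtain ⟨F, _, _, hF⟩ := h.isSubmersion
  have hx := hF x
  set D := hx.domChart with hD
  set ψ := hx.codChart with hψ
  set A := hx.equiv
  have : FiniteDimensional ℝ F :=
    Module.Finite.of_surjective ((LinearMap.snd ℝ ℝ F).comp A.toLinearEquiv.toLinearMap)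
      (Prod.snd_surjective.comp A.surjective)
  have hdim : Module.finrank ℝ F = Module.finrank ℝ (Vec n) := by
    have := A.toLinearEquiv.finrank_eq
    simp only [Module.finrank_prod] at this
    omega
  let B : F ≃L[ℝ] Vec n := ContinuousLinearEquiv.ofFinrankEq hdim
  let A' : (ℝ × Vec n) ≃L[ℝ] (ℝ × Vec n) :=
    A.trans ((ContinuousLinearEquiv.refl ℝ ℝ).prodCongr B)
  let q : OpenPartialHomeomorph (ℝ × Vec n) (ℝ × Vec n) :=
    ψ.symm.prod (OpenPartialHomeomorph.refl _)
  let g : OpenPartialHomeomorph (ℝ × Vec n) (ℝ × Vec n) :=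
    A'.toHomeomorph.toOpenPartialHomeomorph ≫ₕ q
  have hψ1 : ContDiffOn ℝ ∞ ψ ψ.source :=
    (contMDiffOn_of_mem_maximalAtlas hx.codChart_mem_maximalAtlas).contDiffOn
  have hψ2 : ContDiffOn ℝ ∞ ψ.symm ψ.target :=
    (contMDiffOn_symm_of_mem_maximalAtlas hx.codChart_mem_maximalAtlas).contDiffOn
  have hA : A'.toHomeomorph.toOpenPartialHomeomorph ∈
      contDiffGroupoid ∞ 𝓘(ℝ, ℝ × Vec n) := by
    refine mem_groupoid_of_pregroupoid.2 ⟨?_, ?_⟩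
    · exact A'.contDiff.contDiffOn
    · exact A'.symm.contDiff.contDiffOn
  have hq : q ∈ contDiffGroupoid ∞ 𝓘(ℝ, ℝ × Vec n) := by
    refine mem_groupoid_of_pregroupoid.2 ⟨?_, ?_⟩
    · have : ContDiffOn ℝ ∞ (fun z : ℝ × Vec n => (ψ.symm z.1, z.2)) (ψ.target ×ˢ univ) :=
        (hψ2.comp contDiffOn_fst (fun z hz => hz.1)).prodMk contDiffOn_snd
      exact this.mono (fun z hz => hz.1)
    · have : ContDiffOn ℝ ∞ (fun z : ℝ × Vec n => (ψ z.1, z.2)) (ψ.source ×ˢ univ) :=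
        (hψ1.comp contDiffOn_fst (fun z hz => hz.1)).prodMk contDiffOn_snd
      exact this.mono (fun z hz => hz.1)
  have hg := (contDiffGroupoid ∞ 𝓘(ℝ, ℝ × Vec n)).trans hA hq
  have key : ∀ y ∈ D.source, (A' (D y)).1 = ψ (π y) := by
    intro y hy
    have hDy : D y ∈ (D.extend 𝓘(ℝ, ℝ × Vec n)).target := by
      rw [OpenPartialHomeomorph.extend_target]
      exact ⟨D.map_source hy, by simp⟩
    have := hx.writtenInCharts hDy
    have h2 : D.symm (D y) = y := D.left_inv hy
    change ψ (π (D.symm (D y))) = (A (D y)).1 at this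
    rw [h2] at this
    exact this.symm
  have hmap : ∀ y ∈ D.source, π y ∈ ψ.source := fun y hy =>
    hx.mapsto_domChart_source_codChart_source hy
  refine ⟨D ≫ₕ g, ⟨?_, ?_⟩, ?_⟩
  · intro e' he'
    have h1 := hx.domChart_mem_maximalAtlas e' he'
    refine ⟨?_, ?_⟩
    · have := (contDiffGroupoid ∞ 𝓘(ℝ, ℝ × Vec n)).trans
        ((contDiffGroupoid ∞ 𝓘(ℝ, ℝ × Vec n)).symm hg) h1.1
      rwa [OpenPartialHomeomorph.trans_symm_eq_symm_trans_symm, OpenPartialHomeomorph.trans_assoc]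
    · have := (contDiffGroupoid ∞ 𝓘(ℝ, ℝ × Vec n)).trans h1.2 hg
      rwa [← OpenPartialHomeomorph.trans_assoc]
  · intro y hy
    have hyD : y ∈ D.source := hy.1
    change ψ.symm (A' (D y)).1 = π y
    rw [key y hyD, ψ.left_inv (hmap y hyD)]
  · refine ⟨hx.mem_domChart_source, trivial, ?_, trivial⟩
    change (A' (D x)).1 ∈ ψ.target
    rw [key x hx.mem_domChart_source]
    exact ψ.map_source (hmap x hx.mem_domChart_source)

section Jets

variable (n : ℕ) {E : Type*} [TopologicalSpace E] [ChartedSpace (ℝ × Vec n) E]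

/-- `φ` is a smooth section of `π` near the time `t`. -/
def IsLocalSection (π : E → ℝ) (φ : ℝ → E) (t : ℝ) : Prop :=
  ∀ᶠ s in 𝓝 t, ContMDiffAt 𝓘(ℝ, ℝ) 𝓘(ℝ, ℝ × Vec n) ∞ φ s ∧ π (φ s) = s

/-- A smooth local section of `π` together with a base time. -/
structure LocalSection (π : E → ℝ) where
  time : ℝ
  toFun : ℝ → E
  isLocalSection : IsLocalSection n π toFun time

variable {n}

def LocalSection.point {π : E → ℝ} (a : LocalSection n π) : E := a.toFun a.time

theorem LocalSection.contMDiffAt {π : E → ℝ} (a : LocalSection n π) :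
    ContMDiffAt 𝓘(ℝ, ℝ) 𝓘(ℝ, ℝ × Vec n) ∞ a.toFun a.time :=
  (a.isLocalSection.self_of_nhds).1

/-- Two local sections have the same `r`-jet if they have the same base time, the same value there,
and the same derivatives of order at most `r` there in a chart of `E`. -/
def LocalSection.setoid (n : ℕ) [ChartedSpace (ℝ × Vec n) E] (π : E → ℝ) (r : ℕ) :
    Setoid (LocalSection n π) where
  r a b := a.time = b.time ∧ a.point = b.point ∧
    ∀ i ≤ r, iteratedDeriv i (fun s => chartAt (ℝ × Vec n) a.point (a.toFun s)) a.time =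
      iteratedDeriv i (fun s => chartAt (ℝ × Vec n) a.point (b.toFun s)) a.time
  iseqv :=
    { refl := fun _ => ⟨rfl, rfl, fun _ _ => rfl⟩
      symm := fun {a b} ⟨h1, h2, h3⟩ => ⟨h1.symm, h2.symm, fun i hi => by
        rw [← h1, ← h2]; exact (h3 i hi).symm⟩
      trans := fun {a b c} ⟨h1, h2, h3⟩ ⟨k1, k2, k3⟩ => ⟨h1.trans k1, h2.trans k2, fun i hi => by
        rw [h3 i hi]
        have := k3 i hi
        rwa [← h1, ← h2] at this⟩ }

/-- The `r`-th order jet manifold `J^r π`. -/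
def Jet (n : ℕ) [ChartedSpace (ℝ × Vec n) E] (π : E → ℝ) (r : ℕ) : Type _ :=
  Quotient (LocalSection.setoid n π r)

/-- Natural coordinates `(t, q_0, …, q_r)` of the jet manifold. -/
abbrev JetCoord (n r : ℕ) : Type := ℝ × (Fin (r + 1) → Vec n)

variable {π : E → ℝ} {r : ℕ}

/-- The `r`-jet of a local section at its base time. -/
def Jet.mk (r : ℕ) (a : LocalSection n π) : Jet n π r :=
  Quotient.mk (LocalSection.setoid n π r) a

/-- The projection `J^r π → ℝ`. -/
def Jet.time (y : Jet n π r) : ℝ :=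
  Quotient.lift (s := LocalSection.setoid n π r) LocalSection.time (fun _ _ h => h.1) y

/-- The projection `J^r π → E`. -/
def Jet.point (y : Jet n π r) : E :=
  Quotient.lift (s := LocalSection.setoid n π r) LocalSection.point (fun _ _ h => h.2.1) y

/-- The projection `J^r π → J^{r'} π` for `r' ≤ r`. -/
def Jet.proj {r' : ℕ} (h : r' ≤ r) (y : Jet n π r) : Jet n π r' :=
  Quotient.map' (s₁ := LocalSection.setoid n π r) (s₂ := LocalSection.setoid n π r')
    id (fun _ _ hab => ⟨hab.1, hab.2.1, fun i hi => hab.2.2 i (hi.trans h)⟩) y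

/-- A representative of a jet. -/
noncomputable def Jet.rep (y : Jet n π r) : LocalSection n π :=
  @Quotient.out _ (LocalSection.setoid n π r) y

theorem Jet.mk_rep (y : Jet n π r) : Jet.mk r y.rep = y :=
  @Quotient.out_eq _ (LocalSection.setoid n π r) y

theorem Jet.rep_time (y : Jet n π r) : y.rep.time = y.time := by
  conv_rhs => rw [← y.mk_rep]
  rfl

theorem Jet.rep_point (y : Jet n π r) : y.rep.point = y.point := by
  conv_rhs => rw [← y.mk_rep]
  rfl

open Classical in
/-- The prolongation `j^r φ`, defined at all times near which `φ` is a section. -/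
noncomputable def jetProlongation (n : ℕ) [ChartedSpace (ℝ × Vec n) E] (π : E → ℝ) (r : ℕ)
    [Nonempty (Jet n π r)] (φ : ℝ → E) (t : ℝ) : Jet n π r :=
  if h : IsLocalSection n π φ t then Jet.mk r ⟨t, φ, h⟩
  else Classical.arbitrary _

set_option linter.unusedSectionVars false

variable [IsManifold 𝓘(ℝ, ℝ × Vec n) ∞ E]

theorem contDiffAt_chart_comp {e : OpenPartialHomeomorph E (ℝ × Vec n)}
    (he : e ∈ IsManifold.maximalAtlas 𝓘(ℝ, ℝ × Vec n) ∞ E) (a : LocalSection n π)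
    (ha : a.point ∈ e.source) : ContDiffAt ℝ ∞ (fun s => e (a.toFun s)) a.time :=
  ((contMDiffAt_of_mem_maximalAtlas he ha).comp a.time a.contMDiffAt).contDiffAt

theorem contact_chart_change {e e' : OpenPartialHomeomorph E (ℝ × Vec n)}
    (he : e ∈ IsManifold.maximalAtlas 𝓘(ℝ, ℝ × Vec n) ∞ E)
    (he' : e' ∈ IsManifold.maximalAtlas 𝓘(ℝ, ℝ × Vec n) ∞ E)
    {a b : LocalSection n π} (ht : a.time = b.time) (hp : a.point = b.point)
    (ha : a.point ∈ e.source) (ha' : a.point ∈ e'.source)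
    (h : ∀ i ≤ r, iteratedDeriv i (fun s => e (a.toFun s)) a.time =
      iteratedDeriv i (fun s => e (b.toFun s)) a.time) {i : ℕ} (hi : i ≤ r) :
    iteratedDeriv i (fun s => e' (a.toFun s)) a.time =
      iteratedDeriv i (fun s => e' (b.toFun s)) a.time := by
  have hb : b.toFun a.time = a.point := by rw [ht]; exact hp.symm
  have key : ∀ c : LocalSection n π, c.time = a.time → c.point = a.point →
      (fun s => e' (c.toFun s)) =ᶠ[𝓝 a.time] (e' ∘ e.symm) ∘ fun s => e (c.toFun s) := by
    intro c hc1 hc2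
    have hc := c.contMDiffAt.continuousAt
    rw [hc1] at hc
    have h1 : c.toFun a.time ∈ e.source := by
      rw [← hc1]; exact (show c.point ∈ e.source from hc2 ▸ ha)
    filter_upwards [hc.preimage_mem_nhds (e.open_source.mem_nhds h1)] with s hs
    simp [e.left_inv hs]
  rw [(key a rfl rfl).iteratedDeriv_eq i, (key b ht.symm hp.symm).iteratedDeriv_eq i]
  have hG : ContDiffAt ℝ ∞ (e' ∘ e.symm) (e (a.toFun a.time)) := by
    have h1 := contMDiffAt_symm_of_mem_maximalAtlas he (e.map_source ha)
    have h2 := contMDiffAt_of_mem_maximalAtlas he' ha'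
    rw [← e.left_inv ha] at h2
    exact (h2.comp _ h1).contDiffAt
  have hbs := contDiffAt_chart_comp he b (hp ▸ ha)
  rw [← ht] at hbs
  exact iteratedDeriv_comp_congr (hG.of_le (by exact_mod_cast le_top))
    ((contDiffAt_chart_comp he a ha).of_le (by exact_mod_cast le_top))
    (hbs.of_le (by exact_mod_cast le_top))
    (by simp only [hb]; rfl) (fun j hj => h j (hj.trans hi))

theorem iteratedDeriv_pair_congr {V : Type*} [NormedAddCommGroup V] [NormedSpace ℝ V]
    {u v : ℝ → V} {t : ℝ} {i : ℕ} (hu : ContDiffAt ℝ ∞ u t) (hv : ContDiffAt ℝ ∞ v t)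
    (h : ∀ j ≤ i, iteratedDeriv j u t = iteratedDeriv j v t) :
    iteratedDeriv i (fun s => (s, u s)) t = iteratedDeriv i (fun s => (s, v s)) t := by
  have key : ∀ w : ℝ → V, ContDiffAt ℝ ∞ w t → iteratedDeriv i (fun s => (s, w s)) t =
      iteratedDeriv i (fun s => (s, (0 : V))) t +
        iteratedDeriv i ((ContinuousLinearMap.inr ℝ ℝ V) ∘ w) t := by
    intro w hw
    rw [← iteratedDeriv_add (by fun_prop)
      (((ContinuousLinearMap.inr ℝ ℝ V).contDiff.contDiffAt.comp t hw).of_le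
        (by exact_mod_cast le_top))]
    congr 1
    ext s <;> simp
  rw [key u hu, key v hv]
  congr 1
  exact iteratedDeriv_comp_congr (ContinuousLinearMap.contDiff _).contDiffAt
    (hu.of_le (by exact_mod_cast le_top)) (hv.of_le (by exact_mod_cast le_top))
    (by simpa using h 0 (Nat.zero_le _)) h

theorem IsAdapted.eventuallyEq {e : OpenPartialHomeomorph E (ℝ × Vec n)} (he : IsAdapted π e)
    (a : LocalSection n π) (ha : a.point ∈ e.source) :
    (fun s => e (a.toFun s)) =ᶠ[𝓝 a.time] fun s => (s, (e (a.toFun s)).2) := by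
  have hc := a.contMDiffAt.continuousAt
  filter_upwards [hc.preimage_mem_nhds (e.open_source.mem_nhds ha), a.isLocalSection] with s hs hs'
  ext1
  · simp only
    rw [he.fst_eq _ hs, hs'.2]
  · rfl

/-- The local section with polynomial coordinate expression and given derivatives. -/
noncomputable def LocalSection.ofCoord {e : OpenPartialHomeomorph E (ℝ × Vec n)}
    (he : IsAdapted π e) (z : JetCoord n r) (hz : (z.1, z.2 0) ∈ e.target) : LocalSection n π where
  time := z.1
  toFun s := e.symm (s, taylorCurve z s)
  isLocalSection := by
    have h1 : ContDiff ℝ ∞ (fun s : ℝ => (s, taylorCurve z s)) :=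
      contDiff_id.prodMk (contDiff_taylorCurve.comp (contDiff_const.prodMk contDiff_id))
    have h0 : taylorCurve z z.1 = z.2 0 := by simpa using iteratedDeriv_taylorCurve z 0
    have h2 : ∀ᶠ s in 𝓝 z.1, (s, taylorCurve z s) ∈ e.target :=
      h1.continuous.continuousAt.preimage_mem_nhds
        (e.open_target.mem_nhds (by simpa [h0] using hz))
    filter_upwards [h2] with s hs
    refine ⟨?_, ?_⟩
    · exact (contMDiffAt_symm_of_mem_maximalAtlas he.mem hs).comp s h1.contMDiff.contMDiffAt
    · rw [← he.fst_eq _ (e.map_target hs), e.right_inv hs]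

theorem LocalSection.ofCoord_point {e : OpenPartialHomeomorph E (ℝ × Vec n)}
    (he : IsAdapted π e) (z : JetCoord n r) (hz : (z.1, z.2 0) ∈ e.target) :
    (LocalSection.ofCoord he z hz).point = e.symm (z.1, z.2 0) := by
  have h0 : taylorCurve z z.1 = z.2 0 := by simpa using iteratedDeriv_taylorCurve z 0
  change e.symm (z.1, taylorCurve z z.1) = _
  rw [h0]

theorem LocalSection.ofCoord_eventually {e : OpenPartialHomeomorph E (ℝ × Vec n)}
    (he : IsAdapted π e) (z : JetCoord n r) (hz : (z.1, z.2 0) ∈ e.target) :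
    ∀ᶠ s in 𝓝 z.1, (s, taylorCurve z s) ∈ e.target := by
  have h1 : ContDiff ℝ ∞ (fun s : ℝ => (s, taylorCurve z s)) :=
      contDiff_id.prodMk (contDiff_taylorCurve.comp (contDiff_const.prodMk contDiff_id))
  have h0 : taylorCurve z z.1 = z.2 0 := by simpa using iteratedDeriv_taylorCurve z 0
  exact h1.continuous.continuousAt.preimage_mem_nhds
        (e.open_target.mem_nhds (by simpa [h0] using hz))

theorem exists_localSection [IsFibredOverReal n π] : Nonempty (LocalSection n π) := by
  obtain ⟨x, -⟩ := IsFibredOverReal.surjective (n := n) (π := π) 0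
  obtain ⟨e, he, hx⟩ := exists_isAdapted (n := n) π x
  exact ⟨LocalSection.ofCoord (r := 0) he ((e x).1, fun _ => (e x).2) (e.map_source hx)⟩

instance [IsFibredOverReal n π] : Nonempty (Jet n π r) :=
  exists_localSection.map (Jet.mk r)

theorem jetCoord_mk {e : OpenPartialHomeomorph E (ℝ × Vec n)} (he : IsAdapted π e)
    (a : LocalSection n π) (ha : a.point ∈ e.source) {i : ℕ} (hi : i ≤ r) :
    iteratedDeriv i (fun s => (e ((Jet.mk r a).rep.toFun s)).2) a.time =
      iteratedDeriv i (fun s => (e (a.toFun s)).2) a.time := by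
  set b := (Jet.mk r a).rep with hb
  have hab : LocalSection.setoid n π r a b :=
    Setoid.symm' _ (@Quotient.mk_out _ (LocalSection.setoid n π r) a)
  have hbs := contDiffAt_chart_comp he.mem b (hab.2.1 ▸ ha)
  rw [← hab.1] at hbs
  have := fun j (hj : j ≤ r) => contact_chart_change (r := r)
    (IsManifold.chart_mem_maximalAtlas a.point) he.mem hab.1 hab.2.1 (mem_chart_source _ _) ha
    hab.2.2 hj
  refine (iteratedDeriv_comp_congr (G := Prod.snd) contDiff_snd.contDiffAt
    ((contDiffAt_chart_comp he.mem a ha).of_le (by exact_mod_cast le_top))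
    (hbs.of_le (by exact_mod_cast le_top)) (by simpa using this 0 (Nat.zero_le _))
    fun j hj => this j (hj.trans hi)).symm

open Classical in
/-- The jet with given natural coordinates. -/
noncomputable def jetOfCoord [IsFibredOverReal n π] {e : OpenPartialHomeomorph E (ℝ × Vec n)}
    (he : IsAdapted π e) (z : JetCoord n r) : Jet n π r :=
  if hz : (z.1, z.2 0) ∈ e.target then Jet.mk r (LocalSection.ofCoord he z hz)
  else Classical.arbitrary _

theorem jetOfCoord_of_mem [IsFibredOverReal n π] {e : OpenPartialHomeomorph E (ℝ × Vec n)}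
    (he : IsAdapted π e) (z : JetCoord n r) (hz : (z.1, z.2 0) ∈ e.target) :
    jetOfCoord he z = Jet.mk r (LocalSection.ofCoord he z hz) := dif_pos hz

/-- The natural chart `(t, q_0, …, q_r)` of the jet manifold induced by an adapted chart of `E`. -/
noncomputable def jetChart [IsFibredOverReal n π] (r : ℕ) (e : OpenPartialHomeomorph E (ℝ × Vec n))
    (he : IsAdapted π e) : PartialEquiv (Jet n π r) (JetCoord n r) where
  toFun y := (y.time, fun i => iteratedDeriv i (fun s => (e (y.rep.toFun s)).2) y.time)
  invFun z := jetOfCoord he z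
  source := {y | y.point ∈ e.source}
  target := {z | (z.1, z.2 0) ∈ e.target}
  map_source' := by
    intro y hy
    have hy' : y.rep.point ∈ e.source := by rw [y.rep_point]; exact hy
    have h2 : y.rep.toFun y.time = y.rep.point := by rw [← y.rep_time]; rfl
    have h1 : e (y.rep.toFun y.time) = (y.time, (e (y.rep.toFun y.time)).2) := by
      have := (he.eventuallyEq y.rep hy').self_of_nhds
      rwa [y.rep_time] at this
    simp only [Set.mem_ofPred_eq, Fin.val_zero, iteratedDeriv_zero]
    rw [← h1, h2]
    exact e.map_source hy'
  map_target' := by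
    intro z hz
    have hz' : (z.1, z.2 0) ∈ e.target := hz
    change (jetOfCoord he z).point ∈ e.source
    rw [jetOfCoord_of_mem he z hz']
    change (LocalSection.ofCoord he z hz').point ∈ _
    rw [LocalSection.ofCoord_point]
    exact e.map_target hz'
  left_inv' := by
    intro y hy
    obtain ⟨a, rfl⟩ : ∃ a, Jet.mk r a = y := ⟨_, y.mk_rep⟩
    have ha : a.point ∈ e.source := hy
    set y : Jet n π r := Jet.mk r a
    have hyt : y.time = a.time := rfl
    set z : JetCoord n r := (y.time, fun i => iteratedDeriv i (fun s => (e (y.rep.toFun s)).2) y.time)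
      with hzdef
    have hz2 : ∀ i : Fin (r + 1), z.2 i = iteratedDeriv i (fun s => (e (a.toFun s)).2) a.time :=
      fun i => jetCoord_mk he a ha (Nat.lt_succ_iff.1 i.2)
    have h1 : e a.point = (a.time, (e (a.toFun a.time)).2) :=
      (he.eventuallyEq a ha).self_of_nhds
    have hz0 : (z.1, z.2 0) = e a.point := by
      rw [hz2 0, h1]
      simp [hzdef, hyt]
    have hz : (z.1, z.2 0) ∈ e.target := by rw [hz0]; exact e.map_source ha
    rw [jetOfCoord_of_mem he z hz]
    have hpt : (LocalSection.ofCoord he z hz).point = a.point := by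
      rw [LocalSection.ofCoord_point, hz0, e.left_inv ha]
    have hac := contDiffAt_chart_comp he.mem a ha
    have htc : ContDiff ℝ ∞ (taylorCurve z) :=
      contDiff_taylorCurve.comp (contDiff_const.prodMk contDiff_id)
    refine Quotient.sound (s := LocalSection.setoid n π r) (Setoid.symm' _ ⟨rfl, hpt.symm, ?_⟩)
    intro i hi
    refine contact_chart_change (r := r) (a := a) (b := LocalSection.ofCoord he z hz) he.mem
      (IsManifold.chart_mem_maximalAtlas a.point) rfl
      hpt.symm ha (mem_chart_source _ _) (fun j hj => ?_) hi
    rw [(he.eventuallyEq a ha).iteratedDeriv_eq j]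
    have h3 : (fun s => e ((LocalSection.ofCoord he z hz).toFun s)) =ᶠ[𝓝 a.time]
        fun s => (s, taylorCurve z s) := by
      filter_upwards [LocalSection.ofCoord_eventually he z hz] with s hs
      exact e.right_inv hs
    rw [h3.iteratedDeriv_eq j]
    refine iteratedDeriv_pair_congr (contDiff_snd.contDiffAt.comp _ hac) htc.contDiffAt
      fun l hl => ?_
    have := iteratedDeriv_taylorCurve z ⟨l, by omega⟩
    rw [hz2] at this
    exact this.symm
  right_inv' := by
    intro z hz
    have hz' : (z.1, z.2 0) ∈ e.target := hz
    simp only [jetOfCoord_of_mem he z hz']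
    refine Prod.ext rfl (funext fun i => ?_)
    have hpt : (LocalSection.ofCoord he z hz').point ∈ e.source := by
      rw [LocalSection.ofCoord_point]; exact e.map_target hz'
    refine (jetCoord_mk he (LocalSection.ofCoord he z hz') hpt (Nat.lt_succ_iff.1 i.2)).trans ?_
    rw [← iteratedDeriv_taylorCurve z i]
    refine Filter.EventuallyEq.iteratedDeriv_eq _ ?_
    filter_upwards [LocalSection.ofCoord_eventually he z hz'] with s hs
    change (e (e.symm _)).2 = _
    rw [e.right_inv hs]

theorem jetChart_trans_source [IsFibredOverReal n π] {e e' : OpenPartialHomeomorph E (ℝ × Vec n)}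
    (he : IsAdapted π e) (he' : IsAdapted π e') :
    ((jetChart r e he).symm.trans (jetChart r e' he')).source =
      {z : JetCoord n r | (z.1, z.2 0) ∈ e.target ∩ e.symm ⁻¹' e'.source} := by
  ext z
  simp only [PartialEquiv.trans_source, PartialEquiv.symm_source]
  refine and_congr_right fun hz => ?_
  have hz' : (z.1, z.2 0) ∈ e.target := hz
  change (jetOfCoord he z).point ∈ e'.source ↔ _
  rw [jetOfCoord_of_mem he z hz']
  change (LocalSection.ofCoord he z hz').point ∈ _ ↔ _
  rw [LocalSection.ofCoord_point]
  rfl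

theorem isOpen_jetChart_trans_source [IsFibredOverReal n π]
    {e e' : OpenPartialHomeomorph E (ℝ × Vec n)} (he : IsAdapted π e) (he' : IsAdapted π e') :
    IsOpen ((jetChart r e he).symm.trans (jetChart r e' he')).source := by
  rw [jetChart_trans_source]
  exact (e.isOpen_inter_preimage_symm e'.open_source).preimage (by fun_prop)

theorem contDiffOn_jetCoord_change {O : Set (ℝ × Vec n)} (hO : IsOpen O)
    {G : ℝ × Vec n → Vec n} (hG : ContDiffOn ℝ ∞ G O) :
    ContDiffOn ℝ ∞ (fun z : JetCoord n r => ((z.1, fun i : Fin (r + 1) =>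
      iteratedDeriv i (fun s => G (s, taylorCurve z s)) z.1) : JetCoord n r))
      {z | (z.1, z.2 0) ∈ O} := by
  have htc : ContDiff ℝ ∞ (fun p : JetCoord n r × ℝ => (p.2, taylorCurve p.1 p.2)) :=
    contDiff_snd.prodMk contDiff_taylorCurve
  have hU : IsOpen ((fun p : JetCoord n r × ℝ => (p.2, taylorCurve p.1 p.2)) ⁻¹' O) :=
    hO.preimage htc.continuous
  have hH : ∀ i, ContDiffOn ℝ ∞ (fun p : JetCoord n r × ℝ =>
      iteratedDeriv i (fun s => G (s, taylorCurve p.1 s)) p.2)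
      ((fun p : JetCoord n r × ℝ => (p.2, taylorCurve p.1 p.2)) ⁻¹' O) := fun i =>
    contDiffOn_iteratedDeriv_param hU (hG.comp htc.contDiffOn (fun p hp => hp)) i
  have hd : ContDiff ℝ ∞ (fun z : JetCoord n r => (z, z.1)) := contDiff_id.prodMk contDiff_fst
  have h0 : ∀ z : JetCoord n r, taylorCurve z z.1 = z.2 0 := fun z => by
    simpa using iteratedDeriv_taylorCurve z 0
  have hmaps : MapsTo (fun z : JetCoord n r => (z, z.1)) {z | (z.1, z.2 0) ∈ O}
      ((fun p : JetCoord n r × ℝ => (p.2, taylorCurve p.1 p.2)) ⁻¹' O) := by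
    intro z hz
    change (z.1, taylorCurve z z.1) ∈ O
    rw [h0]; exact hz
  have h9 : ∀ i : Fin (r + 1), ContDiffOn ℝ ∞ (fun z : JetCoord n r =>
      iteratedDeriv i (fun s => G (s, taylorCurve z s)) z.1) {z | (z.1, z.2 0) ∈ O} := by
    intro i
    have h8 := (hH i).comp hd.contDiffOn hmaps
    exact h8
  have h7 : ContDiffOn ℝ ∞ (fun z : JetCoord n r => z.1) {z | (z.1, z.2 0) ∈ O} :=
    contDiff_fst.contDiffOn
  exact h7.prodMk (contDiffOn_pi.2 h9)

theorem jetChart_trans_eq [IsFibredOverReal n π]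
    {e e' : OpenPartialHomeomorph E (ℝ × Vec n)} (he : IsAdapted π e) (he' : IsAdapted π e')
    (z : JetCoord n r) (hz : (z.1, z.2 0) ∈ e.target ∩ e.symm ⁻¹' e'.source) :
    (jetChart r e he).symm.trans (jetChart r e' he') z = (z.1, fun i : Fin (r + 1) =>
      iteratedDeriv i (fun s => (e' (e.symm (s, taylorCurve z s))).2) z.1) := by
  have hz' : (z.1, z.2 0) ∈ e.target := hz.1
  have hpt : (LocalSection.ofCoord he z hz').point ∈ e'.source := by
    rw [LocalSection.ofCoord_point]; exact hz.2
  have h4 : (jetChart r e he).symm z = Jet.mk r (LocalSection.ofCoord he z hz') :=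
    jetOfCoord_of_mem he z hz'
  have h5 : (jetChart r e he).symm.trans (jetChart r e' he') z =
      jetChart r e' he' (Jet.mk r (LocalSection.ofCoord he z hz')) := by
    rw [← h4]; rfl
  rw [h5]
  refine Prod.ext rfl (funext fun i => ?_)
  exact jetCoord_mk he' (LocalSection.ofCoord he z hz') hpt (Nat.lt_succ_iff.1 i.2)

theorem contDiffOn_jetChart_trans [IsFibredOverReal n π]
    {e e' : OpenPartialHomeomorph E (ℝ × Vec n)} (he : IsAdapted π e) (he' : IsAdapted π e') :
    ContDiffOn ℝ ∞ ((jetChart r e he).symm.trans (jetChart r e' he'))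
      ((jetChart r e he).symm.trans (jetChart r e' he')).source := by
  have hG : ContDiffOn ℝ ∞ (fun w => (e' (e.symm w)).2) (e.target ∩ e.symm ⁻¹' e'.source) :=
    contDiff_snd.comp_contDiffOn (((contMDiffOn_of_mem_maximalAtlas he'.mem).comp
      ((contMDiffOn_symm_of_mem_maximalAtlas he.mem).mono inter_subset_left)
      (fun w hw => hw.2)).contDiffOn)
  rw [jetChart_trans_source]
  exact (contDiffOn_jetCoord_change (r := r) (e.isOpen_inter_preimage_symm e'.open_source)
    hG).congr fun z hz => jetChart_trans_eq he he' z hz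

/-- The chosen adapted chart around a point of `E`. -/
noncomputable def adaptedChart (π : E → ℝ) [IsFibredOverReal n π] (x : E) :
    OpenPartialHomeomorph E (ℝ × Vec n) := (exists_isAdapted π x).choose

theorem adaptedChart_isAdapted (π : E → ℝ) [IsFibredOverReal n π] (x : E) :
    IsAdapted π (adaptedChart (n := n) π x) := (exists_isAdapted π x).choose_spec.1

theorem mem_adaptedChart_source (π : E → ℝ) [IsFibredOverReal n π] (x : E) :
    x ∈ (adaptedChart (n := n) π x).source := (exists_isAdapted π x).choose_spec.2

/-- The atlas of natural charts of `J^r π`. -/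
noncomputable def jetCore (n : ℕ) [ChartedSpace (ℝ × Vec n) E]
    [IsManifold 𝓘(ℝ, ℝ × Vec n) ∞ E] (π : E → ℝ) [IsFibredOverReal n π] (r : ℕ) :
    ChartedSpaceCore (JetCoord n r) (Jet n π r) where
  atlas := {c | ∃ (e : OpenPartialHomeomorph E (ℝ × Vec n)) (he : IsAdapted π e),
    c = jetChart r e he}
  chartAt y := jetChart r (adaptedChart π y.point) (adaptedChart_isAdapted π y.point)
  mem_chart_source y := mem_adaptedChart_source π y.point
  chart_mem_atlas y := ⟨_, adaptedChart_isAdapted π y.point, rfl⟩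
  open_source := by
    rintro _ _ ⟨e, he, rfl⟩ ⟨e', he', rfl⟩
    exact isOpen_jetChart_trans_source he he'
  continuousOn_toFun := by
    rintro _ _ ⟨e, he, rfl⟩ ⟨e', he', rfl⟩
    exact (contDiffOn_jetChart_trans he he').continuousOn

noncomputable instance [IsFibredOverReal n π] : TopologicalSpace (Jet n π r) :=
  (jetCore n π r).toTopologicalSpace

noncomputable instance [IsFibredOverReal n π] : ChartedSpace (JetCoord n r) (Jet n π r) :=
  (jetCore n π r).toChartedSpace

instance [IsFibredOverReal n π] : IsManifold 𝓘(ℝ, JetCoord n r) ∞ (Jet n π r) := by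
  refine isManifold_of_contDiffOn _ _ _ ?_
  intro e e' he he'
  obtain ⟨_, ⟨c, rfl⟩, he⟩ := he
  obtain ⟨_, ⟨c', rfl⟩, he'⟩ := he'
  simp only [mem_iUnion, mem_singleton_iff] at he he'
  obtain ⟨⟨f, hf, rfl⟩, rfl⟩ := he
  obtain ⟨⟨f', hf', rfl⟩, rfl⟩ := he'
  simp only [modelWithCornersSelf_coe, modelWithCornersSelf_coe_symm, range_id, inter_univ,
    preimage_id]
  exact contDiffOn_jetChart_trans hf hf'

end Jets

section Cotangent

variable (V : Type*) [NormedAddCommGroup V] [NormedSpace ℝ V]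
  (M : Type*) [TopologicalSpace M] [ChartedSpace V M] [IsManifold 𝓘(ℝ, V) ∞ M]

/-- The cotangent bundle of a manifold. -/
abbrev CotangentBundle : Type _ :=
  Bundle.TotalSpace (V →L[ℝ] ℝ)
    (fun q : M => TangentSpace 𝓘(ℝ, V) q →L[ℝ] Bundle.Trivial M ℝ q)

/-- The model with corners of the cotangent bundle. -/
noncomputable abbrev cotangentModel :
    ModelWithCorners ℝ (V × (V →L[ℝ] ℝ)) (ModelProd V (V →L[ℝ] ℝ)) :=
  𝓘(ℝ, V).prod 𝓘(ℝ, V →L[ℝ] ℝ)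

variable {V M}

/-- The canonical one-form `Θ` of the cotangent bundle: `Θ_α(v) = α (Tπ v)`. -/
noncomputable def canonicalOneForm (α : CotangentBundle V M) :
    TangentSpace (cotangentModel V) α →ₗ[ℝ] ℝ :=
  ((α.2 : V →L[ℝ] ℝ).comp
    (mfderiv (cotangentModel V) 𝓘(ℝ, V)
      (Bundle.TotalSpace.proj : CotangentBundle V M → M) α : V × (V →L[ℝ] ℝ) →L[ℝ] V)).toLinearMap

end Cotangent

section ExteriorDerivative

variable {V H : Type*} [NormedAddCommGroup V] [NormedSpace ℝ V] [TopologicalSpace H]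
  (I : ModelWithCorners ℝ V H) {M : Type*} [TopologicalSpace M] [ChartedSpace H M]

/-- The component along `v` of a one-form, in the preferred chart at `x`, at the coordinate point `z`. -/
noncomputable def oneFormInChart (θ : ∀ x : M, TangentSpace I x →ₗ[ℝ] ℝ) (x : M) (z v : V) : ℝ :=
  θ ((extChartAt I x).symm z) (mfderiv 𝓘(ℝ, V) I (extChartAt I x).symm z v)

/-- The exterior derivative of a one-form: `dθ(u, v) = u (θ v) - v (θ u)` for `u`, `v` extended with
constant components in the preferred chart at `x`. (Tangent vectors at `x` are identified with
elements of the model space through that chart.) -/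
noncomputable def oneFormExtDeriv (θ : ∀ x : M, TangentSpace I x →ₗ[ℝ] ℝ) (x : M)
    (u v : TangentSpace I x) : ℝ :=
  fderiv ℝ (fun z => oneFormInChart I θ x z v) (extChartAt I x x) u -
    fderiv ℝ (fun z => oneFormInChart I θ x z u) (extChartAt I x x) v

end ExteriorDerivative

/-- The canonical symplectic form `Ω = -dΘ` of a cotangent bundle. -/
noncomputable def canonicalTwoForm {V : Type*} [NormedAddCommGroup V] [NormedSpace ℝ V]
    {M : Type*} [TopologicalSpace M] [ChartedSpace V M] [IsManifold 𝓘(ℝ, V) ∞ M]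
    (α : CotangentBundle V M) (u v : TangentSpace (cotangentModel V) α) : ℝ :=
  -oneFormExtDeriv (cotangentModel V) canonicalOneForm α u v

section Submanifolds

variable {V H : Type*} [NormedAddCommGroup V] [NormedSpace ℝ V] [TopologicalSpace H]
  (I : ModelWithCorners ℝ V H) {M : Type*} [TopologicalSpace M] [ChartedSpace H M]

/-- `S` is an embedded submanifold: near each of its points it is a linear slice in some chart. -/
def IsEmbeddedSubmanifold (S : Set M) : Prop :=
  ∀ x ∈ S, ∃ e ∈ IsManifold.maximalAtlas I ∞ M, x ∈ e.source ∧
    ∃ F : Submodule ℝ V, ∀ y ∈ e.source, y ∈ S ↔ e.extend I y ∈ F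

/-- `v` is tangent to `S` at `x`: it is the velocity of a curve in `S` that is smooth at `0`. -/
def IsTangentTo (S : Set M) (x : M) (v : TangentSpace I x) : Prop :=
  ∃ γ : ℝ → M, γ 0 = x ∧ ContMDiffAt 𝓘(ℝ, ℝ) I ∞ γ 0 ∧ (∀ᶠ s in 𝓝 (0 : ℝ), γ s ∈ S) ∧
    HasMFDerivAt 𝓘(ℝ, ℝ) I γ 0 (ContinuousLinearMap.toSpanSingleton ℝ (v : V))

/-- `Y` restricts to a smooth vector field on the submanifold `S`, i.e. it is smooth along `S` and
tangent to `S`. The values of `Y` outside `S` are irrelevant. -/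
structure IsVectorFieldOn [IsManifold I ∞ M] (S : Set M) (Y : ∀ x : M, TangentSpace I x) : Prop where
  smooth : ContMDiffOn I I.tangent ∞ (fun x => (⟨x, Y x⟩ : TangentBundle I M)) S
  tangent : ∀ x ∈ S, IsTangentTo I S x (Y x)

end Submanifolds

section ReducedDual

variable {n : ℕ} {E : Type*} [TopologicalSpace E] [ChartedSpace (ℝ × Vec n) E]
  [IsManifold 𝓘(ℝ, ℝ × Vec n) ∞ E] {π : E → ℝ} [IsFibredOverReal n π] {r : ℕ}

/-- All charts of the jet manifold have the time as first coordinate. -/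
theorem fst_atlas_apply (i : atlas (JetCoord n r) (Jet n π r)) (y : Jet n π r) :
    (i.1 y).1 = y.time := by
  obtain ⟨i, _, ⟨c, rfl⟩, hi⟩ := i
  simp only [mem_iUnion, mem_singleton_iff] at hi
  obtain ⟨⟨e, he, rfl⟩, rfl⟩ := hi
  rfl

theorem fst_coordChange (i j : atlas (JetCoord n r) (Jet n π r)) {x : Jet n π r}
    (hi : x ∈ i.1.source) (hj : x ∈ j.1.source) (v : JetCoord n r) :
    ((tangentBundleCore 𝓘(ℝ, JetCoord n r) (Jet n π r)).coordChange i j x v).1 = v.1 := by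
  rw [tangentBundleCore_coordChange]
  simp only [modelWithCornersSelf_coe, range_id, fderivWithin_univ,
    OpenPartialHomeomorph.extend_coe, OpenPartialHomeomorph.extend_coe_symm,
    modelWithCornersSelf_coe_symm, Function.id_comp, Function.comp_id]
  have hd : DifferentiableAt ℝ (j.1 ∘ i.1.symm) (i.1 x) := by
    have h1 := contMDiffAt_symm_of_mem_maximalAtlas (I := 𝓘(ℝ, JetCoord n r)) (n := ∞)
      (IsManifold.subset_maximalAtlas i.2) (i.1.map_source hi)
    have h2 := contMDiffAt_of_mem_maximalAtlas (I := 𝓘(ℝ, JetCoord n r)) (n := ∞)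
      (IsManifold.subset_maximalAtlas j.2) hj
    rw [← i.1.left_inv hi] at h2
    exact (h2.comp _ h1).contDiffAt.differentiableAt (by simp)
  have h3 : (Prod.fst ∘ (j.1 ∘ i.1.symm)) =ᶠ[𝓝 (i.1 x)] Prod.fst := by
    filter_upwards [i.1.open_target.mem_nhds (i.1.map_source hi)] with z hz
    simp only [Function.comp_apply]
    rw [fst_atlas_apply, ← fst_atlas_apply i, i.1.right_inv hz]
  have h4 := (ContinuousLinearMap.fst ℝ ℝ (Fin (r + 1) → Vec n)).hasFDerivAt.comp (i.1 x)
    hd.hasFDerivAt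
  have h5 := (h3.hasFDerivAt_iff.1 h4).unique
    (ContinuousLinearMap.fst ℝ ℝ (Fin (r + 1) → Vec n)).hasFDerivAt
  exact DFunLike.congr_fun h5 v

/-- The derivative of a change of natural charts, restricted to vectors vertical over `ℝ`. -/
noncomputable def verticalCoordChange (i j : atlas (JetCoord n r) (Jet n π r)) (x : Jet n π r) :
    (Fin (r + 1) → Vec n) →L[ℝ] (Fin (r + 1) → Vec n) :=
  ((ContinuousLinearMap.snd ℝ ℝ (Fin (r + 1) → Vec n)).comp
    ((tangentBundleCore 𝓘(ℝ, JetCoord n r) (Jet n π r)).coordChange i j x)).comp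
    (ContinuousLinearMap.inr ℝ ℝ (Fin (r + 1) → Vec n))

theorem inr_verticalCoordChange (i j : atlas (JetCoord n r) (Jet n π r)) {x : Jet n π r}
    (hi : x ∈ i.1.source) (hj : x ∈ j.1.source) (v : Fin (r + 1) → Vec n) :
    ((0, verticalCoordChange i j x v) : JetCoord n r) =
      (tangentBundleCore 𝓘(ℝ, JetCoord n r) (Jet n π r)).coordChange i j x (0, v) :=
  Prod.ext (fst_coordChange i j hi hj (0, v)).symm rfl

theorem contMDiffOn_verticalCoordChange (i j : atlas (JetCoord n r) (Jet n π r)) :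
    ContMDiffOn 𝓘(ℝ, JetCoord n r)
      𝓘(ℝ, (Fin (r + 1) → Vec n) →L[ℝ] (Fin (r + 1) → Vec n)) ∞
      (verticalCoordChange i j) (i.1.source ∩ j.1.source) := by
  have : IsManifold 𝓘(ℝ, JetCoord n r) (∞ + 1) (Jet n π r) :=
    inferInstanceAs (IsManifold 𝓘(ℝ, JetCoord n r) ∞ (Jet n π r))
  have h := (tangentBundleCore.isContMDiff (I := 𝓘(ℝ, JetCoord n r)) (M := Jet n π r)
    (n := ∞)).contMDiffOn_coordChange i j
  exact (contMDiffOn_const.clm_comp h).clm_comp contMDiffOn_const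

/-- The vector bundle `T*(J^r π) / ⟨dt⟩` over `J^r π`. Since `⟨dt⟩` is the annihilator of the vectors
vertical over `ℝ`, its fibre is the dual of the space of vertical vectors. It is glued from the
natural charts. -/
noncomputable def reducedDualCore (n : ℕ) [ChartedSpace (ℝ × Vec n) E]
    [IsManifold 𝓘(ℝ, ℝ × Vec n) ∞ E] (π : E → ℝ) [IsFibredOverReal n π] (r : ℕ) :
    VectorBundleCore ℝ (Jet n π r) ((Fin (r + 1) → Vec n) →L[ℝ] ℝ)
      (atlas (JetCoord n r) (Jet n π r)) where
  baseSet i := i.1.source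
  isOpen_baseSet i := i.1.open_source
  indexAt := achart (JetCoord n r)
  mem_baseSet_at := mem_chart_source (JetCoord n r)
  coordChange i j x := (ContinuousLinearMap.compL ℝ (Fin (r + 1) → Vec n) (Fin (r + 1) → Vec n)
    ℝ).flip (verticalCoordChange j i x)
  coordChange_self i x hx β := by
    ext v
    have h := inr_verticalCoordChange i i hx hx v
    rw [(tangentBundleCore 𝓘(ℝ, JetCoord n r) (Jet n π r)).coordChange_self i x hx] at h
    exact congrArg β (congrArg Prod.snd h)
  continuousOn_coordChange i j := by
    refine ((ContinuousLinearMap.compL ℝ (Fin (r + 1) → Vec n) (Fin (r + 1) → Vec n)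
      ℝ).flip.continuous.comp_continuousOn (contMDiffOn_verticalCoordChange j i).continuousOn).mono
      ?_
    exact fun x hx => ⟨hx.2, hx.1⟩
  coordChange_comp i j k x hx β := by
    obtain ⟨⟨hi, hj⟩, hk⟩ := hx
    ext v
    have h1 := inr_verticalCoordChange k i hk hi v
    have h2 := inr_verticalCoordChange j i hj hi (verticalCoordChange k j x v)
    rw [inr_verticalCoordChange k j hk hj v,
      (tangentBundleCore 𝓘(ℝ, JetCoord n r) (Jet n π r)).coordChange_comp k j i x
        ⟨⟨hk, hj⟩, hi⟩, ← h1] at h2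
    have h3 : verticalCoordChange j i x (verticalCoordChange k j x v) =
        verticalCoordChange k i x v := (Prod.mk.inj h2).2
    exact congrArg β h3

instance : (reducedDualCore n π r).IsContMDiff 𝓘(ℝ, JetCoord n r) ∞ where
  contMDiffOn_coordChange i j :=
    (ContinuousLinearMap.contMDiff _).comp_contMDiffOn
      ((contMDiffOn_verticalCoordChange j i).mono fun _ hx => ⟨hx.2, hx.1⟩)

/-- The total space `J^r π* = T*(J^r π) / ⟨dt⟩`. -/
abbrev ReducedDual (n : ℕ) [ChartedSpace (ℝ × Vec n) E]
    [IsManifold 𝓘(ℝ, ℝ × Vec n) ∞ E] (π : E → ℝ) [IsFibredOverReal n π] (r : ℕ) : Type _ :=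
  Bundle.TotalSpace ((Fin (r + 1) → Vec n) →L[ℝ] ℝ) (reducedDualCore n π r).Fiber

/-- The model with corners of `J^r π*`. -/
noncomputable abbrev reducedDualModel (n r : ℕ) :
    ModelWithCorners ℝ (JetCoord n r × ((Fin (r + 1) → Vec n) →L[ℝ] ℝ))
      (ModelProd (JetCoord n r) ((Fin (r + 1) → Vec n) →L[ℝ] ℝ)) :=
  𝓘(ℝ, JetCoord n r).prod 𝓘(ℝ, (Fin (r + 1) → Vec n) →L[ℝ] ℝ)

/-- The quotient map `μ : T*(J^r π) → J^r π*`, i.e. the restriction of covectors to vertical vectors. -/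
noncomputable def reducedProj (α : CotangentBundle (JetCoord n r) (Jet n π r)) :
    ReducedDual n π r :=
  ⟨α.1, ((α.2 : JetCoord n r →L[ℝ] ℝ).comp
    (ContinuousLinearMap.inr ℝ ℝ (Fin (r + 1) → Vec n)))⟩

theorem hasMFDerivAt_time (q : Jet n π r) :
    HasMFDerivAt 𝓘(ℝ, JetCoord n r) 𝓘(ℝ, ℝ) (Jet.time : Jet n π r → ℝ) q
      (ContinuousLinearMap.fst ℝ ℝ (Fin (r + 1) → Vec n)) := by
  have h1 : ∀ y : Jet n π r, y.time = (chartAt (JetCoord n r) q y).1 := fun y =>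
    (fst_atlas_apply ⟨_, chart_mem_atlas (JetCoord n r) q⟩ y).symm
  refine ⟨?_, ?_⟩
  · have h2 := continuous_fst.continuousAt.comp
      ((chartAt (JetCoord n r) q).continuousAt (mem_chart_source (JetCoord n r) q))
    exact h2.congr (Filter.Eventually.of_forall fun y => (h1 y).symm)
  · refine (ContinuousLinearMap.fst ℝ ℝ (Fin (r + 1) → Vec n)).hasFDerivWithinAt.congr_of_eventuallyEq
      ?_ ?_
    · refine mem_nhdsWithin_of_mem_nhds ?_
      filter_upwards [(chartAt (JetCoord n r) q).open_target.mem_nhds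
        ((chartAt (JetCoord n r) q).map_source (mem_chart_source (JetCoord n r) q))] with z hz
      change ((chartAt (JetCoord n r) q).symm z).time = z.1
      rw [h1, (chartAt (JetCoord n r) q).right_inv hz]
    · change ((chartAt (JetCoord n r) q).symm (chartAt (JetCoord n r) q q)).time =
        (chartAt (JetCoord n r) q q).1
      rw [(chartAt (JetCoord n r) q).left_inv (mem_chart_source (JetCoord n r) q), h1]

theorem reducedProj_surjective :
    Function.Surjective (reducedProj : CotangentBundle (JetCoord n r) (Jet n π r) → _) := by
  rintro ⟨q, β⟩
  exact ⟨⟨q, (β : (Fin (r + 1) → Vec n) →L[ℝ] ℝ).comp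
    (ContinuousLinearMap.snd ℝ ℝ (Fin (r + 1) → Vec n))⟩, rfl⟩

/-- `μ` is the quotient by the multiples of `dt`. -/
theorem reducedProj_eq_iff (q : Jet n π r) (α β : JetCoord n r →L[ℝ] ℝ) :
    reducedProj (⟨q, α⟩ : CotangentBundle (JetCoord n r) (Jet n π r)) = reducedProj ⟨q, β⟩ ↔
      ∃ c : ℝ, α - β = c • mfderiv 𝓘(ℝ, JetCoord n r) 𝓘(ℝ, ℝ) (Jet.time : Jet n π r → ℝ) q := by
  rw [(hasMFDerivAt_time q).mfderiv]
  have h0 : ∀ c : ℝ, (α - β = c • ContinuousLinearMap.fst ℝ ℝ (Fin (r + 1) → Vec n)) ↔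
      (α - β = c • ContinuousLinearMap.fst ℝ ℝ (Fin (r + 1) → Vec n)) := fun _ => Iff.rfl
  constructor
  · intro h
    have h1 : α.comp (ContinuousLinearMap.inr ℝ ℝ (Fin (r + 1) → Vec n)) =
        β.comp (ContinuousLinearMap.inr ℝ ℝ (Fin (r + 1) → Vec n)) :=
      eq_of_heq (Bundle.TotalSpace.mk.inj h).2
    refine ⟨(α - β) (1, 0), (h0 _).2 ?_⟩
    ext v
    · simp
    · have := DFunLike.congr_fun h1 v
      simpa [sub_eq_zero] using this
  · rintro ⟨c, h⟩
    have h1 : α.comp (ContinuousLinearMap.inr ℝ ℝ (Fin (r + 1) → Vec n)) =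
        β.comp (ContinuousLinearMap.inr ℝ ℝ (Fin (r + 1) → Vec n)) := by
      ext v
      have := DFunLike.congr_fun ((h0 c).1 h) (0, v)
      simpa [sub_eq_zero] using this
    exact congrArg (Bundle.TotalSpace.mk q) h1


end ReducedDual

section LegendreMap

variable {n m : ℕ} {E : Type*} [TopologicalSpace E] [ChartedSpace (ℝ × Vec n) E]
  [IsManifold 𝓘(ℝ, ℝ × Vec n) ∞ E] {π : E → ℝ} [IsFibredOverReal n π]

/-- The total time derivative `d_T f = ∂f/∂t + ∑ q_{i+1} ∂f/∂q_i` in natural coordinates. It is only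
applied to functions that do not depend on the coordinate `q_s` of highest order. -/
noncomputable def totalTimeDeriv {n s : ℕ} {W : Type*} [NormedAddCommGroup W] [NormedSpace ℝ W]
    (f : JetCoord n s → W) (z : JetCoord n s) : W :=
  fderiv ℝ f z (1, fun i => if h : (i : ℕ) + 1 < s + 1 then z.2 ⟨i + 1, h⟩ else 0)

/-- The partial derivative `∂f/∂q_i`. -/
noncomputable def partialCoord {n s : ℕ} (f : JetCoord n s → ℝ) (i : Fin (s + 1))
    (z : JetCoord n s) : Vec n →L[ℝ] ℝ :=
  (fderiv ℝ f z).comp ((ContinuousLinearMap.inr ℝ ℝ (Fin (s + 1) → Vec n)).comp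
    (ContinuousLinearMap.single ℝ (fun _ : Fin (s + 1) => Vec n) i))

/-- The Lagrangian function in natural coordinates, as a function on `J^{2k-1} π` with `k = m + 1`. -/
noncomputable def lagrangianInChart (L : Jet n π (m + 1) → ℝ)
    (e : OpenPartialHomeomorph E (ℝ × Vec n)) (he : IsAdapted π e)
    (z : JetCoord n (2 * m + 1)) : ℝ :=
  L ((jetChart (m + 1) e he).symm (z.1, fun i => z.2 (Fin.castLE (by omega) i)))

/-- The momentum `p^i = ∑_{j = 0}^{m - i} (-1)^j d_T^j (∂L/∂q_{i+1+j})`, for `0 ≤ i ≤ m = k - 1`. -/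
noncomputable def momentum (L : Jet n π (m + 1) → ℝ)
    (e : OpenPartialHomeomorph E (ℝ × Vec n)) (he : IsAdapted π e) (i : Fin (m + 1))
    (z : JetCoord n (2 * m + 1)) : Vec n →L[ℝ] ℝ :=
  ∑ j : Fin (m + 1 - i), (-1 : ℝ) ^ (j : ℕ) •
    totalTimeDeriv^[j] (partialCoord (lagrangianInChart L e he) ⟨i + 1 + j, by omega⟩) z

/-- The momentum `p = L - ∑_i q_{i+1} p^i` conjugate to the time. -/
noncomputable def timeMomentum (L : Jet n π (m + 1) → ℝ)
    (e : OpenPartialHomeomorph E (ℝ × Vec n)) (he : IsAdapted π e)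
    (z : JetCoord n (2 * m + 1)) : ℝ :=
  lagrangianInChart L e he z -
    ∑ i : Fin (m + 1), momentum L e he i z (z.2 ⟨i + 1, by omega⟩)

/-- The extended Legendre-Ostrogradsky map `J^{2k-1} π → T*(J^{k-1} π)`, `k = m + 1`, sending `y` to the
covector `p dt + ∑_i p^i dq_i`. The covector is written in the natural chart over the chosen adapted
chart around the point `y.point`; this is also the preferred chart of `J^{k-1} π` at the projection
of `y`, through which its tangent space is identified with `JetCoord n m`. -/
noncomputable def extendedLegendre (L : Jet n π (m + 1) → ℝ) (y : Jet n π (2 * m + 1)) :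
    CotangentBundle (JetCoord n m) (Jet n π m) :=
  let e := adaptedChart (n := n) π y.point
  let he := adaptedChart_isAdapted (n := n) π y.point
  let z := jetChart (2 * m + 1) e he y
  ⟨y.proj (by omega), (timeMomentum L e he z • ContinuousLinearMap.fst ℝ ℝ (Fin (m + 1) → Vec n) +
    ∑ i : Fin (m + 1), (momentum L e he i z).comp
      ((ContinuousLinearMap.proj i).comp (ContinuousLinearMap.snd ℝ ℝ (Fin (m + 1) → Vec n))) :
    JetCoord n m →L[ℝ] ℝ)⟩

/-- The restricted Legendre-Ostrogradsky map `FL : J^{2k-1} π → J^{k-1} π*`. -/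
noncomputable def restrictedLegendre (L : Jet n π (m + 1) → ℝ) (y : Jet n π (2 * m + 1)) :
    ReducedDual n π m :=
  reducedProj (extendedLegendre L y)

/-- Almost-regular Lagrangians: the image of `FL` is a closed submanifold, `FL` is a submersion onto
its image, and the fibres of `FL` are connected submanifolds. -/
structure IsAlmostRegular (L : Jet n π (m + 1) → ℝ) : Prop where
  isClosed_range : IsClosed (range (restrictedLegendre L))
  isEmbeddedSubmanifold_range :
    IsEmbeddedSubmanifold (reducedDualModel n m) (range (restrictedLegendre L))
  contMDiff : ContMDiff 𝓘(ℝ, JetCoord n (2 * m + 1)) (reducedDualModel n m) ∞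
    (restrictedLegendre L)
  isSubmersion : ∀ (y : Jet n π (2 * m + 1))
    (v : TangentSpace (reducedDualModel n m) (restrictedLegendre L y)),
    IsTangentTo (reducedDualModel n m) (range (restrictedLegendre L)) (restrictedLegendre L y) v →
    ∃ u, mfderiv 𝓘(ℝ, JetCoord n (2 * m + 1)) (reducedDualModel n m) (restrictedLegendre L) y u = v
  isConnected_fibre : ∀ y : Jet n π (2 * m + 1),
    IsConnected (restrictedLegendre L ⁻¹' {restrictedLegendre L y})
  isEmbeddedSubmanifold_fibre : ∀ y : Jet n π (2 * m + 1),
    IsEmbeddedSubmanifold 𝓘(ℝ, JetCoord n (2 * m + 1))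
      (restrictedLegendre L ⁻¹' {restrictedLegendre L y})

end LegendreMap

section Unified

variable {n m : ℕ} {E : Type*} [TopologicalSpace E] [ChartedSpace (ℝ × Vec n) E]
  [IsManifold 𝓘(ℝ, ℝ × Vec n) ∞ E] {π : E → ℝ} [IsFibredOverReal n π]

/-- The product `J^{2k-1} π × T*(J^{k-1} π)`, `k = m + 1`. The unified phase space `W` is the fibred
product over `J^{k-1} π` inside it; see `hamiltonianSubmanifold`. -/
abbrev UnifiedSpace (n : ℕ) [ChartedSpace (ℝ × Vec n) E] [IsManifold 𝓘(ℝ, ℝ × Vec n) ∞ E]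
    (π : E → ℝ) [IsFibredOverReal n π] (m : ℕ) : Type _ :=
  Jet n π (2 * m + 1) × CotangentBundle (JetCoord n m) (Jet n π m)

/-- The model with corners of the product `J^{2k-1} π × T*(J^{k-1} π)`. -/
noncomputable abbrev unifiedModel (n m : ℕ) :=
  𝓘(ℝ, JetCoord n (2 * m + 1)).prod (cotangentModel (JetCoord n m))

/-- The coupling function `C(y, α) = α (T(j^{k-1}φ) (∂/∂t))`, with `φ` a representative of `y`. -/
noncomputable def coupling (w : UnifiedSpace n π m) : ℝ :=
  (w.2.2 : JetCoord n m →L[ℝ] ℝ)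
    (mfderiv 𝓘(ℝ, ℝ) 𝓘(ℝ, JetCoord n m) (jetProlongation n π m w.1.rep.toFun) w.1.rep.time
      (1 : ℝ) : JetCoord n m)

/-- The submanifold `W_o` of the fibred product `W` on which the coupling function equals the
Lagrangian. -/
def hamiltonianSubmanifold (L : Jet n π (m + 1) → ℝ) : Set (UnifiedSpace n π m) :=
  {w | w.1.proj (by omega) = w.2.1 ∧ coupling w = L (w.1.proj (by omega))}

/-- The pull-back `Ω_o` of the canonical two-form of `T*(J^{k-1} π)` along the second projection. -/
noncomputable def unifiedTwoForm (w : UnifiedSpace n π m)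
    (u v : TangentSpace (unifiedModel n m) w) : ℝ :=
  canonicalTwoForm w.2
    (mfderiv (unifiedModel n m) (cotangentModel (JetCoord n m))
      (Prod.snd : UnifiedSpace n π m → _) w u)
    (mfderiv (unifiedModel n m) (cotangentModel (JetCoord n m))
      (Prod.snd : UnifiedSpace n π m → _) w v)

/-- `ψ` is a smooth section of `W_o → ℝ`. -/
structure IsUnifiedSection (L : Jet n π (m + 1) → ℝ) (ψ : ℝ → UnifiedSpace n π m) : Prop where
  contMDiff : ContMDiff 𝓘(ℝ, ℝ) (unifiedModel n m) ∞ ψ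
  mem : ∀ t, ψ t ∈ hamiltonianSubmanifold L
  time_eq : ∀ t, (ψ t).1.time = t

/-- `ψ^* i(Y) Ω_o = 0` for every vector field `Y` on `W_o`. -/
def SolvesUnifiedEquation (L : Jet n π (m + 1) → ℝ) (ψ : ℝ → UnifiedSpace n π m) : Prop :=
  ∀ Y : ∀ w : UnifiedSpace n π m, TangentSpace (unifiedModel n m) w,
    IsVectorFieldOn (unifiedModel n m) (hamiltonianSubmanifold L) Y →
    ∀ (t : ℝ) (τ : TangentSpace 𝓘(ℝ, ℝ) t),
      unifiedTwoForm (ψ t) (Y (ψ t)) (mfderiv 𝓘(ℝ, ℝ) (unifiedModel n m) ψ t τ) = 0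

/-- The section `σ` of `J^r π → ℝ` is the prolongation of its projection to `E`. -/
def IsHolonomic (n : ℕ) [ChartedSpace (ℝ × Vec n) E] [IsManifold 𝓘(ℝ, ℝ × Vec n) ∞ E]
    (π : E → ℝ) [IsFibredOverReal n π] {r : ℕ} (σ : ℝ → Jet n π r) : Prop :=
  σ = jetProlongation n π r (fun t => (σ t).point)

/-- The graph `W_1` of the extended Legendre-Ostrogradsky map. -/
def legendreGraph (L : Jet n π (m + 1) → ℝ) : Set (UnifiedSpace n π m) :=
  {w | w.2 = extendedLegendre L w.1}

open Classical in
/-- The Hamiltonian section `h` on `P = Im FL`, determined by `h (FL y) = FL~ y` where `FL~` is the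
extended Legendre-Ostrogradsky map. It has a junk value outside `P`. -/
noncomputable def hamiltonianSection (L : Jet n π (m + 1) → ℝ) (p : ReducedDual n π m) :
    CotangentBundle (JetCoord n m) (Jet n π m) :=
  if hp : ∃ y, restrictedLegendre L y = p then extendedLegendre L hp.choose
  else ⟨p.1, (0 : JetCoord n m →L[ℝ] ℝ)⟩

/-- The Hamilton-Cartan form `Ω_h^o = h^* Ω` on `P = Im FL`, evaluated on vectors tangent to `P`. -/
noncomputable def hamiltonCartanForm (L : Jet n π (m + 1) → ℝ) (p : ReducedDual n π m)
    (u v : TangentSpace (reducedDualModel n m) p) : ℝ :=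
  canonicalTwoForm (hamiltonianSection L p)
    (mfderivWithin (reducedDualModel n m) (cotangentModel (JetCoord n m)) (hamiltonianSection L)
      (range (restrictedLegendre L)) p u)
    (mfderivWithin (reducedDualModel n m) (cotangentModel (JetCoord n m)) (hamiltonianSection L)
      (range (restrictedLegendre L)) p v)

/-- `σ` is a smooth section of `P → ℝ`, where `P = Im FL`. -/
structure IsPhaseSpaceSection (L : Jet n π (m + 1) → ℝ) (σ : ℝ → ReducedDual n π m) : Prop where
  contMDiff : ContMDiff 𝓘(ℝ, ℝ) (reducedDualModel n m) ∞ σ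
  mem : ∀ t, σ t ∈ range (restrictedLegendre L)
  time_eq : ∀ t, (σ t).1.time = t

/-- `σ^* i(Y) Ω_h^o = 0` for every vector field `Y` on `P = Im FL`. -/
def SolvesHamiltonEquation (L : Jet n π (m + 1) → ℝ) (σ : ℝ → ReducedDual n π m) : Prop :=
  ∀ Y : ∀ p : ReducedDual n π m, TangentSpace (reducedDualModel n m) p,
    IsVectorFieldOn (reducedDualModel n m) (range (restrictedLegendre L)) Y →
    ∀ (t : ℝ) (τ : TangentSpace 𝓘(ℝ, ℝ) t),
      hamiltonCartanForm L (σ t) (Y (σ t))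
        (mfderiv 𝓘(ℝ, ℝ) (reducedDualModel n m) σ t τ) = 0

end Unified

/-! ### Natural charts of a cotangent bundle and the canonical forms in them -/

section CotangentCharts

variable {V : Type*} [NormedAddCommGroup V] [NormedSpace ℝ V]
  {M : Type*} [TopologicalSpace M] [ChartedSpace V M] [IsManifold 𝓘(ℝ, V) ∞ M]

/-! Write `k = m + 1`. In natural coordinates `W_o` is a graph: the coupling condition is solved by
`p = L - ∑ q_{i+1} p^i`, so `(t, q_0, …, q_{2k-1}, p^0, …, p^{k-1})` are free parameters
(`unifiedParam`). The graph of the extended Legendre map lies in `W_o`, because its time momentum is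
defined by this very formula. Four facts follow.

The Hamiltonian section is well defined. On a fibre of `FL` the `(k-1)`-jet and the vertical momenta
are fixed, so only the `dt`-component `L - ∑ q_{i+1} p^i` of the extended map could vary. Along a
curve in the fibre only coordinates of order at least `k` move. There `dL = (∂L/∂q_k) dq_k = p^{k-1}
dq_k`, so the derivative of that component vanishes. Fibres are connected submanifolds, hence the
component is constant (`IsAlmostRegular.extendedLegendre_eq_of_restrictedLegendre_eq`).

The section `h` is smooth. The extended map is a smooth function of the jet and of `FL`, both
smooth. Since `FL` is a submersion onto the embedded submanifold `P`, it has smooth local sections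
`s` (`IsEmbeddedSubmanifold.exists_section`), and locally `h = FL~ ∘ s` on `P`.

A holonomic solution lies in `W_1`. In Darboux form `Ω = dq ∧ dp`, and testing the unified equation
against variations of the jet coordinates gives `p^{k-1} = ∂L/∂q_k` and `p^i = ∂L/∂q_{i+1} - (d/dt)
p^{i+1}` along the section. The Legendre momenta satisfy the same recursion with the total
derivative `d_T`, which is the time derivative along a holonomic curve. Downward induction
identifies the two (`SolvesUnifiedEquation.mem_legendreGraph`).

A solution in `W_1` projects to a Hamiltonian solution. A tangent vector of `P` is `T FL (u)`, and
`Th` sends it to `T FL~ (u)`. This is also the cotangent component of a vector tangent to `W_1 ⊆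
W_o`, which extends to a vector field on `W_o`. Moreover `h ∘ FL ∘ ρ₁ ∘ ψ = ρ₂ ∘ ψ` on `W_1`. Both
arguments of `Ω` therefore agree with those in the unified equation
(`SolvesUnifiedEquation.solvesHamiltonEquation`). The necessary extensions to vector fields come
from the graph description and a bump function (`exists_isVectorFieldOn_hamiltonianSubmanifold`). -/

theorem cotangentChart_fst (α β : CotangentBundle V M) :
    (extChartAt (cotangentModel V) α β).1 = extChartAt 𝓘(ℝ, V) α.1 β.1 := by
  rfl

theorem cotangentChart_snd (α β : CotangentBundle V M) :
    (extChartAt (cotangentModel V) α β).2 = ContinuousLinearMap.inCoordinates V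
      (TangentSpace 𝓘(ℝ, V)) ℝ (Bundle.Trivial M ℝ) α.1 β.1 α.1 β.1 β.2 := by
  rfl

theorem cotangentChart_source (α : CotangentBundle V M) :
    (extChartAt (cotangentModel V) α).source = {β | β.1 ∈ (chartAt V α.1).source} := by
  ext β
  rw [FiberBundle.extChartAt]
  simp only [PartialEquiv.trans_source, PartialEquiv.prod_source, PartialEquiv.refl_source,
    extChartAt_source]
  refine ⟨fun h => h.2.1, fun h => ⟨⟨h, trivial⟩, h, trivial⟩⟩

theorem cotangentChart_target (α : CotangentBundle V M) :
    (extChartAt (cotangentModel V) α).target = (chartAt V α.1).target ×ˢ univ := by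
  rw [FiberBundle.extChartAt_target]
  ext z
  simp
  intro h
  exact (chartAt V α.1).map_target h

theorem cotangentChart_snd_apply {α β : CotangentBundle V M}
    (v : V) :
    (extChartAt (cotangentModel V) α β).2 v =
      (β.2 : V →L[ℝ] ℝ) ((trivializationAt V (TangentSpace 𝓘(ℝ, V)) α.1).symmL ℝ β.1 v) := by
  rw [cotangentChart_snd]
  simp [ContinuousLinearMap.inCoordinates]

/-- The fibre coordinates of a covector are its transport by the inverse of the chart's derivative,
so pairing them with a vector read in the same chart gives back the intrinsic pairing. -/
theorem cotangentChart_snd_mfderiv {α β : CotangentBundle V M}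
    (hβ : β.1 ∈ (chartAt V α.1).source) (v : V) :
    (extChartAt (cotangentModel V) α β).2
      (mfderiv 𝓘(ℝ, V) 𝓘(ℝ, V) (extChartAt 𝓘(ℝ, V) α.1) β.1 v : V) = (β.2 : V →L[ℝ] ℝ) v := by
  have h1 := DFunLike.congr_fun (TangentBundle.continuousLinearMapAt_trivializationAt
    (I := 𝓘(ℝ, V)) hβ) v
  refine (congrArg _ h1.symm).trans ((cotangentChart_snd_apply _).trans (congrArg β.2 ?_))
  exact Bundle.Trivialization.symmL_continuousLinearMapAt _ 
    (show β.1 ∈ (trivializationAt V (TangentSpace 𝓘(ℝ, V)) α.1).baseSet from hβ) v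

/-- In a natural chart the canonical one-form is `p dq`. -/
theorem canonicalOneForm_eq {α β : CotangentBundle V M}
    (hβ : β.1 ∈ (chartAt V α.1).source) (w : V × (V →L[ℝ] ℝ)) :
    canonicalOneForm β w = (extChartAt (cotangentModel V) α β).2
      (mfderiv (cotangentModel V) 𝓘(ℝ, V × (V →L[ℝ] ℝ)) (extChartAt (cotangentModel V) α) β w :
        V × (V →L[ℝ] ℝ)).1 := by
  have h1 : HasMFDerivAt (cotangentModel V) 𝓘(ℝ, V)
      (Bundle.TotalSpace.proj : CotangentBundle V M → M) β _ :=
    ((Bundle.contMDiff_proj (IB := 𝓘(ℝ, V)) (n := 1) _).mdifferentiableAt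
      (by simp)).hasMFDerivAt
  have h2 : HasMFDerivAt 𝓘(ℝ, V) 𝓘(ℝ, V) (extChartAt 𝓘(ℝ, V) α.1) β.1 _ :=
    (mdifferentiableAt_extChartAt hβ).hasMFDerivAt
  have h3 : HasMFDerivAt (cotangentModel V) 𝓘(ℝ, V × (V →L[ℝ] ℝ))
      (extChartAt (cotangentModel V) α) β _ :=
    (mdifferentiableAt_extChartAt (by
      have := cotangentChart_source α
      rw [extChartAt_source] at this
      rw [this]; exact hβ)).hasMFDerivAt
  have h4 := h2.comp β h1
  have h5 : HasMFDerivAt (cotangentModel V) 𝓘(ℝ, V) (Prod.fst ∘ (extChartAt (cotangentModel V) α))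
      β _ :=
    HasMFDerivAt.comp β (I' := 𝓘(ℝ, V × (V →L[ℝ] ℝ)))
      (ContinuousLinearMap.fst ℝ V (V →L[ℝ] ℝ)).hasMFDerivAt h3
  have h6 := DFunLike.congr_fun (hasMFDerivAt_unique h4 h5) w
  have h7 := cotangentChart_snd_mfderiv hβ (mfderiv (cotangentModel V) 𝓘(ℝ, V)
      (Bundle.TotalSpace.proj : CotangentBundle V M → M) β w)
  exact h7.symm.trans (congrArg _ h6)


/-- The tangent space at `x` is identified with the model space through the preferred chart at `x`.
The derivative of another chart is therefore an ordinary derivative of the transition map. -/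
theorem mfderiv_extChartAt_eq_fderiv {W H N : Type*} [NormedAddCommGroup W] [NormedSpace ℝ W]
    [TopologicalSpace H] {I : ModelWithCorners ℝ W H} [I.Boundaryless] [TopologicalSpace N]
    [ChartedSpace H N] [IsManifold I 1 N] {x y : N} (hx : x ∈ (chartAt H y).source) :
    (mfderiv I 𝓘(ℝ, W) (extChartAt I y) x : W →L[ℝ] W) =
      fderiv ℝ (extChartAt I y ∘ (extChartAt I x).symm) (extChartAt I x x) := by
  rw [(mdifferentiableAt_extChartAt hx).mfderiv]
  rw [I.range_eq_univ, fderivWithin_univ]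
  rfl

/-- The exterior derivative of the canonical one-form in an arbitrary natural chart. -/
theorem canonicalTwoForm_eq {α₀ α : CotangentBundle V M}
    (hα : α.1 ∈ (chartAt V α₀.1).source) (D : V × (V →L[ℝ] ℝ) →L[ℝ] V × (V →L[ℝ] ℝ))
    (hD : HasMFDerivAt (cotangentModel V) 𝓘(ℝ, V × (V →L[ℝ] ℝ))
      (extChartAt (cotangentModel V) α₀) α D) (u v : V × (V →L[ℝ] ℝ)) :
    canonicalTwoForm α u v = (D v).2 (D u).1 - (D u).2 (D v).1 := by
  set κ₀ := extChartAt (cotangentModel V) α₀ with hκ₀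
  set κ := extChartAt (cotangentModel V) α with hκ
  set φ := κ₀ ∘ κ.symm with hφ
  have hmem : α ∈ (chartAt (ModelProd V (V →L[ℝ] ℝ)) α₀).source := by
    have := cotangentChart_source α₀
    rw [extChartAt_source] at this
    rw [this]; exact hα
  have hD' : D = fderiv ℝ φ (κ α) := hD.mfderiv.symm.trans (mfderiv_extChartAt_eq_fderiv hmem)
  have hU : ∀ᶠ z in 𝓝 (κ α), z ∈ κ.target ∧ κ.symm z ∈ κ₀.source :=  by
    refine Filter.Eventually.and (extChartAt_target_mem_nhds (I := cotangentModel V) α) ?_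
    refine (continuousAt_extChartAt_symm α).preimage_mem_nhds ?_
    rw [κ.left_inv (mem_extChartAt_source α)]
    exact (isOpen_extChartAt_source α₀).mem_nhds (by rwa [extChartAt_source])
  have hsm : ∀ z, z ∈ κ.target ∧ κ.symm z ∈ κ₀.source → ContDiffAt ℝ ∞ φ z := by
    intro z hz
    have h1 : ContMDiffAt 𝓘(ℝ, V × (V →L[ℝ] ℝ)) (cotangentModel V) ∞ κ.symm z :=
      (contMDiffOn_extChartAt_symm α).contMDiffAt ((isOpen_extChartAt_target α).mem_nhds hz.1)
    have h2 : ContMDiffAt (cotangentModel V) 𝓘(ℝ, V × (V →L[ℝ] ℝ)) ∞ κ₀ (κ.symm z) :=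
      contMDiffAt_extChartAt' (by have := hz.2; rwa [extChartAt_source] at this)
    exact (h2.comp z h1).contDiffAt
  -- With `(q₀, p₀) = φ z` the coordinates of the second chart, this is `Θ = p₀ dq₀` pulled back by
  -- the transition map and evaluated on the constant field `v`.
  have key : ∀ v : V × (V →L[ℝ] ℝ),
      (fun z => oneFormInChart (cotangentModel V) canonicalOneForm α z v) =ᶠ[𝓝 (κ α)]
        fun z => (φ z).2 (fderiv ℝ φ z v).1 := by
    intro v
    filter_upwards [hU] with z hz
    have hb : (κ.symm z).1 ∈ (chartAt V α₀.1).source := by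
      have := hz.2
      rwa [hκ₀, cotangentChart_source] at this
    have h1 : HasMFDerivAt 𝓘(ℝ, V × (V →L[ℝ] ℝ)) (cotangentModel V) κ.symm z _ :=
      (((contMDiffOn_extChartAt_symm (n := ∞) α).contMDiffAt
        ((isOpen_extChartAt_target α).mem_nhds hz.1)).mdifferentiableAt (by simp)).hasMFDerivAt
    have h2 : HasMFDerivAt (cotangentModel V) 𝓘(ℝ, V × (V →L[ℝ] ℝ)) κ₀ (κ.symm z) _ :=
      (mdifferentiableAt_extChartAt (by have := hz.2; rwa [extChartAt_source] at this)).hasMFDerivAt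
    have h3 := (h2.comp z h1).mfderiv
    rw [mfderiv_eq_fderiv] at h3
    have h4 := DFunLike.congr_fun h3 v
    exact (canonicalOneForm_eq hb _).trans
      (congrArg (fun w : V × (V →L[ℝ] ℝ) => (κ₀ (κ.symm z)).2 w.1) h4.symm)
  have hφ0 := hsm _ hU.self_of_nhds
  have hder : ∀ u v : V × (V →L[ℝ] ℝ),
      fderiv ℝ (fun z => (φ z).2 (fderiv ℝ φ z v).1) (κ α) u =
        (D u).2 (D v).1 + (φ (κ α)).2 (fderiv ℝ (fderiv ℝ φ) (κ α) u v).1 := by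
    intro u v
    have h1 : HasFDerivAt φ D (κ α) := hD' ▸ (hφ0.differentiableAt (by simp)).hasFDerivAt
    have h2 : HasFDerivAt (fderiv ℝ φ) (fderiv ℝ (fderiv ℝ φ) (κ α)) (κ α) :=
      ((hφ0.fderiv_right (m := 1) (by norm_cast)).differentiableAt
        (by simp)).hasFDerivAt
    have h3 := h1.snd.clm_apply ((h2.clm_apply (hasFDerivAt_const v _)).fst)
    rw [h3.fderiv, ← hD']
    simp [add_comm]
  -- The second derivatives of the transition map enter symmetrically and cancel in `dΘ`. What
  -- remains is `dp₀ ∧ dq₀`, whence the independence of the chart.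
  have hsymm : fderiv ℝ (fderiv ℝ φ) (κ α) u v = fderiv ℝ (fderiv ℝ φ) (κ α) v u :=
    (hφ0.isSymmSndFDerivAt (by simpa using by norm_cast)) u v
  change -(fderiv ℝ (fun z => oneFormInChart (cotangentModel V) canonicalOneForm α z v) (κ α) u -
    fderiv ℝ (fun z => oneFormInChart (cotangentModel V) canonicalOneForm α z u) (κ α) v) = _
  rw [(key v).fderiv_eq, (key u).fderiv_eq, hder, hder, hsymm]
  ring

end CotangentCharts

/-! ### Natural charts of jet manifolds, projections and prolongations -/

section NaturalCharts

variable {n : ℕ} {E : Type*} [TopologicalSpace E] [ChartedSpace (ℝ × Vec n) E]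

section

variable {π : E → ℝ} {r r' : ℕ}

@[simp] theorem Jet.proj_mk (h : r' ≤ r) (a : LocalSection n π) :
    (Jet.mk r a).proj h = Jet.mk r' a := rfl

@[simp] theorem Jet.point_proj (h : r' ≤ r) (y : Jet n π r) : (y.proj h).point = y.point := by
  rw [← y.mk_rep]; rfl

@[simp] theorem Jet.time_proj (h : r' ≤ r) (y : Jet n π r) : (y.proj h).time = y.time := by
  rw [← y.mk_rep]; rfl

theorem IsLocalSection.eventually {φ : ℝ → E} {t : ℝ} (h : IsLocalSection n π φ t) :
    ∀ᶠ s in 𝓝 t, IsLocalSection n π φ s := eventually_eventually_nhds.2 h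

theorem IsLocalSection.contMDiffAt {φ : ℝ → E} {t : ℝ} (h : IsLocalSection n π φ t) :
    ContMDiffAt 𝓘(ℝ, ℝ) 𝓘(ℝ, ℝ × Vec n) ∞ φ t := (h.self_of_nhds).1

end

variable [IsManifold 𝓘(ℝ, ℝ × Vec n) ∞ E]

/-- The natural chart of `J^r π` over the chosen adapted chart around a point of `E`. -/
noncomputable def natChart (π : E → ℝ) [IsFibredOverReal n π] (r : ℕ) (x : E) :
    OpenPartialHomeomorph (Jet n π r) (JetCoord n r) :=
  (jetCore n π r).openPartialHomeomorph (jetChart r _ (adaptedChart_isAdapted π x))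
    ⟨_, adaptedChart_isAdapted π x, rfl⟩

variable {π : E → ℝ} [IsFibredOverReal n π] {r r' : ℕ}

theorem chartAt_jet (y : Jet n π r) : chartAt (JetCoord n r) y = natChart π r y.point := rfl

theorem extChartAt_jet (y : Jet n π r) :
    (extChartAt 𝓘(ℝ, JetCoord n r) y : Jet n π r → JetCoord n r) = natChart π r y.point := rfl

theorem natChart_source (x : E) :
    (natChart (n := n) π r x).source = {y | y.point ∈ (adaptedChart (n := n) π x).source} := rfl

theorem natChart_target (x : E) :
    (natChart (n := n) π r x).target = {z | (z.1, z.2 0) ∈ (adaptedChart (n := n) π x).target} :=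
  rfl

theorem natChart_mem_maximalAtlas (x : E) :
    natChart (n := n) π r x ∈ IsManifold.maximalAtlas 𝓘(ℝ, JetCoord n r) ∞ (Jet n π r) := by
  refine IsManifold.subset_maximalAtlas ?_
  refine ⟨_, ⟨jetChart r _ (adaptedChart_isAdapted π x), rfl⟩, ?_⟩
  simp only [mem_iUnion, mem_singleton_iff]
  exact ⟨⟨_, adaptedChart_isAdapted π x, rfl⟩, rfl⟩

theorem contMDiffOn_natChart (x : E) :
    ContMDiffOn 𝓘(ℝ, JetCoord n r) 𝓘(ℝ, JetCoord n r) ∞ (natChart (n := n) π r x)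
      (natChart (n := n) π r x).source :=
  contMDiffOn_of_mem_maximalAtlas (natChart_mem_maximalAtlas x)

theorem contMDiffOn_natChart_symm (x : E) :
    ContMDiffOn 𝓘(ℝ, JetCoord n r) 𝓘(ℝ, JetCoord n r) ∞ (natChart (n := n) π r x).symm
      (natChart (n := n) π r x).target :=
  contMDiffOn_symm_of_mem_maximalAtlas (natChart_mem_maximalAtlas x)

theorem natChart_mk {x : E} (a : LocalSection n π)
    (ha : a.point ∈ (adaptedChart (n := n) π x).source) :
    natChart π r x (Jet.mk r a) = (a.time, fun i : Fin (r + 1) =>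
      iteratedDeriv i (fun s => (adaptedChart (n := n) π x (a.toFun s)).2) a.time) :=
  Prod.ext rfl (funext fun i =>
    jetCoord_mk (adaptedChart_isAdapted π x) a ha (Nat.lt_succ_iff.1 i.2))

/-- Truncation of natural coordinates. -/
noncomputable def jetTrunc (n : ℕ) {r r' : ℕ} (h : r' ≤ r) : JetCoord n r →L[ℝ] JetCoord n r' :=
  (ContinuousLinearMap.fst ℝ ℝ (Fin (r + 1) → Vec n)).prod
    (ContinuousLinearMap.pi fun i : Fin (r' + 1) =>
      (ContinuousLinearMap.proj (Fin.castLE (by omega) i)).comp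
        (ContinuousLinearMap.snd ℝ ℝ (Fin (r + 1) → Vec n)))

@[simp] theorem jetTrunc_fst (h : r' ≤ r) (z : JetCoord n r) : (jetTrunc n h z).1 = z.1 := rfl

@[simp] theorem jetTrunc_snd (h : r' ≤ r) (z : JetCoord n r) (i : Fin (r' + 1)) :
    (jetTrunc n h z).2 i = z.2 (Fin.castLE (by omega) i) := rfl

theorem natChart_proj (h : r' ≤ r) {x : E} {y : Jet n π r}
    (hy : y.point ∈ (adaptedChart (n := n) π x).source) :
    natChart π r' x (y.proj h) = jetTrunc n h (natChart π r x y) := by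
  rw [← y.mk_rep] at hy ⊢
  rw [Jet.proj_mk, natChart_mk _ hy, natChart_mk _ hy]
  rfl

theorem contMDiff_jet_proj (h : r' ≤ r) :
    ContMDiff 𝓘(ℝ, JetCoord n r) 𝓘(ℝ, JetCoord n r') ∞ (Jet.proj h : Jet n π r → Jet n π r') := by
  intro y
  have hy : y ∈ (natChart π r y.point).source := mem_adaptedChart_source π y.point
  have h1 : ContMDiffAt 𝓘(ℝ, JetCoord n r) 𝓘(ℝ, JetCoord n r') ∞
      ((natChart π r' y.point).symm ∘ (jetTrunc n h ∘ natChart π r y.point)) y := by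
    have h2 : ContMDiffAt 𝓘(ℝ, JetCoord n r) 𝓘(ℝ, JetCoord n r') ∞
        (jetTrunc n h ∘ natChart π r y.point) y :=
      (jetTrunc n h).contDiff.contMDiff.contMDiffAt.comp y
        ((contMDiffOn_natChart y.point).contMDiffAt ((natChart π r y.point).open_source.mem_nhds hy))
    refine ContMDiffAt.comp y ((contMDiffOn_natChart_symm y.point).contMDiffAt
      ((natChart π r' y.point).open_target.mem_nhds ?_)) h2
    exact (natChart π r y.point).map_source hy
  refine h1.congr_of_eventuallyEq ?_
  filter_upwards [(natChart π r y.point).open_source.mem_nhds hy] with y' hy'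
  simp only [Function.comp_apply]
  rw [← natChart_proj h hy', (natChart π r' y.point).left_inv]
  rw [natChart_source, mem_ofPred_eq, Jet.point_proj]
  exact hy'

/-- In natural coordinates this map is `e.symm (t, q_0)`. It carries bump functions from `E` to the
unified space and gives smoothness of the base curve of a section. -/
theorem contMDiff_jet_point :
    ContMDiff 𝓘(ℝ, JetCoord n r) 𝓘(ℝ, ℝ × Vec n) ∞ (Jet.point : Jet n π r → E) := by
  intro y
  set x := y.point
  have hy : y ∈ (natChart π r x).source := mem_adaptedChart_source π y.point
  set e := adaptedChart (n := n) π x with he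
  have h1 : ∀ y' ∈ (natChart π r x).source,
      y'.point = e.symm ((natChart π r x y').1, (natChart π r x y').2 0) := by
    intro y' hy'
    rw [← y'.mk_rep] at hy' ⊢
    rw [natChart_mk _ hy']
    have := ((adaptedChart_isAdapted π x).eventuallyEq y'.rep hy').self_of_nhds
    simp only [Fin.val_zero, iteratedDeriv_zero] at this ⊢
    rw [← he, ← this]
    exact (e.left_inv hy').symm
  have h3 : ContMDiffAt 𝓘(ℝ, JetCoord n r) 𝓘(ℝ, ℝ × Vec n) ∞
      (fun y' => ((natChart π r x y').1, (natChart π r x y').2 0)) y := by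
    have h4 := (contMDiffOn_natChart (π := π) (r := r) x).contMDiffAt
      ((natChart π r x).open_source.mem_nhds hy)
    have h5 : ContDiff ℝ ∞ fun z : JetCoord n r => (z.1, z.2 0) := by fun_prop
    exact h5.contMDiff.contMDiffAt.comp y h4
  have h2 := ContMDiffAt.comp (f := fun y' => ((natChart π r x y').1, (natChart π r x y').2 0)) y
    (contMDiffAt_symm_of_mem_maximalAtlas (adaptedChart_isAdapted π x).mem
      ((natChart π r x).map_source hy)) h3
  refine h2.congr_of_eventuallyEq ?_
  filter_upwards [(natChart π r x).open_source.mem_nhds hy] with y' hy' using h1 y' hy'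

theorem jetProlongation_of_isLocalSection {φ : ℝ → E} {t : ℝ} (h : IsLocalSection n π φ t) :
    jetProlongation n π r φ t = Jet.mk r ⟨t, φ, h⟩ := dif_pos h

theorem natChart_jetProlongation {φ : ℝ → E} {t : ℝ} (h : IsLocalSection n π φ t) {x : E}
    (hx : φ t ∈ (adaptedChart (n := n) π x).source) :
    natChart π r x (jetProlongation n π r φ t) = (t, fun i : Fin (r + 1) =>
      iteratedDeriv i (fun s => (adaptedChart (n := n) π x (φ s)).2) t) := by
  rw [jetProlongation_of_isLocalSection h]
  exact natChart_mk _ hx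

theorem contDiffAt_adaptedChart_comp {φ : ℝ → E} {t : ℝ} (h : IsLocalSection n π φ t) {x : E}
    (hx : φ t ∈ (adaptedChart (n := n) π x).source) :
    ContDiffAt ℝ ∞ (fun s => (adaptedChart (n := n) π x (φ s)).2) t :=
  contDiff_snd.contDiffAt.comp t
    (contDiffAt_chart_comp (adaptedChart_isAdapted π x).mem ⟨t, φ, h⟩ hx)

theorem ContDiffAt.hasDerivAt_iteratedDeriv {F : Type*} [NormedAddCommGroup F] [NormedSpace ℝ F]
    {f : ℝ → F} {t : ℝ} (hf : ContDiffAt ℝ ∞ f t) (i : ℕ) :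
    HasDerivAt (iteratedDeriv i f) (iteratedDeriv (i + 1) f t) t := by
  have h1 : ContDiffAt ℝ ∞ (iteratedDeriv i f) t := by
    have h2 := hf.iteratedFDeriv_right (m := ∞) (i := i) (by exact_mod_cast le_refl _)
    rw [iteratedDeriv_eq_equiv_comp]
    exact (LinearIsometryEquiv.contDiff _).contDiffAt.comp t h2
  rw [iteratedDeriv_succ]
  exact (h1.differentiableAt (by simp)).hasDerivAt

/-- The velocity of a prolongation in natural coordinates. -/
theorem hasDerivAt_natChart_jetProlongation {φ : ℝ → E} {t : ℝ} (h : IsLocalSection n π φ t)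
    {x : E} (hx : φ t ∈ (adaptedChart (n := n) π x).source) :
    HasDerivAt (fun s => natChart π r x (jetProlongation n π r φ s))
      ((1, fun i : Fin (r + 1) =>
        iteratedDeriv (i + 1) (fun s => (adaptedChart (n := n) π x (φ s)).2) t) : JetCoord n r) t := by
  have h1 : HasDerivAt (fun s => ((s, fun i : Fin (r + 1) =>
      iteratedDeriv i (fun s => (adaptedChart (n := n) π x (φ s)).2) s) : JetCoord n r))
      ((1, fun i : Fin (r + 1) =>
        iteratedDeriv (i + 1) (fun s => (adaptedChart (n := n) π x (φ s)).2) t) : JetCoord n r) t :=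
    (hasDerivAt_id t).prodMk (hasDerivAt_pi.2 fun i =>
      (contDiffAt_adaptedChart_comp h hx).hasDerivAt_iteratedDeriv i)
  refine h1.congr_of_eventuallyEq ?_
  filter_upwards [h.eventually, h.contMDiffAt.continuousAt.preimage_mem_nhds
    ((adaptedChart (n := n) π x).open_source.mem_nhds hx)] with s hs hs'
  exact natChart_jetProlongation hs hs'

theorem mdifferentiableAt_jetProlongation {φ : ℝ → E} {t : ℝ} (h : IsLocalSection n π φ t) :
    MDifferentiableAt 𝓘(ℝ, ℝ) 𝓘(ℝ, JetCoord n r) (jetProlongation n π r φ) t := by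
  have hx := mem_adaptedChart_source (n := n) π (φ t)
  have h1 := (hasDerivAt_natChart_jetProlongation (r := r) h hx).differentiableAt.mdifferentiableAt
  have hev : ∀ᶠ s in 𝓝 t, jetProlongation n π r φ s ∈ (natChart π r (φ t)).source := by
    filter_upwards [h.eventually, h.contMDiffAt.continuousAt.preimage_mem_nhds
      ((adaptedChart (n := n) π (φ t)).open_source.mem_nhds hx)] with s hs hs'
    rw [jetProlongation_of_isLocalSection hs]
    exact hs'
  have h2 : MDifferentiableAt 𝓘(ℝ, JetCoord n r) 𝓘(ℝ, JetCoord n r) (natChart π r (φ t)).symm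
      (natChart π r (φ t) (jetProlongation n π r φ t)) :=
    ((contMDiffOn_natChart_symm (φ t)).contMDiffAt ((natChart π r (φ t)).open_target.mem_nhds
      ((natChart π r (φ t)).map_source hev.self_of_nhds))).mdifferentiableAt (by simp)
  have h3 := h2.comp t h1
  refine h3.congr_of_eventuallyEq ?_
  filter_upwards [hev] with s hs
  exact ((natChart π r (φ t)).left_inv hs).symm

end NaturalCharts

/-! ### `W_o` as a graph in natural coordinates -/

section UnifiedCharts

variable {n m : ℕ} {E : Type*} [TopologicalSpace E] [ChartedSpace (ℝ × Vec n) E]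
  [IsManifold 𝓘(ℝ, ℝ × Vec n) ∞ E] {π : E → ℝ} [IsFibredOverReal n π]

/-- The coordinates `(q_1, …, q_k)`, i.e. the vertical velocity of a `(k - 1)`-jet. -/
noncomputable def jetShift (n m : ℕ) : JetCoord n (2 * m + 1) →L[ℝ] (Fin (m + 1) → Vec n) :=
  ContinuousLinearMap.pi fun i : Fin (m + 1) =>
    (ContinuousLinearMap.proj (⟨i + 1, by omega⟩ : Fin (2 * m + 1 + 1))).comp
      (ContinuousLinearMap.snd ℝ ℝ (Fin (2 * m + 1 + 1) → Vec n))

@[simp] theorem jetShift_apply (z : JetCoord n (2 * m + 1)) (i : Fin (m + 1)) :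
    jetShift n m z i = z.2 ⟨i + 1, by omega⟩ := rfl

/-- The coupling function in natural coordinates is `p + ∑ p^i q_{i+1}`. -/
theorem coupling_eq {α₀ : CotangentBundle (JetCoord n m) (Jet n π m)} {w : UnifiedSpace n π m}
    (hw : w.1.proj (by omega) = w.2.1)
    (hx : w.1.point ∈ (adaptedChart (n := n) π α₀.1.point).source) :
    coupling w = (extChartAt (cotangentModel (JetCoord n m)) α₀ w.2).2
      (1, jetShift n m (natChart π (2 * m + 1) α₀.1.point w.1)) := by
  obtain ⟨y, q, a⟩ := w
  change y.proj (by omega) = q at hw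
  subst hw
  have hrep : Jet.mk m y.rep = y.proj (by omega) := by
    conv_rhs => rw [← y.mk_rep]
    rfl
  have hsec : IsLocalSection n π y.rep.toFun y.rep.time := y.rep.isLocalSection
  have hx' : y.rep.toFun y.rep.time ∈ (adaptedChart (n := n) π α₀.1.point).source := by
    change y.rep.point ∈ _
    rw [y.rep_point]
    exact hx
  have hjet : jetProlongation n π m y.rep.toFun y.rep.time = y.proj (by omega) :=
    (jetProlongation_of_isLocalSection hsec).trans hrep
  have h1 := (mdifferentiableAt_jetProlongation (r := m) hsec).hasMFDerivAt
  have hsrc : y.proj (by omega) ∈ (chartAt (JetCoord n m) α₀.1).source := by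
    rw [chartAt_jet, natChart_source, mem_ofPred_eq, Jet.point_proj]
    exact hx
  have h2 : HasMFDerivAt 𝓘(ℝ, JetCoord n m) 𝓘(ℝ, JetCoord n m) (extChartAt 𝓘(ℝ, JetCoord n m) α₀.1)
      (jetProlongation n π m y.rep.toFun y.rep.time) (mfderiv 𝓘(ℝ, JetCoord n m)
        𝓘(ℝ, JetCoord n m) (extChartAt 𝓘(ℝ, JetCoord n m) α₀.1) (y.proj (by omega)))  := by
    rw [hjet]
    exact (mdifferentiableAt_extChartAt hsrc).hasMFDerivAt
  have h3 := h2.comp y.rep.time h1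
  have h4 := (hasDerivAt_natChart_jetProlongation (r := m) hsec hx').hasFDerivAt
  have h5 := DFunLike.congr_fun (hasMFDerivAt_unique h3 h4.hasMFDerivAt) (1 : ℝ)
  have h6 := cotangentChart_snd_mfderiv (α := α₀) (β := ⟨y.proj (by omega), a⟩) hsrc
    (mfderiv 𝓘(ℝ, ℝ) 𝓘(ℝ, JetCoord n m) (jetProlongation n π m y.rep.toFun) y.rep.time (1 : ℝ))
  -- The velocity of the `m`-jet needs derivatives of order at most `m + 1 ≤ 2 * m + 1`, so it can
  -- be read off from the coordinates of `y` itself.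
  have h7 : ((1, jetShift n m (natChart π (2 * m + 1) α₀.1.point y)) : JetCoord n m) =
      (1, fun i : Fin (m + 1) => iteratedDeriv (i + 1)
        (fun s => (adaptedChart (n := n) π α₀.1.point (y.rep.toFun s)).2) y.rep.time) := by
    conv_lhs => rw [← y.mk_rep, natChart_mk _ hx']
    rfl
  refine h6.symm.trans (congrArg _ (h5.trans ?_))
  rw [h7]
  exact one_smul ℝ _

/-- The Lagrangian in a natural chart, as a function on `J^{2k-1} π`. -/
noncomputable def localLagrangian (L : Jet n π (m + 1) → ℝ) (x : E) :
    JetCoord n (2 * m + 1) → ℝ :=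
  lagrangianInChart L _ (adaptedChart_isAdapted π x)

theorem localLagrangian_eq (L : Jet n π (m + 1) → ℝ) (x : E) (z : JetCoord n (2 * m + 1)) :
    localLagrangian L x z = L ((natChart π (m + 1) x).symm (jetTrunc n (by omega) z)) := rfl

theorem localLagrangian_natChart (L : Jet n π (m + 1) → ℝ) {x : E} {y : Jet n π (2 * m + 1)}
    (hy : y.point ∈ (adaptedChart (n := n) π x).source) :
    localLagrangian L x (natChart π (2 * m + 1) x y) = L (y.proj (by omega)) := by
  rw [localLagrangian_eq, ← natChart_proj (by omega) hy, (natChart π (m + 1) x).left_inv]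
  rw [natChart_source, mem_ofPred_eq, Jet.point_proj]
  exact hy

theorem contDiffOn_localLagrangian {L : Jet n π (m + 1) → ℝ}
    (hL : ContMDiff 𝓘(ℝ, JetCoord n (m + 1)) 𝓘(ℝ, ℝ) ∞ L) (x : E) :
    ContDiffOn ℝ ∞ (localLagrangian L x) (natChart (n := n) π (2 * m + 1) x).target := by
  have h1 : ContMDiffOn 𝓘(ℝ, JetCoord n (2 * m + 1)) 𝓘(ℝ, ℝ) ∞
      (L ∘ ((natChart π (m + 1) x).symm ∘ jetTrunc n (by omega)))
      (natChart (n := n) π (2 * m + 1) x).target :=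
    hL.comp_contMDiffOn ((contMDiffOn_natChart_symm x).comp
      (jetTrunc n (by omega)).contDiff.contMDiff.contMDiffOn fun z hz => hz)
  exact h1.contDiffOn

/-- The covector with given vertical part `β` that takes the value `c` on `∂/∂t + ∑ q_{i+1} ∂/∂q_i`. -/
noncomputable def liftCovector (c : ℝ) (v : Fin (m + 1) → Vec n)
    (β : (Fin (m + 1) → Vec n) →L[ℝ] ℝ) : JetCoord n m →L[ℝ] ℝ :=
  (c - β v) • ContinuousLinearMap.fst ℝ ℝ (Fin (m + 1) → Vec n) +
    β.comp (ContinuousLinearMap.snd ℝ ℝ (Fin (m + 1) → Vec n))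

theorem liftCovector_apply (c : ℝ) (v : Fin (m + 1) → Vec n)
    (β : (Fin (m + 1) → Vec n) →L[ℝ] ℝ) (u : JetCoord n m) :
    liftCovector c v β u = (c - β v) * u.1 + β u.2 := rfl

/-- A covector is determined by its vertical part and its value on one vector with time component
`1`. This solves the coupling condition for the time momentum. -/
theorem eq_liftCovector_iff (c : ℝ) (v : Fin (m + 1) → Vec n) (P : JetCoord n m →L[ℝ] ℝ) :
    P = liftCovector c v (P.comp (ContinuousLinearMap.inr ℝ ℝ (Fin (m + 1) → Vec n))) ↔
      P (1, v) = c := by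
  have h : ∀ a : ℝ, ∀ u : Fin (m + 1) → Vec n, P (a, u) = a * P (1, 0) + P (0, u) := by
    intro a u
    rw [← smul_eq_mul, ← map_smul, ← map_add]
    simp
  constructor
  · intro hP
    rw [hP, liftCovector_apply]
    ring
  · intro hP
    ext1
    · ext
      simp [liftCovector_apply, ← hP, h 1 v]
      exact map_zero P
    · ext u
      simp [liftCovector_apply]

/-- The natural parametrization of `W_o` by `(t, q_0, …, q_{2k-1}, p^0, …, p^{k-1})`, written in
natural coordinates. -/
noncomputable def unifiedParam (L : Jet n π (m + 1) → ℝ) (x : E)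
    (p : JetCoord n (2 * m + 1) × ((Fin (m + 1) → Vec n) →L[ℝ] ℝ)) :
    JetCoord n (2 * m + 1) × (JetCoord n m × (JetCoord n m →L[ℝ] ℝ)) :=
  (p.1, (jetTrunc n (by omega) p.1, liftCovector (localLagrangian L x p.1) (jetShift n m p.1) p.2))

theorem contDiffOn_unifiedParam {L : Jet n π (m + 1) → ℝ}
    (hL : ContMDiff 𝓘(ℝ, JetCoord n (m + 1)) 𝓘(ℝ, ℝ) ∞ L) (x : E) :
    ContDiffOn ℝ ∞ (unifiedParam L x)
      ((natChart (n := n) π (2 * m + 1) x).target ×ˢ univ) := by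
  have h1 : ContDiffOn ℝ ∞ (fun p : JetCoord n (2 * m + 1) × ((Fin (m + 1) → Vec n) →L[ℝ] ℝ) =>
      localLagrangian L x p.1) ((natChart (n := n) π (2 * m + 1) x).target ×ˢ univ) :=
    (contDiffOn_localLagrangian hL x).comp contDiffOn_fst fun p hp => hp.1
  have h2 : ContDiff ℝ ∞ (fun p : JetCoord n (2 * m + 1) × ((Fin (m + 1) → Vec n) →L[ℝ] ℝ) =>
      p.2 (jetShift n m p.1)) := by fun_prop
  have h3 : ContDiff ℝ ∞ (fun p : JetCoord n (2 * m + 1) × ((Fin (m + 1) → Vec n) →L[ℝ] ℝ) =>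
      p.2.comp (ContinuousLinearMap.snd ℝ ℝ (Fin (m + 1) → Vec n))) := by fun_prop
  exact contDiffOn_fst.prodMk (((jetTrunc n (by omega)).contDiff.comp_contDiffOn
    contDiffOn_fst).prodMk (((h1.sub h2.contDiffOn).smul contDiffOn_const).add h3.contDiffOn))

theorem unifiedChart_apply (w₀ w : UnifiedSpace n π m) :
    extChartAt (unifiedModel n m) w₀ w = (natChart π (2 * m + 1) w₀.1.point w.1,
      extChartAt (cotangentModel (JetCoord n m)) w₀.2 w.2) := by
  rw [extChartAt_prod]
  rfl

theorem unifiedChart_source (w₀ : UnifiedSpace n π m) :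
    (extChartAt (unifiedModel n m) w₀).source =
      {w | w.1.point ∈ (adaptedChart (n := n) π w₀.1.point).source ∧
        w.2.1.point ∈ (adaptedChart (n := n) π w₀.2.1.point).source} := by
  rw [extChartAt_prod]
  ext w
  rw [PartialEquiv.prod_source, cotangentChart_source, extChartAt_source]
  rfl

theorem unifiedChart_target (w₀ : UnifiedSpace n π m) :
    (extChartAt (unifiedModel n m) w₀).target =
      (natChart (n := n) π (2 * m + 1) w₀.1.point).target ×ˢ
        ((natChart (n := n) π m w₀.2.1.point).target ×ˢ univ) := by
  rw [extChartAt_prod, PartialEquiv.prod_target, cotangentChart_target, extChartAt_target]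
  simp
  rfl

/-- By `h₀` the charts of both factors come from one adapted chart of `E`. The fibre-product
condition then says that the base coordinates are a truncation, and the coupling condition is solved
by `eq_liftCovector_iff`. -/
theorem mem_hamiltonianSubmanifold_iff (L : Jet n π (m + 1) → ℝ) {w₀ w : UnifiedSpace n π m}
    (h₀ : w₀.1.point = w₀.2.1.point) (hw : w ∈ (extChartAt (unifiedModel n m) w₀).source) :
    w ∈ hamiltonianSubmanifold L ↔ extChartAt (unifiedModel n m) w₀ w =
      unifiedParam L w₀.1.point (natChart π (2 * m + 1) w₀.1.point w.1,
        (extChartAt (cotangentModel (JetCoord n m)) w₀.2 w.2).2.comp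
          (ContinuousLinearMap.inr ℝ ℝ (Fin (m + 1) → Vec n))) := by
  rw [unifiedChart_source] at hw
  obtain ⟨hw1, hw2⟩ := hw
  have hq : w.1.proj (by omega) = w.2.1 ↔
      jetTrunc n (by omega) (natChart π (2 * m + 1) w₀.1.point w.1) =
        (extChartAt (cotangentModel (JetCoord n m)) w₀.2 w.2).1 := by
    rw [cotangentChart_fst, extChartAt_jet, ← h₀, ← natChart_proj (by omega) hw1]
    refine ⟨fun h => by rw [h], fun h => (natChart π m w₀.1.point).injOn ?_ ?_ h⟩
    · rw [natChart_source, mem_ofPred_eq, Jet.point_proj]; exact hw1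
    · rw [h₀]; exact hw2
  have hc := fun h => coupling_eq (α₀ := w₀.2) (w := w) h (h₀ ▸ hw1)
  -- The coordinate formula for the coupling presupposes the fibre-product condition, which is
  -- therefore carried along in the conjunction.
  have hP : coupling w = L (w.1.proj (by omega)) ∧ w.1.proj (by omega) = w.2.1 ↔
      (extChartAt (cotangentModel (JetCoord n m)) w₀.2 w.2).2 = liftCovector
        (localLagrangian L w₀.1.point (natChart π (2 * m + 1) w₀.1.point w.1))
        (jetShift n m (natChart π (2 * m + 1) w₀.1.point w.1))
        ((extChartAt (cotangentModel (JetCoord n m)) w₀.2 w.2).2.comp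
          (ContinuousLinearMap.inr ℝ ℝ (Fin (m + 1) → Vec n))) ∧ w.1.proj (by omega) = w.2.1 := by
    refine and_congr_left fun h => ?_
    rw [eq_liftCovector_iff, localLagrangian_natChart L hw1, hc h, ← h₀]
  rw [unifiedChart_apply, unifiedParam]
  simp only [Prod.mk.injEq, true_and]
  rw [Prod.ext_iff]
  refine ⟨fun h => ⟨(hq.1 h.1).symm, (hP.1 ⟨h.2, h.1⟩).1⟩,
    fun h => ⟨hq.2 h.1.symm, (hP.2 ⟨h.2, hq.2 h.1.symm⟩).1⟩⟩

end UnifiedCharts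

/-! ### Vector fields and tangent curves given in a chart -/

section ChartCurves

variable {V H : Type*} [NormedAddCommGroup V] [NormedSpace ℝ V] [TopologicalSpace H]
  {I : ModelWithCorners ℝ V H} {M : Type*} [TopologicalSpace M]
  [ChartedSpace H M] [IsManifold I ∞ M]

/-- The tangent trivialization over a chart domain is the derivative of the chart. Hence `symmL`
produces the tangent vector with prescribed chart components. -/
theorem mfderiv_extChartAt_symmL {x₀ x : M} (hx : x ∈ (extChartAt I x₀).source) (v : V) :
    (mfderiv I 𝓘(ℝ, V) (extChartAt I x₀) x
      ((trivializationAt V (TangentSpace I) x₀).symmL ℝ x v) : V) = v := by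
  have hx' : x ∈ (chartAt H x₀).source := by rwa [extChartAt_source] at hx
  have h1 := DFunLike.congr_fun (TangentBundle.continuousLinearMapAt_trivializationAt
    (I := I) hx') ((trivializationAt V (TangentSpace I) x₀).symmL ℝ x v)
  refine h1.symm.trans ?_
  exact Bundle.Trivialization.continuousLinearMapAt_symmL _
    (show x ∈ (trivializationAt V (TangentSpace I) x₀).baseSet from hx') v

/-- A smooth function with values in the model space, supported in a chart domain, gives a smooth
vector field. -/
theorem contMDiffOn_symmL_trivializationAt {x₀ : M} {S : Set M} {vec : M → V}
    (h : ∀ x ∈ S, (x ∈ (extChartAt I x₀).source ∧ ContMDiffAt I 𝓘(ℝ, V) ∞ vec x) ∨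
      ∀ᶠ x' in 𝓝 x, vec x' = 0) :
    ContMDiffOn I I.tangent ∞ (fun x => (⟨x, (trivializationAt V (TangentSpace I) x₀).symmL ℝ x
      (vec x)⟩ : TangentBundle I M)) S := by
  have : IsManifold I (∞ + 1) M := inferInstanceAs (IsManifold I ∞ M)
  intro x hx
  set e := trivializationAt V (TangentSpace I) x₀ with he
  rcases h x hx with ⟨hxs, hv⟩ | h0
  · have hb : x ∈ e.baseSet := by rwa [extChartAt_source] at hxs
    refine ((e.contMDiffAt_section_iff hb).2 ?_).contMDiffWithinAt
    refine hv.congr_of_eventuallyEq ?_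
    filter_upwards [e.open_baseSet.mem_nhds hb] with x' hx'
    have h1 := e.continuousLinearMapAt_symmL (R := ℝ) hx' (vec x')
    rw [Bundle.Trivialization.continuousLinearMapAt_apply,
      Bundle.Trivialization.coe_linearMapAt_of_mem _ hx'] at h1
    exact h1
  · refine ((Bundle.contMDiff_zeroSection ℝ (TangentSpace I
      (M := M))).contMDiffAt.congr_of_eventuallyEq ?_).contMDiffWithinAt
    filter_upwards [h0] with x' hx'
    simp only [hx', map_zero]
    rfl

omit [IsManifold I ∞ M] in
theorem isTangentTo_zero {S : Set M} {x : M} (hx : x ∈ S) : IsTangentTo I S x 0 := by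
  refine ⟨fun _ => x, rfl, contMDiffAt_const, Eventually.of_forall fun _ => hx, ?_⟩
  refine (hasMFDerivAt_const x (0 : ℝ)).congr_mfderiv ?_
  exact ContinuousLinearMap.ext fun (a : ℝ) => (smul_zero (A := V) a).symm

variable [I.Boundaryless]

/-- A curve in the preferred chart at `x₀` through the coordinates of `x` gives a curve through `x`. -/
theorem contMDiffAt_extChartAt_symm_comp {x₀ x : M} (hx : x ∈ (extChartAt I x₀).source)
    {c : ℝ → V} (hc : ContDiffAt ℝ ∞ c 0) (hc0 : c 0 = extChartAt I x₀ x) :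
    ContMDiffAt 𝓘(ℝ, ℝ) I ∞ (fun s => (extChartAt I x₀).symm (c s)) 0 := by
  have h1 : ContMDiffAt 𝓘(ℝ, V) I ∞ (extChartAt I x₀).symm (c 0) :=
    (contMDiffOn_extChartAt_symm x₀).contMDiffAt ((isOpen_extChartAt_target x₀).mem_nhds (by
      rw [hc0]; exact (extChartAt I x₀).map_source hx))
  exact h1.comp (0 : ℝ) hc.contMDiffAt

theorem hasMFDerivAt_extChartAt_symm_comp {x₀ x : M} (hx : x ∈ (extChartAt I x₀).source)
    {c : ℝ → V} {v : V} (hc : HasDerivAt c v 0) (hc0 : c 0 = extChartAt I x₀ x) :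
    HasMFDerivAt 𝓘(ℝ, ℝ) I (fun s => (extChartAt I x₀).symm (c s)) 0
      (ContinuousLinearMap.toSpanSingleton ℝ
        ((trivializationAt V (TangentSpace I) x₀).symmL ℝ x v : V)) := by
  have h1 : HasMFDerivAt 𝓘(ℝ, V) I (extChartAt I x₀).symm (c 0) _ :=
    (((contMDiffOn_extChartAt_symm (n := ∞) x₀).contMDiffAt
      ((isOpen_extChartAt_target x₀).mem_nhds (by
        rw [hc0]; exact (extChartAt I x₀).map_source hx))).mdifferentiableAt
          (by simp)).hasMFDerivAt
  have h2 := h1.comp (0 : ℝ) hc.hasFDerivAt.hasMFDerivAt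
  have h3 := TangentBundle.symmL_trivializationAt (I := I) (x₀ := x₀) (x := x)
    (by rwa [extChartAt_source] at hx)
  rw [I.range_eq_univ, mfderivWithin_univ, ← hc0] at h3
  have h4 := DFunLike.congr_fun h3 v
  refine h2.congr_mfderiv ?_
  refine ContinuousLinearMap.ext fun (a : ℝ) => ?_
  have h5 : mfderiv 𝓘(ℝ, V) I (extChartAt I x₀).symm (c 0) (a • v : V) =
      (a • mfderiv 𝓘(ℝ, V) I (extChartAt I x₀).symm (c 0) v : V) :=
    (mfderiv 𝓘(ℝ, V) I (extChartAt I x₀).symm (c 0)).map_smul a v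
  exact h5.trans (congrArg (fun w : V => a • w) h4.symm)

theorem isTangentTo_symmL {S : Set M} {x₀ x : M} (hx : x ∈ (extChartAt I x₀).source)
    {c : ℝ → V} {v : V} (hcs : ContDiffAt ℝ ∞ c 0) (hc : HasDerivAt c v 0)
    (hc0 : c 0 = extChartAt I x₀ x) (hS : ∀ᶠ s in 𝓝 0, (extChartAt I x₀).symm (c s) ∈ S) :
    IsTangentTo I S x ((trivializationAt V (TangentSpace I) x₀).symmL ℝ x v) :=
  ⟨fun s => (extChartAt I x₀).symm (c s), by simp only [hc0]; exact (extChartAt I x₀).left_inv hx,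
    contMDiffAt_extChartAt_symm_comp hx hcs hc0, hS, hasMFDerivAt_extChartAt_symm_comp hx hc hc0⟩

end ChartCurves

/-! ### Extending tangent vectors of `W_o` to vector fields -/

section UnifiedVectorFields

variable {n m : ℕ} {E : Type*} [TopologicalSpace E] [ChartedSpace (ℝ × Vec n) E]
  [IsManifold 𝓘(ℝ, ℝ × Vec n) ∞ E] {π : E → ℝ} [IsFibredOverReal n π]

/-- The coordinates `(t, q_0, …, q_{2k-1}, p^0, …, p^{k-1})` extracted from natural coordinates. -/
noncomputable def unifiedBase (n m : ℕ) :
    JetCoord n (2 * m + 1) × (JetCoord n m × (JetCoord n m →L[ℝ] ℝ)) →L[ℝ]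
      JetCoord n (2 * m + 1) × ((Fin (m + 1) → Vec n) →L[ℝ] ℝ) :=
  (ContinuousLinearMap.fst ℝ _ _).prod
    ((((ContinuousLinearMap.compL ℝ (Fin (m + 1) → Vec n) (JetCoord n m) ℝ).flip
      (ContinuousLinearMap.inr ℝ ℝ (Fin (m + 1) → Vec n))).comp
      (ContinuousLinearMap.snd ℝ (JetCoord n m) (JetCoord n m →L[ℝ] ℝ))).comp
        (ContinuousLinearMap.snd ℝ _ _))

theorem unifiedBase_apply (z : JetCoord n (2 * m + 1)) (q : JetCoord n m)
    (P : JetCoord n m →L[ℝ] ℝ) :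
    unifiedBase n m (z, (q, P)) =
      (z, P.comp (ContinuousLinearMap.inr ℝ ℝ (Fin (m + 1) → Vec n))) := rfl

theorem unifiedBase_unifiedParam (L : Jet n π (m + 1) → ℝ) (x : E)
    (p : JetCoord n (2 * m + 1) × ((Fin (m + 1) → Vec n) →L[ℝ] ℝ)) :
    unifiedBase n m (unifiedParam L x p) = p := by
  rw [unifiedParam, unifiedBase_apply]
  refine Prod.ext rfl ?_
  ext u
  simp [liftCovector_apply]

/-- Since `unifiedBase` is a left inverse of `unifiedParam`, the composite is a retraction and `W_o`
is its fixed-point set in the chart. An equation of this form can be differentiated along maps into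
`W_o`. -/
theorem mem_hamiltonianSubmanifold_iff' (L : Jet n π (m + 1) → ℝ) {w₀ w : UnifiedSpace n π m}
    (h₀ : w₀.1.point = w₀.2.1.point) (hw : w ∈ (extChartAt (unifiedModel n m) w₀).source) :
    w ∈ hamiltonianSubmanifold L ↔ unifiedParam L w₀.1.point (unifiedBase n m
      (extChartAt (unifiedModel n m) w₀ w)) = extChartAt (unifiedModel n m) w₀ w := by
  rw [mem_hamiltonianSubmanifold_iff L h₀ hw, eq_comm]
  rfl

/-- The two factors of a point of `W_o` lie over the same point of `E`, so one membership condition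
in `E` controls both charts. -/
theorem mem_unifiedChart_source {L : Jet n π (m + 1) → ℝ} {w₀ w : UnifiedSpace n π m}
    (h₀ : w₀.1.point = w₀.2.1.point) (hw : w ∈ hamiltonianSubmanifold L)
    (hx : w.1.point ∈ (adaptedChart (n := n) π w₀.1.point).source) :
    w ∈ (extChartAt (unifiedModel n m) w₀).source := by
  rw [unifiedChart_source]
  refine ⟨hx, ?_⟩
  rw [← h₀, ← hw.1, Jet.point_proj]
  exact hx

theorem unifiedParam_mem_target {w₀ : UnifiedSpace n π m} (h₀ : w₀.1.point = w₀.2.1.point)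
    (L : Jet n π (m + 1) → ℝ)
    {p : JetCoord n (2 * m + 1) × ((Fin (m + 1) → Vec n) →L[ℝ] ℝ)}
    (hp : p.1 ∈ (natChart (n := n) π (2 * m + 1) w₀.1.point).target) :
    unifiedParam L w₀.1.point p ∈ (extChartAt (unifiedModel n m) w₀).target := by
  rw [unifiedChart_target, ← h₀]
  exact ⟨hp, hp, trivial⟩

theorem unifiedParam_mem_hamiltonianSubmanifold {w₀ : UnifiedSpace n π m}
    (h₀ : w₀.1.point = w₀.2.1.point) (L : Jet n π (m + 1) → ℝ)
    {p : JetCoord n (2 * m + 1) × ((Fin (m + 1) → Vec n) →L[ℝ] ℝ)}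
    (hp : p.1 ∈ (natChart (n := n) π (2 * m + 1) w₀.1.point).target) :
    (extChartAt (unifiedModel n m) w₀).symm (unifiedParam L w₀.1.point p) ∈
      hamiltonianSubmanifold L := by
  have h := unifiedParam_mem_target h₀ L hp
  rw [mem_hamiltonianSubmanifold_iff' L h₀ ((extChartAt (unifiedModel n m) w₀).map_target h),
    (extChartAt (unifiedModel n m) w₀).right_inv h, unifiedBase_unifiedParam]

set_option maxHeartbeats 2000000 in
/-- Every tangent vector of `W_o` is the value of a vector field on `W_o`. -/
theorem exists_isVectorFieldOn_hamiltonianSubmanifold [T2Space E] {L : Jet n π (m + 1) → ℝ}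
    (hL : ContMDiff 𝓘(ℝ, JetCoord n (m + 1)) 𝓘(ℝ, ℝ) ∞ L) {w₀ w₁ : UnifiedSpace n π m}
    (h₀ : w₀.1.point = w₀.2.1.point) (hw₁ : w₁ ∈ hamiltonianSubmanifold L)
    (hx₁ : w₁.1.point ∈ (adaptedChart (n := n) π w₀.1.point).source)
    (ξ : JetCoord n (2 * m + 1) × ((Fin (m + 1) → Vec n) →L[ℝ] ℝ)) :
    ∃ Y : ∀ w : UnifiedSpace n π m, TangentSpace (unifiedModel n m) w,
      IsVectorFieldOn (unifiedModel n m) (hamiltonianSubmanifold L) Y ∧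
      (mfderiv (unifiedModel n m)
        𝓘(ℝ, JetCoord n (2 * m + 1) × (JetCoord n m × (JetCoord n m →L[ℝ] ℝ)))
        (extChartAt (unifiedModel n m) w₀) w₁ (Y w₁) :
          JetCoord n (2 * m + 1) × (JetCoord n m × (JetCoord n m →L[ℝ] ℝ))) =
      fderiv ℝ (unifiedParam L w₀.1.point)
        (unifiedBase n m (extChartAt (unifiedModel n m) w₀ w₁)) ξ := by
  set S := (adaptedChart (n := n) π w₀.1.point).source with hS
  have hSopen : IsOpen S := (adaptedChart (n := n) π w₀.1.point).open_source
  -- The cut-off lives on `E`, where the Hausdorff property is assumed, and is pulled back. On `W_o`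
  -- the chart domain is the preimage of `S`, so the cut-off field extends by zero.
  obtain ⟨χ, -, hχ⟩ := (SmoothBumpFunction.nhds_basis_tsupport (I := 𝓘(ℝ, ℝ × Vec n))
    w₁.1.point).mem_iff.1 (hSopen.mem_nhds hx₁)
  set κ := extChartAt (unifiedModel n m) w₀ with hκ
  set T := (natChart (n := n) π (2 * m + 1) w₀.1.point).target with hT
  have hTopen : IsOpen T := (natChart (n := n) π (2 * m + 1) w₀.1.point).open_target
  set Γ := unifiedParam L w₀.1.point with hΓ
  have hΓs : ContDiffOn ℝ ∞ Γ (T ×ˢ univ) := contDiffOn_unifiedParam hL _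
  have hTU : IsOpen (T ×ˢ (univ : Set ((Fin (m + 1) → Vec n) →L[ℝ] ℝ))) :=
    hTopen.prod isOpen_univ
  set vec : UnifiedSpace n π m → JetCoord n (2 * m + 1) ×
      (JetCoord n m × (JetCoord n m →L[ℝ] ℝ)) :=
    fun w => χ w.1.point • fderiv ℝ Γ (unifiedBase n m (κ w)) ξ with hvec
  have hsrc : ∀ w ∈ hamiltonianSubmanifold L, w.1.point ∈ S → w ∈ κ.source := fun w hw hx =>
    mem_unifiedChart_source h₀ hw hx
  have hbaseT : ∀ w ∈ κ.source, unifiedBase n m (κ w) ∈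
      T ×ˢ (univ : Set ((Fin (m + 1) → Vec n) →L[ℝ] ℝ)) := by
    intro w hw
    refine ⟨?_, trivial⟩
    have := κ.map_source hw
    rw [hκ, unifiedChart_target] at this
    exact this.1
  have hpt : ContMDiff (unifiedModel n m) 𝓘(ℝ, ℝ × Vec n) ∞
      (fun w : UnifiedSpace n π m => w.1.point) := contMDiff_jet_point.comp contMDiff_fst
  have hχs : ContMDiff (unifiedModel n m) 𝓘(ℝ, ℝ) ∞
      (fun w : UnifiedSpace n π m => χ w.1.point) := χ.contMDiff.comp hpt
  refine ⟨fun w => (trivializationAt _ (TangentSpace (unifiedModel n m)) w₀).symmL ℝ w (vec w),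
    ⟨contMDiffOn_symmL_trivializationAt fun w hw => ?_, fun w hw => ?_⟩, ?_⟩
  · by_cases hx : w.1.point ∈ S
    · have hwκ := hsrc w hw hx
      refine Or.inl ⟨hwκ, ?_⟩
      have h2 : ContMDiffAt (unifiedModel n m)
          𝓘(ℝ, JetCoord n (2 * m + 1) × (JetCoord n m × (JetCoord n m →L[ℝ] ℝ))) ∞ κ w :=
        contMDiffAt_extChartAt' (by rwa [hκ, extChartAt_source] at hwκ)
      have h3 : ContDiffAt ℝ ∞ (fun z => fderiv ℝ Γ (unifiedBase n m z) ξ) (κ w) := by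
        have h4 : ContDiffAt ℝ ∞ (fderiv ℝ Γ) (unifiedBase n m (κ w)) :=
          (hΓs.fderiv_of_isOpen hTU (by simp)).contDiffAt (hTU.mem_nhds (hbaseT w hwκ))
        exact (h4.comp (κ w) (unifiedBase n m).contDiff.contDiffAt).clm_apply contDiffAt_const
      exact (hχs.contMDiffAt).smul (h3.contMDiffAt.comp w h2)
    · refine Or.inr ?_
      filter_upwards [hpt.continuous.continuousAt.preimage_mem_nhds
          ((isClosed_tsupport χ).isOpen_compl.mem_nhds fun h => hx (hχ h))] with w' hw'
      simp only [hvec, image_eq_zero_of_notMem_tsupport hw', zero_smul]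
  · by_cases hx : w.1.point ∈ S
    · have hwκ := hsrc w hw hx
      -- A straight line in the free parameters. Its image under `Γ` stays in `W_o`, and the factor
      -- `χ` in its speed makes the velocity equal to `vec w`.
      set c : ℝ → JetCoord n (2 * m + 1) × ((Fin (m + 1) → Vec n) →L[ℝ] ℝ) :=
        fun s => unifiedBase n m (κ w) + (s * χ w.1.point) • ξ with hc
      have hcs : ContDiff ℝ ∞ c := by fun_prop
      have hc0 : c 0 = unifiedBase n m (κ w) := by simp [hc]
      have hΓc : Γ (c 0) = κ w := by
        rw [hc0]; exact (mem_hamiltonianSubmanifold_iff' L h₀ hwκ).1 hw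
      have hcT : c 0 ∈ T ×ˢ (univ : Set ((Fin (m + 1) → Vec n) →L[ℝ] ℝ)) := by
        rw [hc0]; exact hbaseT w hwκ
      have hcd : HasDerivAt c (χ w.1.point • ξ) 0 := by
        have := (((hasDerivAt_id (0 : ℝ)).mul_const (χ w.1.point)).smul_const ξ).const_add
          (unifiedBase n m (κ w))
        simpa only [id, one_mul] using this
      have hΓ0 : ContDiffAt ℝ ∞ Γ (c 0) := hΓs.contDiffAt (hTU.mem_nhds hcT)
      have hd : HasDerivAt (Γ ∘ c) (vec w) 0 := by
        have := (hΓ0.differentiableAt (by simp)).hasFDerivAt.comp_hasDerivAt (0 : ℝ) hcd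
        rw [map_smul, hc0] at this
        exact this
      refine isTangentTo_symmL (c := Γ ∘ c) hwκ (hΓ0.comp (0 : ℝ) hcs.contDiffAt) hd hΓc ?_
      filter_upwards [hcs.continuous.continuousAt.preimage_mem_nhds (hTU.mem_nhds hcT)] with s hs
      exact unifiedParam_mem_hamiltonianSubmanifold h₀ L hs.1
    · have : vec w = 0 := by
        simp only [hvec, image_eq_zero_of_notMem_tsupport fun h => hx (hχ h), zero_smul]
      rw [this, map_zero]
      exact isTangentTo_zero hw
  -- The bump function is centred at the point below `w₁`, hence equals `1` there.
  · refine (mfderiv_extChartAt_symmL (hsrc w₁ hw₁ hx₁) _).trans ?_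
    simp only [hvec, χ.eq_one, one_smul]
    rfl

end UnifiedVectorFields

/-! ### Order of dependence and the total time derivative -/

section MomentumRecursion

variable {n s : ℕ} {W : Type*} [NormedAddCommGroup W] [NormedSpace ℝ W]

/-- The projection killing the coordinates `q_i` with `i > a`. -/
noncomputable def jetCut (n s a : ℕ) : JetCoord n s →L[ℝ] JetCoord n s :=
  (ContinuousLinearMap.fst ℝ ℝ (Fin (s + 1) → Vec n)).prod
    (ContinuousLinearMap.pi fun i : Fin (s + 1) => if (i : ℕ) ≤ a then
      (ContinuousLinearMap.proj i).comp (ContinuousLinearMap.snd ℝ ℝ (Fin (s + 1) → Vec n)) else 0)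

theorem jetCut_snd (a : ℕ) (z : JetCoord n s) (i : Fin (s + 1)) :
    (jetCut n s a z).2 i = if (i : ℕ) ≤ a then z.2 i else 0 := by
  simp only [jetCut, ContinuousLinearMap.prod_apply, ContinuousLinearMap.coe_pi']
  split_ifs <;> rfl

theorem jetCut_jetCut {a b : ℕ} (hab : a ≤ b) (z : JetCoord n s) :
    jetCut n s a (jetCut n s b z) = jetCut n s a z := by
  refine Prod.ext rfl (funext fun i => ?_)
  simp only [jetCut_snd]
  split_ifs <;> first | rfl | omega

/-- On `T`, the function `f` depends only on `t` and the coordinates `q_i` with `i ≤ a`. -/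
def DependsUpTo (T : Set (JetCoord n s)) (a : ℕ) (f : JetCoord n s → W) : Prop :=
  ∀ z ∈ T, f (jetCut n s a z) = f z

variable {T : Set (JetCoord n s)} {a : ℕ} {f : JetCoord n s → W}

omit [NormedAddCommGroup W] [NormedSpace ℝ W] in
theorem DependsUpTo.mono {b : ℕ} (hT : ∀ a, MapsTo (jetCut n s a) T T) (hf : DependsUpTo T a f)
    (hab : a ≤ b) : DependsUpTo T b f := by
  intro z hz
  rw [← hf _ (hT b hz), jetCut_jetCut hab, hf z hz]

/-- The chain rule for `f ∘ jetCut n s a`, which agrees with `f` near `z` because `T` is open. -/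
theorem DependsUpTo.fderiv_apply_jetCut (hTo : IsOpen T) (hT : ∀ a, MapsTo (jetCut n s a) T T)
    (hf : DependsUpTo T a f) (hd : DifferentiableOn ℝ f T) {z : JetCoord n s} (hz : z ∈ T)
    (v : JetCoord n s) :
    fderiv ℝ f (jetCut n s a z) (jetCut n s a v) = fderiv ℝ f z v := by
  have h1 : (f ∘ jetCut n s a) =ᶠ[𝓝 z] f := by
    filter_upwards [hTo.mem_nhds hz] with z' hz' using hf z' hz'
  have h2 := ((hd _ (hT a hz)).differentiableAt (hTo.mem_nhds (hT a hz))).hasFDerivAt.comp z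
    (jetCut n s a).hasFDerivAt
  rw [← h1.fderiv_eq, h2.fderiv]
  rfl

/-- Both sides are unchanged when `v` is cut as well, since `jetCut` is idempotent. This makes
partial derivatives depend on no more coordinates than `f` does. -/
theorem DependsUpTo.fderiv_jetCut (hTo : IsOpen T) (hT : ∀ a, MapsTo (jetCut n s a) T T)
    (hf : DependsUpTo T a f) (hd : DifferentiableOn ℝ f T) {z : JetCoord n s} (hz : z ∈ T)
    (v : JetCoord n s) :
    fderiv ℝ f (jetCut n s a z) v = fderiv ℝ f z v := by
  rw [← hf.fderiv_apply_jetCut hTo hT hd (hT a hz), jetCut_jetCut le_rfl,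
    hf.fderiv_apply_jetCut hTo hT hd hz]

/-- The total time derivative raises the order of dependence by one. -/
theorem DependsUpTo.timeDeriv (hTo : IsOpen T) (hT : ∀ a, MapsTo (jetCut n s a) T T)
    (hf : DependsUpTo T a f) (hd : DifferentiableOn ℝ f T) :
    DependsUpTo T (a + 1) (totalTimeDeriv f) := by
  intro z hz
  unfold totalTimeDeriv
  rw [← hf.fderiv_apply_jetCut hTo hT hd (hT (a + 1) hz), jetCut_jetCut (Nat.le_succ a),
    ← hf.fderiv_apply_jetCut hTo hT hd hz]
  congr 1
  -- For `i ≤ a` the component is `q_{i+1}`, which survives the cut at `a + 1`.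
  refine Prod.ext rfl (funext fun i => ?_)
  simp only [jetCut_snd]
  split_ifs <;> first | rfl | omega

theorem contDiffOn_totalTimeDeriv (hTo : IsOpen T) (hf : ContDiffOn ℝ ∞ f T) :
    ContDiffOn ℝ ∞ (totalTimeDeriv f) T := by
  have h1 : ContDiff ℝ ∞ (fun z : JetCoord n s => ((1, fun i : Fin (s + 1) =>
      if h : (i : ℕ) + 1 < s + 1 then z.2 ⟨i + 1, h⟩ else 0) : JetCoord n s)) := by
    refine contDiff_const.prodMk (contDiff_pi.2 fun i => ?_)
    split_ifs <;> fun_prop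
  exact (hf.fderiv_of_isOpen hTo (by simp)).clm_apply h1.contDiffOn

theorem contDiffOn_totalTimeDeriv_iterate (hTo : IsOpen T) (hf : ContDiffOn ℝ ∞ f T) (j : ℕ) :
    ContDiffOn ℝ ∞ (totalTimeDeriv^[j] f) T := by
  induction j with
  | zero => exact hf
  | succ j ih =>
    rw [Function.iterate_succ_apply']
    exact contDiffOn_totalTimeDeriv hTo ih

theorem DependsUpTo.timeDeriv_iterate (hTo : IsOpen T) (hT : ∀ a, MapsTo (jetCut n s a) T T)
    (hf : DependsUpTo T a f) (hd : ContDiffOn ℝ ∞ f T) (j : ℕ) :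
    DependsUpTo T (a + j) (totalTimeDeriv^[j] f) := by
  induction j with
  | zero => exact hf
  | succ j ih =>
    rw [Function.iterate_succ_apply']
    exact ih.timeDeriv hTo hT
      ((contDiffOn_totalTimeDeriv_iterate hTo hd j).differentiableOn (by simp))

/-- Along a holonomic curve the time derivative is the total time derivative. -/
theorem DependsUpTo.hasDerivAt_comp (hTo : IsOpen T) (hT : ∀ a, MapsTo (jetCut n s a) T T)
    (hf : DependsUpTo T a f) (hd : DifferentiableOn ℝ f T) (ha : a < s) {c : ℝ → JetCoord n s}
    {c' : JetCoord n s} {t : ℝ} (hc : HasDerivAt c c' t) (hct : c t ∈ T) (h1 : c'.1 = 1)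
    (h2 : ∀ (i : ℕ) (hi : i < s), c'.2 ⟨i, by omega⟩ = (c t).2 ⟨i + 1, by omega⟩) :
    HasDerivAt (fun τ => f (c τ)) (totalTimeDeriv f (c t)) t := by
  have h3 := ((hd _ hct).differentiableAt (hTo.mem_nhds hct)).hasFDerivAt.comp_hasDerivAt t hc
  refine h3.congr_deriv ?_
  unfold totalTimeDeriv
  -- After cutting at `a < s` the components of order `s` disappear: neither the default `0` in
  -- `totalTimeDeriv` nor the unconstrained top component of `c'` matters.
  rw [← hf.fderiv_apply_jetCut hTo hT hd hct, ← hf.fderiv_apply_jetCut hTo hT hd hct]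
  congr 1
  refine Prod.ext h1 (funext fun i => ?_)
  simp only [jetCut_snd]
  split_ifs with h4 h5
  · exact h2 i (by omega)
  · omega
  · rfl

theorem DependsUpTo.partialDeriv {f : JetCoord n s → ℝ} (hTo : IsOpen T)
    (hT : ∀ a, MapsTo (jetCut n s a) T T)
    (hf : DependsUpTo T a f) (hd : DifferentiableOn ℝ f T) (i : Fin (s + 1)) :
    DependsUpTo T a (partialCoord f i) := by
  intro z hz
  ext v
  exact hf.fderiv_jetCut hTo hT hd hz _

theorem contDiffOn_partialCoord {f : JetCoord n s → ℝ} (hTo : IsOpen T)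
    (hf : ContDiffOn ℝ ∞ f T) (i : Fin (s + 1)) : ContDiffOn ℝ ∞ (partialCoord f i) T :=
  (hf.fderiv_of_isOpen hTo (by simp)).clm_comp contDiffOn_const

end MomentumRecursion

/-! ### The Legendre momenta in a natural chart -/

section Momenta

variable {n m : ℕ} {E : Type*} [TopologicalSpace E] [ChartedSpace (ℝ × Vec n) E]
  [IsManifold 𝓘(ℝ, ℝ × Vec n) ∞ E] {π : E → ℝ} [IsFibredOverReal n π]

/-- A natural chart restricts only `t` and `q_0`, and no cut removes `q_0`. -/
theorem mapsTo_jetCut_natChart_target (r : ℕ) (x : E) (a : ℕ) :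
    MapsTo (jetCut n r a) (natChart (n := n) π r x).target (natChart (n := n) π r x).target := by
  intro z hz
  rw [natChart_target, mem_ofPred_eq] at hz ⊢
  rw [jetCut_snd]
  exact hz

theorem dependsUpTo_localLagrangian (L : Jet n π (m + 1) → ℝ) (x : E) :
    DependsUpTo (natChart (n := n) π (2 * m + 1) x).target (m + 1) (localLagrangian L x) := by
  intro z _
  rw [localLagrangian_eq, localLagrangian_eq]
  congr 2
  refine Prod.ext rfl (funext fun i => ?_)
  rw [jetTrunc_snd, jetCut_snd, if_pos (by have := i.2; simp; omega)]
  rfl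

/-- The momenta in a natural chart. -/
noncomputable def localMomentum (L : Jet n π (m + 1) → ℝ) (x : E) (i : Fin (m + 1)) :
    JetCoord n (2 * m + 1) → Vec n →L[ℝ] ℝ :=
  momentum L _ (adaptedChart_isAdapted π x) i

/-- The partial derivative `∂L/∂q_l` in a natural chart. -/
noncomputable def lagrangianPartial (L : Jet n π (m + 1) → ℝ) (x : E) (l : ℕ) :
    JetCoord n (2 * m + 1) → Vec n →L[ℝ] ℝ :=
  if h : l < 2 * m + 1 + 1 then partialCoord (localLagrangian L x) ⟨l, h⟩ else 0

/-- Summation over natural numbers, with partial derivatives indexed by `ℕ`, lets the recursion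
shift its indices without transporting elements of `Fin`. -/
theorem localMomentum_eq (L : Jet n π (m + 1) → ℝ) (x : E) (i : Fin (m + 1))
    (z : JetCoord n (2 * m + 1)) :
    localMomentum L x i z = ∑ j ∈ Finset.range (m + 1 - i),
      (-1 : ℝ) ^ j • totalTimeDeriv^[j] (lagrangianPartial L x (i + 1 + j)) z := by
  rw [← Fin.sum_univ_eq_sum_range (α := Vec n →L[ℝ] ℝ)
    (fun j => (-1 : ℝ) ^ j • totalTimeDeriv^[j] (lagrangianPartial L x (i + 1 + j)) z)]
  unfold localMomentum momentum
  refine Finset.sum_congr rfl fun j _ => ?_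
  rw [lagrangianPartial, dif_pos (by omega)]
  rfl

variable {L : Jet n π (m + 1) → ℝ}

theorem contDiffOn_lagrangianPartial (hL : ContMDiff 𝓘(ℝ, JetCoord n (m + 1)) 𝓘(ℝ, ℝ) ∞ L)
    (x : E) (l : ℕ) :
    ContDiffOn ℝ ∞ (lagrangianPartial L x l) (natChart (n := n) π (2 * m + 1) x).target := by
  unfold lagrangianPartial
  split_ifs
  · exact contDiffOn_partialCoord (natChart π (2 * m + 1) x).open_target
      (contDiffOn_localLagrangian hL x) _
  · exact contDiffOn_const

theorem dependsUpTo_lagrangianPartial (hL : ContMDiff 𝓘(ℝ, JetCoord n (m + 1)) 𝓘(ℝ, ℝ) ∞ L)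
    (x : E) (l : ℕ) :
    DependsUpTo (natChart (n := n) π (2 * m + 1) x).target (m + 1) (lagrangianPartial L x l) := by
  unfold lagrangianPartial
  split_ifs
  · exact (dependsUpTo_localLagrangian L x).partialDeriv (natChart π (2 * m + 1) x).open_target
      (mapsTo_jetCut_natChart_target _ x)
      ((contDiffOn_localLagrangian hL x).differentiableOn (by simp)) _
  · exact fun _ _ => rfl

theorem contDiffOn_localMomentum (hL : ContMDiff 𝓘(ℝ, JetCoord n (m + 1)) 𝓘(ℝ, ℝ) ∞ L)
    (x : E) (i : Fin (m + 1)) :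
    ContDiffOn ℝ ∞ (localMomentum L x i) (natChart (n := n) π (2 * m + 1) x).target := by
  refine ContDiffOn.congr ?_ fun z _ => localMomentum_eq L x i z
  exact ContDiffOn.sum fun j _ => ContDiffOn.const_smul _
    (contDiffOn_totalTimeDeriv_iterate (natChart π (2 * m + 1) x).open_target
      (contDiffOn_lagrangianPartial hL x _) j)

/-- The `j`-th summand has order at most `m + 1 + j`, and `j ≤ m - i`. -/
theorem dependsUpTo_localMomentum (hL : ContMDiff 𝓘(ℝ, JetCoord n (m + 1)) 𝓘(ℝ, ℝ) ∞ L)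
    (x : E) (i : Fin (m + 1)) :
    DependsUpTo (natChart (n := n) π (2 * m + 1) x).target (2 * m + 1 - i)
      (localMomentum L x i) := by
  intro z hz
  rw [localMomentum_eq, localMomentum_eq]
  refine Finset.sum_congr rfl fun j hj => ?_
  have hj' := Finset.mem_range.1 hj
  congr 1
  exact (((dependsUpTo_lagrangianPartial hL x (i + 1 + j)).timeDeriv_iterate
    (natChart π (2 * m + 1) x).open_target (mapsTo_jetCut_natChart_target _ x)
    (contDiffOn_lagrangianPartial hL x _) j).mono (mapsTo_jetCut_natChart_target _ x)
    (by omega)) z hz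

theorem localMomentum_last (L : Jet n π (m + 1) → ℝ) (x : E) (z : JetCoord n (2 * m + 1)) :
    localMomentum L x (Fin.last m) z = lagrangianPartial L x (m + 1) z := by
  rw [localMomentum_eq]
  simp

/-- The recursion `p^{i-1} = ∂L/∂q_i - d_T p^i`. -/
theorem localMomentum_eq_sub (hL : ContMDiff 𝓘(ℝ, JetCoord n (m + 1)) 𝓘(ℝ, ℝ) ∞ L) {x : E}
    {i : ℕ} (hi : i < m) {z : JetCoord n (2 * m + 1)}
    (hz : z ∈ (natChart (n := n) π (2 * m + 1) x).target) :
    localMomentum L x ⟨i, by omega⟩ z = lagrangianPartial L x (i + 1) z -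
      totalTimeDeriv (localMomentum L x ⟨i + 1, by omega⟩) z := by
  have hTo := (natChart (n := n) π (2 * m + 1) x).open_target
  have h1 : totalTimeDeriv (localMomentum L x ⟨i + 1, by omega⟩) z =
      ∑ j ∈ Finset.range (m + 1 - (i + 1)), (-1 : ℝ) ^ j •
        totalTimeDeriv^[j + 1] (lagrangianPartial L x (i + 1 + 1 + j)) z := by
    have h2 : HasFDerivAt (fun z => ∑ j ∈ Finset.range (m + 1 - (i + 1)), (-1 : ℝ) ^ j •
        totalTimeDeriv^[j] (lagrangianPartial L x (i + 1 + 1 + j)) z) _ z :=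
      HasFDerivAt.fun_sum fun j _ => (((contDiffOn_totalTimeDeriv_iterate hTo
        (contDiffOn_lagrangianPartial hL x (i + 1 + 1 + j)) j).contDiffAt
          (hTo.mem_nhds hz)).differentiableAt (by simp)).hasFDerivAt.const_smul ((-1 : ℝ) ^ j)
    have h3 : localMomentum L x ⟨i + 1, by omega⟩ = _ := funext (localMomentum_eq L x _)
    unfold totalTimeDeriv
    rw [h3, h2.fderiv, sum_apply]
    refine Finset.sum_congr rfl fun j _ => ?_
    rw [Function.iterate_succ_apply']
    rfl
  rw [h1, localMomentum_eq]
  have h4 : m + 1 - ((⟨i, by omega⟩ : Fin (m + 1)) : ℕ) = (m + 1 - (i + 1)) + 1 := by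
    simp only []; omega
  -- The term `j = 0` is `∂L/∂q_{i+1}`. The others are those of `d_T p^{i+1}` with the index raised
  -- by one, hence with opposite sign.
  rw [h4, Finset.sum_range_succ', add_comm, sub_eq_add_neg, ← Finset.sum_neg_distrib]
  congr 1
  · simp
  · refine Finset.sum_congr rfl fun j _ => ?_
    have : i + 1 + (j + 1) = i + 1 + 1 + j := by omega
    simp only [pow_succ, mul_neg_one, this]
    exact neg_smul ((-1 : ℝ) ^ j)
      (totalTimeDeriv^[j + 1] (lagrangianPartial L x (i + 1 + 1 + j)) z)

end Momenta

/-! ### The unified equation in natural coordinates -/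

section UnifiedEquation

variable {n m : ℕ} {E : Type*} [TopologicalSpace E] [ChartedSpace (ℝ × Vec n) E]
  [IsManifold 𝓘(ℝ, ℝ × Vec n) ∞ E] {π : E → ℝ} [IsFibredOverReal n π]

/-- The product rule for the dependent coordinate: `dp = dL - ∑ (p^i dq_{i+1} + q_{i+1} dp^i)`. All
other coordinates are linear in the parameters. -/
theorem fderiv_unifiedParam {L : Jet n π (m + 1) → ℝ}
    (hL : ContMDiff 𝓘(ℝ, JetCoord n (m + 1)) 𝓘(ℝ, ℝ) ∞ L) {x : E}
    {p : JetCoord n (2 * m + 1) × ((Fin (m + 1) → Vec n) →L[ℝ] ℝ)}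
    (hp : p.1 ∈ (natChart (n := n) π (2 * m + 1) x).target)
    (ξ : JetCoord n (2 * m + 1) × ((Fin (m + 1) → Vec n) →L[ℝ] ℝ)) :
    fderiv ℝ (unifiedParam L x) p ξ = (ξ.1, (jetTrunc n (by omega) ξ.1,
      (fderiv ℝ (localLagrangian L x) p.1 ξ.1 - (p.2 (jetShift n m ξ.1) + ξ.2 (jetShift n m p.1))) •
        ContinuousLinearMap.fst ℝ ℝ (Fin (m + 1) → Vec n) +
          ξ.2.comp (ContinuousLinearMap.snd ℝ ℝ (Fin (m + 1) → Vec n)))) := by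
  have h1 : HasFDerivAt (fun p : JetCoord n (2 * m + 1) × ((Fin (m + 1) → Vec n) →L[ℝ] ℝ) =>
      localLagrangian L x p.1) _ p :=
    ((((contDiffOn_localLagrangian hL x).contDiffAt
      ((natChart π (2 * m + 1) x).open_target.mem_nhds hp)).differentiableAt
        (by simp)).hasFDerivAt).comp p hasFDerivAt_fst
  have h2 : HasFDerivAt (fun p : JetCoord n (2 * m + 1) × ((Fin (m + 1) → Vec n) →L[ℝ] ℝ) =>
      p.2 (jetShift n m p.1)) _ p :=
    hasFDerivAt_snd.clm_apply ((jetShift n m).hasFDerivAt.comp p hasFDerivAt_fst)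
  have h3 : HasFDerivAt (fun p : JetCoord n (2 * m + 1) × ((Fin (m + 1) → Vec n) →L[ℝ] ℝ) =>
      p.2.comp (ContinuousLinearMap.snd ℝ ℝ (Fin (m + 1) → Vec n))) _ p :=
    ((((ContinuousLinearMap.compL ℝ (JetCoord n m) (Fin (m + 1) → Vec n) ℝ).flip
      (ContinuousLinearMap.snd ℝ ℝ (Fin (m + 1) → Vec n))).comp
        (ContinuousLinearMap.snd ℝ (JetCoord n (2 * m + 1)) _)) :
          JetCoord n (2 * m + 1) × ((Fin (m + 1) → Vec n) →L[ℝ] ℝ) →L[ℝ] _).hasFDerivAt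
  have h4 : HasFDerivAt (fun p : JetCoord n (2 * m + 1) × ((Fin (m + 1) → Vec n) →L[ℝ] ℝ) =>
      jetTrunc n (by omega : m ≤ 2 * m + 1) p.1) _ p :=
    (jetTrunc n (by omega : m ≤ 2 * m + 1)).hasFDerivAt.comp p
      hasFDerivAt_fst
  have h5 : HasFDerivAt (unifiedParam L x) _ p :=
    hasFDerivAt_fst.prodMk (h4.prodMk
      (((h1.sub h2).smul_const (ContinuousLinearMap.fst ℝ ℝ (Fin (m + 1) → Vec n))).add h3))
  rw [h5.fderiv]
  rfl

/-- The form `Ω_o` in natural coordinates. -/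
theorem unifiedTwoForm_eq {w₀ w : UnifiedSpace n π m}
    (hw : w ∈ (extChartAt (unifiedModel n m) w₀).source)
    {K : JetCoord n (2 * m + 1) × (JetCoord n m × (JetCoord n m →L[ℝ] ℝ)) →L[ℝ]
      JetCoord n (2 * m + 1) × (JetCoord n m × (JetCoord n m →L[ℝ] ℝ))}
    (hK : HasMFDerivAt (unifiedModel n m)
      𝓘(ℝ, JetCoord n (2 * m + 1) × (JetCoord n m × (JetCoord n m →L[ℝ] ℝ)))
      (extChartAt (unifiedModel n m) w₀) w K)
    (u v : JetCoord n (2 * m + 1) × (JetCoord n m × (JetCoord n m →L[ℝ] ℝ))) :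
    unifiedTwoForm w u v = (K v).2.2 (K u).2.1 - (K u).2.2 (K v).2.1 := by
  rw [unifiedChart_source] at hw
  have hsrc : w.2.1 ∈ (chartAt (JetCoord n m) w₀.2.1).source := hw.2
  have hmem : w.2 ∈ (chartAt (ModelProd (JetCoord n m) (JetCoord n m →L[ℝ] ℝ)) w₀.2).source := by
    have := cotangentChart_source w₀.2
    rw [extChartAt_source] at this
    rw [this]; exact hsrc
  have h1 : HasMFDerivAt (cotangentModel (JetCoord n m))
      𝓘(ℝ, JetCoord n m × (JetCoord n m →L[ℝ] ℝ))
      (extChartAt (cotangentModel (JetCoord n m)) w₀.2) w.2 _ :=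
    (mdifferentiableAt_extChartAt hmem).hasMFDerivAt
  have h2 : HasMFDerivAt (unifiedModel n m) (cotangentModel (JetCoord n m))
      (Prod.snd : UnifiedSpace n π m → _) w _ :=
    (mdifferentiableAt_snd (I := 𝓘(ℝ, JetCoord n (2 * m + 1)))
      (I' := cotangentModel (JetCoord n m))).hasMFDerivAt
  have h3 := h1.comp w h2
  have h4 : HasMFDerivAt (unifiedModel n m) 𝓘(ℝ, JetCoord n m × (JetCoord n m →L[ℝ] ℝ))
      (Prod.snd ∘ extChartAt (unifiedModel n m) w₀) w _ :=
    HasMFDerivAt.comp w (I' := 𝓘(ℝ, JetCoord n (2 * m + 1) ×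
      (JetCoord n m × (JetCoord n m →L[ℝ] ℝ)))) (ContinuousLinearMap.snd ℝ
        (JetCoord n (2 * m + 1)) (JetCoord n m × (JetCoord n m →L[ℝ] ℝ))).hasMFDerivAt hK
  have h5 := hasMFDerivAt_unique h3 h4
  have hu := DFunLike.congr_fun h5 u
  have hv := DFunLike.congr_fun h5 v
  refine (canonicalTwoForm_eq hsrc _ h1 _ _).trans ?_
  refine Eq.trans ?_ (congrArg₂ (fun a b : JetCoord n m × (JetCoord n m →L[ℝ] ℝ) =>
    b.2 a.1 - a.2 b.1) hu hv)
  rfl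

/-- The unified equation in natural coordinates. -/
theorem SolvesUnifiedEquation.coord [T2Space E] {L : Jet n π (m + 1) → ℝ}
    (hL : ContMDiff 𝓘(ℝ, JetCoord n (m + 1)) 𝓘(ℝ, ℝ) ∞ L) {ψ : ℝ → UnifiedSpace n π m}
    (hψ : IsUnifiedSection L ψ) (hsol : SolvesUnifiedEquation L ψ) {w₀ : UnifiedSpace n π m}
    (h₀ : w₀.1.point = w₀.2.1.point) {t : ℝ}
    (hx : (ψ t).1.point ∈ (adaptedChart (n := n) π w₀.1.point).source)
    {c' : JetCoord n (2 * m + 1) × (JetCoord n m × (JetCoord n m →L[ℝ] ℝ))}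
    (hc : HasDerivAt (fun s => extChartAt (unifiedModel n m) w₀ (ψ s)) c' t)
    (ξ : JetCoord n (2 * m + 1) × ((Fin (m + 1) → Vec n) →L[ℝ] ℝ)) :
    c'.2.2 (fderiv ℝ (unifiedParam L w₀.1.point)
        (unifiedBase n m (extChartAt (unifiedModel n m) w₀ (ψ t))) ξ).2.1 =
      (fderiv ℝ (unifiedParam L w₀.1.point)
        (unifiedBase n m (extChartAt (unifiedModel n m) w₀ (ψ t))) ξ).2.2 c'.2.1 := by
  -- The equation is assumed for vector fields only, so the tangent vector with parameters `ξ` is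
  -- extended before testing.
  obtain ⟨Y, hY, hYt⟩ := exists_isVectorFieldOn_hamiltonianSubmanifold hL h₀ (hψ.mem t) hx ξ
  have hw := mem_unifiedChart_source h₀ (hψ.mem t) hx
  have hK : HasMFDerivAt (unifiedModel n m)
      𝓘(ℝ, JetCoord n (2 * m + 1) × (JetCoord n m × (JetCoord n m →L[ℝ] ℝ)))
      (extChartAt (unifiedModel n m) w₀) (ψ t) _ :=
    (mdifferentiableAt_extChartAt (by rwa [extChartAt_source] at hw)).hasMFDerivAt
  have hψt : HasMFDerivAt 𝓘(ℝ, ℝ) (unifiedModel n m) ψ t _ :=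
    ((hψ.contMDiff t).mdifferentiableAt (by simp)).hasMFDerivAt
  have h1 := DFunLike.congr_fun (hasMFDerivAt_unique (hK.comp t hψt) hc.hasFDerivAt.hasMFDerivAt)
    (1 : ℝ)
  have h2 := h1.trans (one_smul ℝ c')
  have h3 := (unifiedTwoForm_eq hw hK _ _).symm.trans (hsol Y hY t (1 : ℝ))
  have h4 := (congrArg₂ (fun a b : JetCoord n (2 * m + 1) ×
    (JetCoord n m × (JetCoord n m →L[ℝ] ℝ)) => b.2.2 a.2.1 - a.2.2 b.2.1) hYt h2).symm.trans h3
  exact sub_eq_zero.1 h4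

end UnifiedEquation

/-! ### Components of curves, and fibre coordinates at the centre of a chart -/

section ProdCurves

variable {X Y : Type*} [NormedAddCommGroup X] [NormedSpace ℝ X] [NormedAddCommGroup Y]
  [NormedSpace ℝ Y] {c : ℝ → X × Y} {c' : X × Y} {t : ℝ}

theorem HasDerivAt.fst' (h : HasDerivAt c c' t) : HasDerivAt (fun s => (c s).1) c'.1 t :=
  (hasFDerivAt_fst (𝕜 := ℝ) (E := X) (F := Y) (p := c t)).comp_hasDerivAt t h

theorem HasDerivAt.snd' (h : HasDerivAt c c' t) : HasDerivAt (fun s => (c s).2) c'.2 t :=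
  (hasFDerivAt_snd (𝕜 := ℝ) (E := X) (F := Y) (p := c t)).comp_hasDerivAt t h

end ProdCurves

section SelfChart

variable {V : Type*} [NormedAddCommGroup V] [NormedSpace ℝ V]
  {M : Type*} [TopologicalSpace M] [ChartedSpace V M] [IsManifold 𝓘(ℝ, V) ∞ M]

/-- The derivative of the preferred chart at its own centre is the identity, so there the coordinate
expression of a covector is the covector itself. -/
theorem cotangentChart_snd_self (q : M) (a b : V →L[ℝ] ℝ) :
    (extChartAt (cotangentModel V) (⟨q, a⟩ : CotangentBundle V M) ⟨q, b⟩).2 = b := by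
  ext v
  have h1 := cotangentChart_snd_mfderiv (α := (⟨q, a⟩ : CotangentBundle V M)) (β := ⟨q, b⟩)
    (mem_chart_source V q) v
  have h2 := DFunLike.congr_fun (mfderiv_extChartAt_self (I := 𝓘(ℝ, V)) (x := q)) v
  exact (congrArg _ h2.symm).trans h1

end SelfChart

theorem Jet.proj_point_eq_time {n r : ℕ} {E : Type*} [TopologicalSpace E]
    [ChartedSpace (ℝ × Vec n) E] {π : E → ℝ} (y : Jet n π r) : π y.point = y.time := by
  rw [← y.mk_rep]
  exact (y.rep.isLocalSection.self_of_nhds).2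

/-! ### Holonomic solutions take values in the Legendre graph -/

section Legendre

variable {n m : ℕ} {E : Type*} [TopologicalSpace E] [ChartedSpace (ℝ × Vec n) E]
  [IsManifold 𝓘(ℝ, ℝ × Vec n) ∞ E] {π : E → ℝ} [IsFibredOverReal n π]

/-- The vertical covector `∑_i p^i dq_i`. -/
noncomputable def momentumCovector (L : Jet n π (m + 1) → ℝ) (x : E)
    (z : JetCoord n (2 * m + 1)) : (Fin (m + 1) → Vec n) →L[ℝ] ℝ :=
  ∑ i : Fin (m + 1), (localMomentum L x i z).comp (ContinuousLinearMap.proj i)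

theorem momentumCovector_apply (L : Jet n π (m + 1) → ℝ) (x : E) (z : JetCoord n (2 * m + 1))
    (v : Fin (m + 1) → Vec n) :
    momentumCovector L x z v = ∑ i : Fin (m + 1), localMomentum L x i z (v i) := by
  simp [momentumCovector]

theorem eq_momentumCovector {L : Jet n π (m + 1) → ℝ} {x : E} {z : JetCoord n (2 * m + 1)}
    {β : (Fin (m + 1) → Vec n) →L[ℝ] ℝ}
    (h : ∀ i v, β (Pi.single i v) = localMomentum L x i z v) : β = momentumCovector L x z := by
  ext v
  rw [momentumCovector_apply]
  conv_lhs => rw [← Finset.univ_sum_single v, map_sum]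
  exact Finset.sum_congr rfl fun i _ => h i _

/-- In this form the extended map visibly solves the coupling condition, and its only data beyond
the jet and `L` are the vertical momenta. -/
theorem extendedLegendre_eq (L : Jet n π (m + 1) → ℝ) (y : Jet n π (2 * m + 1)) :
    extendedLegendre L y = ⟨y.proj (by omega),
      liftCovector (localLagrangian L y.point (natChart π (2 * m + 1) y.point y))
        (jetShift n m (natChart π (2 * m + 1) y.point y))
        (momentumCovector L y.point (natChart π (2 * m + 1) y.point y))⟩ := by
  unfold extendedLegendre
  refine congrArg (Bundle.TotalSpace.mk (y.proj (by omega))) ?_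
  refine ContinuousLinearMap.ext fun (u : JetCoord n m) => ?_
  rw [liftCovector_apply, momentumCovector_apply, momentumCovector_apply]
  refine (add_apply _ _ u).trans ?_
  refine congrArg₂ (· + ·) rfl ?_
  exact (sum_apply _ _ u)

theorem coupling_mk {y : Jet n π (2 * m + 1)} {q : Jet n π m} (hq : y.proj (by omega) = q)
    (P : JetCoord n m →L[ℝ] ℝ) :
    coupling ((y, ⟨q, P⟩) : UnifiedSpace n π m) =
      P (1, jetShift n m (natChart π (2 * m + 1) q.point y)) := by
  have hsrc : y.point ∈ (adaptedChart (n := n) π q.point).source := by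
    rw [← hq, Jet.point_proj]
    exact mem_adaptedChart_source (n := n) π y.point
  have h1 := coupling_eq (α₀ := ⟨q, 0⟩) (w := (y, ⟨q, P⟩)) hq hsrc
  rw [h1]
  exact DFunLike.congr_fun (cotangentChart_snd_self q 0 P) _

/-- The inclusion `W_1 ⊆ W_o`: adding `∑ q_{i+1} p^i` to the time momentum `L - ∑ q_{i+1} p^i` gives
`L`. -/
theorem mem_hamiltonianSubmanifold_extendedLegendre (L : Jet n π (m + 1) → ℝ)
    (y : Jet n π (2 * m + 1)) :
    ((y, extendedLegendre L y) : UnifiedSpace n π m) ∈ hamiltonianSubmanifold L := by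
  rw [extendedLegendre_eq]
  refine ⟨rfl, (coupling_mk rfl _).trans ?_⟩
  rw [Jet.point_proj, liftCovector_apply, localLagrangian_natChart L (mem_adaptedChart_source (n := n) π y.point)]
  ring

/-- A point of `W_o` whose vertical momenta are those of the Legendre map lies in `W_1`. -/
theorem mem_legendreGraph_of_momenta {L : Jet n π (m + 1) → ℝ} {w : UnifiedSpace n π m}
    (hw : w ∈ hamiltonianSubmanifold L)
    (h : ∀ i v, (extChartAt (cotangentModel (JetCoord n m)) w.2 w.2).2 (0, Pi.single i v) =
      localMomentum L w.1.point i (natChart π (2 * m + 1) w.1.point w.1) v) :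
    w ∈ legendreGraph L := by
  obtain ⟨y, q, a⟩ := w
  have hq : y.proj (by omega) = q := hw.1
  subst hq
  have h1 := (mem_hamiltonianSubmanifold_iff L (w₀ := (y, ⟨y.proj (by omega), a⟩))
    (Jet.point_proj (by omega) y).symm (mem_extChartAt_source _)).1 hw
  rw [unifiedChart_apply] at h1
  have h2 := congrArg (fun p => p.2.2) h1
  have h4 : (extChartAt (cotangentModel (JetCoord n m)) (⟨y.proj (by omega), a⟩ :
      CotangentBundle (JetCoord n m) (Jet n π m)) ⟨y.proj (by omega), a⟩).2 = a :=
    cotangentChart_snd_self _ _ _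
  have h3 := eq_momentumCovector (L := L) (x := y.point) (z := natChart π (2 * m + 1) y.point y)
    (β := (a : JetCoord n m →L[ℝ] ℝ).comp (ContinuousLinearMap.inr ℝ ℝ (Fin (m + 1) → Vec n)))
    fun i v => by
      have := h i v
      simp only [h4] at this
      exact this
  change (⟨y.proj (by omega), a⟩ : CotangentBundle (JetCoord n m) (Jet n π m)) =
    extendedLegendre L y
  rw [extendedLegendre_eq]
  refine congrArg (Bundle.TotalSpace.mk (y.proj (by omega))) ?_
  simp only [unifiedParam, h4] at h2
  exact h2.trans (congrArg _ h3)

/-- A holonomic solution of the unified equation takes its values in the graph of the extended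
Legendre-Ostrogradsky map. -/
theorem SolvesUnifiedEquation.mem_legendreGraph [T2Space E] {L : Jet n π (m + 1) → ℝ}
    (hL : ContMDiff 𝓘(ℝ, JetCoord n (m + 1)) 𝓘(ℝ, ℝ) ∞ L) {ψ : ℝ → UnifiedSpace n π m}
    (hψ : IsUnifiedSection L ψ) (hsol : SolvesUnifiedEquation L ψ)
    (hhol : IsHolonomic n π fun t => (ψ t).1) (t₀ : ℝ) : ψ t₀ ∈ legendreGraph L := by
  set w₀ := ψ t₀ with hw₀
  have h₀ : w₀.1.point = w₀.2.1.point := by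
    rw [← (hψ.mem t₀).1, Jet.point_proj]
  set x := w₀.1.point with hx
  set e := adaptedChart (n := n) π x with he
  set φ : ℝ → E := fun t => (ψ t).1.point with hφ
  have hφs : ContMDiff 𝓘(ℝ, ℝ) 𝓘(ℝ, ℝ × Vec n) ∞ φ :=
    contMDiff_jet_point.comp (contMDiff_fst.comp hψ.contMDiff)
  have hsec : ∀ t, IsLocalSection n π φ t := fun t => Eventually.of_forall fun s =>
    ⟨hφs s, (Jet.proj_point_eq_time _).trans (hψ.time_eq s)⟩
  have hjet : ∀ t, (ψ t).1 = jetProlongation n π (2 * m + 1) φ t := fun t => congrFun hhol t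
  -- The identities are proved on this open set of times and not only at `t₀`, because the induction
  -- differentiates them.
  set O := φ ⁻¹' e.source with hO
  have hOo : IsOpen O := e.open_source.preimage hφs.continuous
  set κ := extChartAt (unifiedModel n m) w₀ with hκ
  set f : ℝ → Vec n := fun s => (e (φ s)).2 with hf
  have hsrc : ∀ t ∈ O, ψ t ∈ κ.source := fun t ht => mem_unifiedChart_source h₀ (hψ.mem t) ht
  have hc1 : ∀ t, (κ (ψ t)).1 = natChart π (2 * m + 1) x (jetProlongation n π (2 * m + 1) φ t) := by
    intro t
    rw [← hjet t, hκ, unifiedChart_apply]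
  have hT : ∀ t ∈ O, (κ (ψ t)).1 ∈ (natChart (n := n) π (2 * m + 1) x).target := by
    intro t ht
    have := κ.map_source (hsrc t ht)
    rw [hκ, unifiedChart_target] at this
    exact this.1
  have hκψ : ∀ t ∈ O, κ (ψ t) = unifiedParam L x (unifiedBase n m (κ (ψ t))) := fun t ht =>
    ((mem_hamiltonianSubmanifold_iff' L h₀ (hsrc t ht)).1 (hψ.mem t)).symm
  have hder : ∀ t ∈ O, ∃ c' : JetCoord n (2 * m + 1) × (JetCoord n m × (JetCoord n m →L[ℝ] ℝ)),
      HasDerivAt (fun s => κ (ψ s)) c' t ∧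
      c'.1 = (1, fun i : Fin (2 * m + 1 + 1) => iteratedDeriv (i + 1) f t) ∧
      c'.2.1 = jetTrunc n (by omega) c'.1 := by
    intro t ht
    have h1 : ContMDiffAt (unifiedModel n m)
        𝓘(ℝ, JetCoord n (2 * m + 1) × (JetCoord n m × (JetCoord n m →L[ℝ] ℝ))) ∞ κ (ψ t) :=
      contMDiffAt_extChartAt' (by have := hsrc t ht; rwa [hκ, extChartAt_source] at this)
    have h2 : DifferentiableAt ℝ (fun s => κ (ψ s)) t :=
      ((h1.comp t (hψ.contMDiff t)).contDiffAt).differentiableAt (by simp)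
    have h3 := h2.hasDerivAt
    have h4 : HasDerivAt (fun s => (κ (ψ s)).1) (deriv (fun s => κ (ψ s)) t).1 t :=
      h3.fst'
    have h5 : HasDerivAt (fun s => (κ (ψ s)).2.1) (deriv (fun s => κ (ψ s)) t).2.1 t :=
      h3.snd'.fst'
    refine ⟨_, h3, ?_, ?_⟩
    · refine h4.unique ?_
      simp only [hc1]
      exact hasDerivAt_natChart_jetProlongation (hsec t) ht
    · refine h5.unique ?_
      refine ((jetTrunc n (by omega : m ≤ 2 * m + 1)).hasFDerivAt.comp_hasDerivAt t
        h4).congr_of_eventuallyEq ?_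
      filter_upwards [hOo.mem_nhds ht] with s hs
      exact congrArg (fun p => p.2.1) (hκψ s hs)
  have hcoord : ∀ t ∈ O, ∀ i : Fin (2 * m + 1 + 1), (κ (ψ t)).1.2 i = iteratedDeriv i f t := by
    intro t ht i
    rw [hc1, natChart_jetProlongation (hsec t) ht]
  -- the equations `p^i = ∂L/∂q_{i+1} - (d/dt) p^{i+1}`
  have heq : ∀ t ∈ O, ∀ c' : JetCoord n (2 * m + 1) × (JetCoord n m × (JetCoord n m →L[ℝ] ℝ)),
      HasDerivAt (fun s => κ (ψ s)) c' t → c'.2.1.1 = 1 → ∀ w : Fin (2 * m + 1 + 1) → Vec n,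
      c'.2.2 (0, fun i => w (Fin.castLE (by omega) i)) =
        fderiv ℝ (localLagrangian L x) (κ (ψ t)).1 (0, w) -
          (κ (ψ t)).2.2 (0, fun i => w ⟨i + 1, by omega⟩) := by
    intro t ht c' hc' h1 w
    -- Only jet coordinates vary here; time and the vertical momenta are held fixed. The remaining
    -- variation of the time momentum is multiplied by `dt/dt = 1`.
    have h2 := SolvesUnifiedEquation.coord hL hψ hsol h₀ ht hc' ((0, w), 0)
    rw [fderiv_unifiedParam hL (hT t ht)] at h2
    refine h2.trans ?_
    change (_ - (_ + (0 : ℝ))) * c'.2.1.1 + (0 : ℝ) = _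
    rw [h1, add_zero, add_zero, mul_one]
    rfl
  -- Induction on `m - i`: the top momentum is explicit, and each lower one is obtained by
  -- differentiating the next.
  have main : ∀ k : ℕ, ∀ i (hi : i + k = m), ∀ t ∈ O, ∀ v,
      (κ (ψ t)).2.2 (0, Pi.single ⟨i, by omega⟩ v) =
        localMomentum L x ⟨i, by omega⟩ (κ (ψ t)).1 v := by
    intro k
    induction k with
    | zero =>
      intro i hi t ht v
      obtain rfl : i = m := hi
      obtain ⟨c', hc', h1, h2⟩ := hder t ht
      have h3 := heq t ht c' hc' (by rw [h2, jetTrunc_fst, h1])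
        (Pi.single ⟨i + 1, by omega⟩ v)
      -- The varied coordinate is `q_k`, which is not a coordinate of `J^{k-1} π`, so no derivative
      -- of a momentum appears.
      have h4 : (fun l : Fin (i + 1) => (Pi.single (⟨i + 1, by omega⟩ : Fin (2 * i + 1 + 1)) v :
          Fin (2 * i + 1 + 1) → Vec n) (Fin.castLE (by omega) l)) = 0 := by
        funext l
        rw [Pi.single_apply, if_neg, Pi.zero_apply]
        rw [Fin.ext_iff, Fin.val_castLE]
        change ¬ (l : ℕ) = i + 1
        omega
      have h5 : (fun l : Fin (i + 1) => (Pi.single (⟨i + 1, by omega⟩ : Fin (2 * i + 1 + 1)) v :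
          Fin (2 * i + 1 + 1) → Vec n) ⟨l + 1, by omega⟩) = Pi.single ⟨i, by omega⟩ v := by
        funext l
        simp only [Pi.single_apply, Fin.ext_iff, Nat.add_right_cancel_iff]
      rw [h4, h5] at h3
      have h6 : c'.2.2 (0, 0) = 0 := map_zero c'.2.2
      rw [h6] at h3
      have h7 := localMomentum_last L x (κ (ψ t)).1
      rw [lagrangianPartial, dif_pos (by omega)] at h7
      refine (sub_eq_zero.1 h3.symm).symm.trans ?_
      exact (DFunLike.congr_fun h7 v).symm
    | succ k ih =>
      intro i hi t ht v
      obtain ⟨c', hc', h1, h2⟩ := hder t ht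
      have h3 := heq t ht c' hc' (by rw [h2, jetTrunc_fst, h1])
        (Pi.single ⟨i + 1, by omega⟩ v)
      have h4 : (fun l : Fin (m + 1) => (Pi.single (⟨i + 1, by omega⟩ : Fin (2 * m + 1 + 1)) v :
          Fin (2 * m + 1 + 1) → Vec n) (Fin.castLE (by omega) l)) =
            Pi.single ⟨i + 1, by omega⟩ v := by
        funext l
        simp only [Pi.single_apply, Fin.ext_iff, Fin.val_castLE]
      have h5 : (fun l : Fin (m + 1) => (Pi.single (⟨i + 1, by omega⟩ : Fin (2 * m + 1 + 1)) v :
          Fin (2 * m + 1 + 1) → Vec n) ⟨l + 1, by omega⟩) = Pi.single ⟨i, by omega⟩ v := by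
        funext l
        simp only [Pi.single_apply, Fin.ext_iff, Nat.add_right_cancel_iff]
      rw [h4, h5] at h3
      have h8 : HasDerivAt (fun s => (κ (ψ s)).2.2 (0, Pi.single ⟨i + 1, by omega⟩ v))
          (c'.2.2 (0, Pi.single ⟨i + 1, by omega⟩ v)) t := by
        have := hc'.snd'.snd'
        exact (((ContinuousLinearMap.apply ℝ ℝ ((0, Pi.single ⟨i + 1, by omega⟩ v) :
          JetCoord n m))).hasFDerivAt).comp_hasDerivAt t this
      have h9 : HasDerivAt (fun s => localMomentum L x ⟨i + 1, by omega⟩ (κ (ψ s)).1)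
          (totalTimeDeriv (localMomentum L x ⟨i + 1, by omega⟩) (κ (ψ t)).1) t := by
        -- The momentum `p^{i+1}` has order at most `2 * m - i`, below the top order `2 * m + 1`, so
        -- its total derivative is its time derivative along the prolongation.
        refine (dependsUpTo_localMomentum hL x ⟨i + 1, by omega⟩).hasDerivAt_comp
          (natChart π (2 * m + 1) x).open_target (mapsTo_jetCut_natChart_target _ x)
          ((contDiffOn_localMomentum hL x _).differentiableOn (by simp)) (by simp only []; omega)
          (c' := c'.1) (hc'.fst') (hT t ht) (by rw [h1]) ?_
        intro l hl
        rw [hcoord t ht, h1]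
      have h10 : HasDerivAt (fun s => (κ (ψ s)).2.2 (0, Pi.single ⟨i + 1, by omega⟩ v))
          (totalTimeDeriv (localMomentum L x ⟨i + 1, by omega⟩) (κ (ψ t)).1 v) t := by
        refine HasDerivAt.congr_of_eventuallyEq
          (((ContinuousLinearMap.apply ℝ ℝ v)).hasFDerivAt.comp_hasDerivAt t h9) ?_
        filter_upwards [hOo.mem_nhds ht] with s hs
        exact ih (i + 1) (by omega) s hs v
      rw [h8.unique h10] at h3
      rw [localMomentum_eq_sub hL (by omega) (hT t ht)]
      have h11 : fderiv ℝ (localLagrangian L x) (κ (ψ t)).1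
          (0, Pi.single ⟨i + 1, by omega⟩ v) = lagrangianPartial L x (i + 1) (κ (ψ t)).1 v := by
        rw [lagrangianPartial, dif_pos (by omega)]
        rfl
      rw [sub_apply, h3, h11]
      ring
  refine mem_legendreGraph_of_momenta (hψ.mem t₀) fun i v => ?_
  have := main (m - i) i (by omega) t₀ (mem_adaptedChart_source π x) v
  rw [hκ, unifiedChart_apply] at this
  exact this

end Legendre

/-! ### Functions constant on a connected submanifold -/

section ConstantAlongSubmanifold

variable {V H : Type*} [NormedAddCommGroup V] [NormedSpace ℝ V] [TopologicalSpace H]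
  {I : ModelWithCorners ℝ V H} [I.Boundaryless] {M : Type*} [TopologicalSpace M]
  [ChartedSpace H M]

/-- A function whose derivative along every smooth curve in a connected submanifold vanishes is
constant on it. -/
theorem IsEmbeddedSubmanifold.constant_of_curves {S : Set M} (hS : IsEmbeddedSubmanifold I S)
    (hc : IsPreconnected S) {h : M → ℝ}
    (hh : ∀ γ : ℝ → M, ContMDiffAt 𝓘(ℝ, ℝ) I ∞ γ 0 → (∀ᶠ s in 𝓝 0, γ s ∈ S) → γ 0 ∈ S →
      HasDerivAt (fun s => h (γ s)) 0 0) {x y : M} (hx : x ∈ S) (hy : y ∈ S) : h x = h y := by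
  have hloc : ∀ x ∈ S, ∀ᶠ y in 𝓝[S] x, h y = h x := by
    intro x hx
    obtain ⟨e, he, hxe, F, hF⟩ := hS x hx
    have hto : IsOpen (e.extend I).target := by
      rw [e.extend_target, I.range_eq_univ, inter_univ]
      exact e.open_target.preimage I.continuous_symm
    have hxs : x ∈ (e.extend I).source := by rwa [e.extend_source]
    -- In a ball inside the chart image, the segment between two coordinate points of the slice
    -- stays in the ball by convexity and in `F` by linearity, so it is a curve in `S`.
    obtain ⟨ε, hε, hball⟩ := Metric.isOpen_iff.1 hto _ ((e.extend I).map_source hxs)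
    have h1 : ∀ᶠ y in 𝓝 x, y ∈ e.source ∧ e.extend I y ∈ Metric.ball (e.extend I x) ε :=
      Filter.Eventually.and (e.open_source.mem_nhds hxe)
        ((e.continuousAt_extend hxe).preimage_mem_nhds (Metric.ball_mem_nhds _ hε))
    filter_upwards [mem_nhdsWithin_of_mem_nhds h1, self_mem_nhdsWithin] with y ⟨hye, hyb⟩ hyS
    have hxF := (hF x hxe).1 hx
    have hyF := (hF y hye).1 hyS
    set ℓ : ℝ → V := fun s => e.extend I x + s • (e.extend I y - e.extend I x) with hℓ
    have hℓd : ContDiff ℝ ∞ ℓ := by fun_prop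
    have hℓF : ∀ s, ℓ s ∈ F := fun s => F.add_mem hxF (F.smul_mem s (F.sub_mem hyF hxF))
    have hℓT : ∀ s ∈ Icc (0 : ℝ) 1, ℓ s ∈ (e.extend I).target := by
      intro s hs
      refine hball ?_
      have := (convex_ball (e.extend I x) ε).add_smul_sub_mem (Metric.mem_ball_self hε) hyb hs
      exact this
    have hder : ∀ s ∈ Icc (0 : ℝ) 1, HasDerivAt (fun s => h ((e.extend I).symm (ℓ s))) 0 s := by
      intro s hs
      have h2 : ∀ᶠ τ in 𝓝 (0 : ℝ), ℓ (τ + s) ∈ (e.extend I).target := by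
        have h3 : Continuous fun τ : ℝ => ℓ (τ + s) := hℓd.continuous.comp (continuous_add_const s)
        refine h3.continuousAt.preimage_mem_nhds (hto.mem_nhds ?_)
        rw [zero_add]
        exact hℓT s hs
      have hSmem : ∀ τ, ℓ (τ + s) ∈ (e.extend I).target → (e.extend I).symm (ℓ (τ + s)) ∈ S := by
        intro τ hτ
        have h4 := (e.extend I).map_target hτ
        rw [e.extend_source] at h4
        rw [hF _ h4, (e.extend I).right_inv hτ]
        exact hℓF _
      -- The hypothesis concerns the parameter value `0` only, hence the translation by `s`.
      have h5 := hh (fun τ => (e.extend I).symm (ℓ (τ + s))) ?_ (h2.mono hSmem)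
        (hSmem 0 h2.self_of_nhds)
      · have h6 := HasDerivAt.comp_sub_const (f := fun τ => h ((e.extend I).symm (ℓ (τ + s))))
          s s (by rwa [sub_self])
        simpa using h6
      · have h7 : ContMDiffAt 𝓘(ℝ, V) I ∞ (e.extend I).symm (ℓ (0 + s)) := by
          have h8 := contMDiffOn_extend_symm (n := ∞) (I := I) he
          rw [I.image_eq] at h8
          refine h8.contMDiffAt ?_
          rw [I.range_eq_univ, inter_univ]
          have := h2.self_of_nhds
          rw [e.extend_target] at this
          exact (e.open_target.preimage I.continuous_symm).mem_nhds this.1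
        exact h7.comp (0 : ℝ) (hℓd.contMDiff.contMDiffAt.comp (0 : ℝ)
          (contDiff_id.add contDiff_const).contMDiff.contMDiffAt)
    have h9 := constant_of_has_deriv_right_zero (a := 0) (b := 1)
      (f := fun s => h ((e.extend I).symm (ℓ s)))
      (fun s hs => (hder s hs).continuousAt.continuousWithinAt)
      (fun s hs => (hder s ⟨hs.1, hs.2.le⟩).hasDerivWithinAt) 1 ⟨zero_le_one, le_rfl⟩
    have hys : y ∈ (e.extend I).source := by rwa [e.extend_source]
    simp only [hℓ, one_smul, zero_smul, add_zero, add_sub_cancel] at h9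
    rwa [(e.extend I).left_inv hxs, (e.extend I).left_inv hys] at h9
  have : PreconnectedSpace S := Subtype.preconnectedSpace hc
  have h2 : IsLocallyConstant (fun p : S => h p) :=
    (IsLocallyConstant.iff_eventually_eq _).2 fun p =>
      (eventually_nhds_subtype_iff S p fun y => h y = h p).2 (hloc p p.2)
  exact h2.apply_eq_of_preconnectedSpace ⟨x, hx⟩ ⟨y, hy⟩

end ConstantAlongSubmanifold

/-! ### The Hamiltonian section is well defined -/

section LegendreFibres

variable {n m : ℕ} {E : Type*} [TopologicalSpace E] [ChartedSpace (ℝ × Vec n) E]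
  [IsManifold 𝓘(ℝ, ℝ × Vec n) ∞ E] {π : E → ℝ} [IsFibredOverReal n π]

theorem restrictedLegendre_eq (L : Jet n π (m + 1) → ℝ) (y : Jet n π (2 * m + 1)) :
    restrictedLegendre L y = ⟨y.proj (by omega),
      momentumCovector L y.point (natChart π (2 * m + 1) y.point y)⟩ := by
  unfold restrictedLegendre
  rw [extendedLegendre_eq]
  refine congrArg (Bundle.TotalSpace.mk (y.proj (by omega))) ?_
  refine ContinuousLinearMap.ext fun v => ?_
  refine (liftCovector_apply _ _ _ _).trans ?_
  change _ * (0 : ℝ) + _ = _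
  rw [mul_zero, zero_add]
  rfl

/-- `dL = ∑ p^i dq_{i+1}` on vectors vertical over `J^{k-1} π`. -/
theorem fderiv_localLagrangian_of_jetTrunc_eq_zero {L : Jet n π (m + 1) → ℝ}
    (hL : ContMDiff 𝓘(ℝ, JetCoord n (m + 1)) 𝓘(ℝ, ℝ) ∞ L) {x : E} {z : JetCoord n (2 * m + 1)}
    (hz : z ∈ (natChart (n := n) π (2 * m + 1) x).target) {u : JetCoord n (2 * m + 1)}
    (hu : jetTrunc n (by omega : m ≤ 2 * m + 1) u = 0) :
    fderiv ℝ (localLagrangian L x) z u = momentumCovector L x z (jetShift n m u) := by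
  have hu1 : u.1 = 0 := congrArg Prod.fst hu
  have hu2 : ∀ (i : ℕ) (hi : i < m + 1), u.2 ⟨i, by omega⟩ = 0 := fun i hi =>
    congrFun (congrArg Prod.snd hu) ⟨i, hi⟩
  -- For `i < m` the component `u_{i+1}` of the shifted vector is among those killed by truncation.
  -- Only `p^m = ∂L/∂q_{m+1}` is left.
  rw [momentumCovector_apply, Finset.sum_eq_single (Fin.last m), localMomentum_last,
    lagrangianPartial, dif_pos (by omega)]
  · have h1 := dependsUpTo_localLagrangian L x
    have h2 := h1.fderiv_apply_jetCut (natChart π (2 * m + 1) x).open_target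
      (mapsTo_jetCut_natChart_target _ x)
      ((contDiffOn_localLagrangian hL x).differentiableOn (by simp)) hz u
    rw [h1.fderiv_jetCut (natChart π (2 * m + 1) x).open_target
      (mapsTo_jetCut_natChart_target _ x)
      ((contDiffOn_localLagrangian hL x).differentiableOn (by simp)) hz] at h2
    rw [← h2]
    -- Entries of `u` above `m + 1` are cut because `L` has order `m + 1`, and entries up to `m`
    -- vanish by `hu`. What survives is the single entry of order `m + 1`.
    refine congrArg (fderiv ℝ (localLagrangian L x) z) (Prod.ext hu1 (funext fun i => ?_))
    rw [jetCut_snd]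
    change _ = (Pi.single (⟨m + 1, by omega⟩ : Fin (2 * m + 1 + 1)) (u.2 ⟨m + 1, by omega⟩) :
      Fin (2 * m + 1 + 1) → Vec n) i
    rw [Pi.single_apply]
    by_cases hi : i = ⟨m + 1, by omega⟩
    · subst hi; simp
    · rw [if_neg hi]
      have : (i : ℕ) ≠ m + 1 := fun h => hi (Fin.ext h)
      split_ifs
      · exact hu2 i (by omega)
      · rfl
  · intro i _ hi
    have : (i : ℕ) ≠ m := fun h => hi (Fin.ext h)
    rw [jetShift_apply, hu2 (i + 1) (by omega), map_zero]
  · simp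

/-- The extended Legendre map is constant on the fibres of the restricted one. -/
theorem IsAlmostRegular.extendedLegendre_eq_of_restrictedLegendre_eq {L : Jet n π (m + 1) → ℝ}
    (hL : ContMDiff 𝓘(ℝ, JetCoord n (m + 1)) 𝓘(ℝ, ℝ) ∞ L) (hreg : IsAlmostRegular L)
    {y y' : Jet n π (2 * m + 1)} (hyy : restrictedLegendre L y' = restrictedLegendre L y) :
    extendedLegendre L y' = extendedLegendre L y := by
  set x := y.point with hx
  set q := y.proj (by omega : m ≤ 2 * m + 1) with hq
  set β := momentumCovector L x (natChart π (2 * m + 1) x y) with hβ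
  have hfib : ∀ y₁ ∈ restrictedLegendre L ⁻¹' {restrictedLegendre L y},
      y₁.proj (by omega) = q ∧ y₁.point = x ∧
        momentumCovector L x (natChart π (2 * m + 1) x y₁) = β := by
    intro y₁ hy₁
    have h1 : restrictedLegendre L y₁ = restrictedLegendre L y := hy₁
    have h2 : y₁.proj (by omega) = q := congrArg Bundle.TotalSpace.proj h1
    have h3 : y₁.point = x := by
      rw [← Jet.point_proj (by omega : m ≤ 2 * m + 1) y₁, h2, hq, Jet.point_proj]
    refine ⟨h2, h3, ?_⟩
    rw [restrictedLegendre_eq, restrictedLegendre_eq, h2, h3] at h1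
    exact eq_of_heq (Bundle.TotalSpace.mk.inj h1).2
  -- On the fibre this is the `dt`-component of the extended map. The momenta may be frozen at `β`
  -- because they are constant there.
  set h : Jet n π (2 * m + 1) → ℝ := fun y₁ =>
    localLagrangian L x (natChart π (2 * m + 1) x y₁) -
      β (jetShift n m (natChart π (2 * m + 1) x y₁)) with hh
  have hconst : h y' = h y := by
    refine (hreg.isEmbeddedSubmanifold_fibre y).constant_of_curves
      (hreg.isConnected_fibre y).isPreconnected (fun γ hγ hγS hγ0 => ?_) hyy rfl
    have hsrc : γ 0 ∈ (natChart (n := n) π (2 * m + 1) x).source := by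
      rw [natChart_source, mem_ofPred_eq, (hfib _ hγ0).2.1]
      exact mem_adaptedChart_source π x
    have h1 : DifferentiableAt ℝ (fun s => natChart π (2 * m + 1) x (γ s)) 0 := by
      have h2 := (contMDiffOn_natChart (π := π) (r := 2 * m + 1) x).contMDiffAt
        ((natChart π (2 * m + 1) x).open_source.mem_nhds hsrc)
      exact ((h2.comp (0 : ℝ) hγ).contDiffAt).differentiableAt (by simp)
    obtain ⟨u, hu⟩ : ∃ u, HasDerivAt (fun s => natChart π (2 * m + 1) x (γ s)) u 0 :=
      ⟨_, h1.hasDerivAt⟩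
    have hz := (natChart (n := n) π (2 * m + 1) x).map_source hsrc
    -- A fibre of `FL` lies over a single `(k-1)`-jet, so the velocity of a curve in it has no
    -- components of order below `k`.
    have htr : jetTrunc n (by omega : m ≤ 2 * m + 1) u = 0 := by
      have h3 := (jetTrunc n (by omega : m ≤ 2 * m + 1)).hasFDerivAt.comp_hasDerivAt (0 : ℝ) hu
      refine (h3.congr_of_eventuallyEq (f₁ := fun _ => natChart π m x q) ?_).unique
        (hasDerivAt_const _ _)
      filter_upwards [hγS] with s hs
      simp only [Function.comp_apply]
      rw [← natChart_proj (by omega) (by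
        rw [(hfib _ hs).2.1]; exact mem_adaptedChart_source π x), (hfib _ hs).1]
    have h4 : HasDerivAt (fun s => localLagrangian L x (natChart π (2 * m + 1) x (γ s)))
        (fderiv ℝ (localLagrangian L x) (natChart π (2 * m + 1) x (γ 0)) u) 0 :=
      HasFDerivAt.comp_hasDerivAt (0 : ℝ) (((contDiffOn_localLagrangian hL x).contDiffAt
        ((natChart π (2 * m + 1) x).open_target.mem_nhds hz)).differentiableAt
          (by simp)).hasFDerivAt hu
    have h5 : HasDerivAt (fun s => β (jetShift n m (natChart π (2 * m + 1) x (γ s))))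
        (β (jetShift n m u)) 0 :=
      (β.comp (jetShift n m)).hasFDerivAt.comp_hasDerivAt (0 : ℝ) hu
    have h6 := h4.sub h5
    rw [fderiv_localLagrangian_of_jetTrunc_eq_zero hL hz htr, (hfib _ hγ0).2.2, sub_self] at h6
    exact h6
  obtain ⟨h1, h2, h3⟩ := hfib y' hyy
  rw [extendedLegendre_eq, extendedLegendre_eq, h1, h2, h3]
  refine congrArg (Bundle.TotalSpace.mk q) ?_
  unfold liftCovector
  exact congrArg (fun c : ℝ => c • ContinuousLinearMap.fst ℝ ℝ (Fin (m + 1) → Vec n) +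
    β.comp (ContinuousLinearMap.snd ℝ ℝ (Fin (m + 1) → Vec n))) hconst

/-- The section is defined through a chosen preimage, so this identity is precisely its independence
of the choice. -/
theorem IsAlmostRegular.hamiltonianSection_restrictedLegendre {L : Jet n π (m + 1) → ℝ}
    (hL : ContMDiff 𝓘(ℝ, JetCoord n (m + 1)) 𝓘(ℝ, ℝ) ∞ L) (hreg : IsAlmostRegular L)
    (y : Jet n π (2 * m + 1)) :
    hamiltonianSection L (restrictedLegendre L y) = extendedLegendre L y := by
  have h : ∃ y', restrictedLegendre L y' = restrictedLegendre L y := ⟨y, rfl⟩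
  rw [hamiltonianSection, dif_pos h]
  exact hreg.extendedLegendre_eq_of_restrictedLegendre_eq hL h.choose_spec

end LegendreFibres

/-! ### Smooth local sections of submersions onto submanifolds -/

/-- A smooth map with surjective derivative at a point has a smooth local right inverse. -/
theorem ContDiffAt.exists_rightInverse {V F : Type*} [NormedAddCommGroup V] [NormedSpace ℝ V]
    [NormedAddCommGroup F] [NormedSpace ℝ F] [FiniteDimensional ℝ F] {G : V → F} {z : V}
    (hG : ContDiffAt ℝ ∞ G z) (hs : Function.Surjective (fderiv ℝ G z)) :
    ∃ s : F → V, ContDiffAt ℝ ∞ s (G z) ∧ s (G z) = z ∧ ∀ᶠ w in 𝓝 (G z), G (s w) = w := by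
  have : CompleteSpace F := FiniteDimensional.complete ℝ F
  obtain ⟨R, hR⟩ := (fderiv ℝ G z).exists_rightInverse_of_surjective
    (LinearMap.range_eq_top.2 hs)
  -- Restricted to the affine space through `z` along a linear right inverse `R`, the map has
  -- derivative `1` at the origin, and the inverse function theorem applies.
  have hA : ContDiff ℝ ∞ fun w : F => z + R w := by fun_prop
  have hA0 : z + R 0 = z := by simp
  have hK : ContDiffAt ℝ ∞ (fun w => G (z + R w)) 0 :=
    ContDiffAt.comp (0 : F) (by rwa [hA0]) hA.contDiffAt
  have hK' : HasFDerivAt (fun w => G (z + R w))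
      ((ContinuousLinearEquiv.refl ℝ F : F ≃L[ℝ] F) : F →L[ℝ] F) 0 := by
    have h1 : HasFDerivAt G (fderiv ℝ G z) (z + R 0) := by
      rw [hA0]; exact (hG.differentiableAt (by simp)).hasFDerivAt
    have h2 := h1.comp (0 : F) (R.hasFDerivAt.const_add z)
    rw [hR] at h2
    exact h2
  have h1 := hK.to_localInverse hK' (by simp)
  have h2 := hK.localInverse_apply_image hK' (by simp)
  have h3 := (hK.hasStrictFDerivAt' hK' (by simp)).eventually_right_inverse
  simp only [hA0] at h1 h2 h3
  refine ⟨fun w => z + R (hK.localInverse hK' (by simp) w), hA.contDiffAt.comp _ h1, ?_, h3⟩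
  simp only [h2, hA0]

section LocalSections

variable {V H W H' : Type*} [NormedAddCommGroup V] [NormedSpace ℝ V] [FiniteDimensional ℝ V]
  [TopologicalSpace H] {I : ModelWithCorners ℝ V H} [I.Boundaryless] {M : Type*}
  [TopologicalSpace M] [ChartedSpace H M]
  [NormedAddCommGroup W] [NormedSpace ℝ W] [TopologicalSpace H'] {J : ModelWithCorners ℝ W H'}
  [J.Boundaryless] {N : Type*} [TopologicalSpace N] [ChartedSpace H' N] [IsManifold J ∞ N]

/-- A submersion onto an embedded submanifold has smooth local sections. -/
theorem IsEmbeddedSubmanifold.exists_section [IsManifold I ∞ M] {f : N → M}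
    (hS : IsEmbeddedSubmanifold I (range f)) (hf : ContMDiff J I ∞ f) (y : N)
    (hsub : ∀ v : TangentSpace I (f y), IsTangentTo I (range f) (f y) v →
      ∃ u, mfderiv J I f y u = v) :
    ∃ s : M → N, ContMDiffAt I J ∞ s (f y) ∧ s (f y) = y ∧
      ∀ᶠ q in 𝓝[range f] (f y), f (s q) = q := by
  obtain ⟨e, he, hye, F, hF⟩ := hS (f y) ⟨y, rfl⟩
  have hto : IsOpen (e.extend I).target := by
    rw [e.extend_target, I.range_eq_univ, inter_univ]
    exact e.open_target.preimage I.continuous_symm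
  have hys : f y ∈ (e.extend I).source := by rwa [e.extend_source]
  have hyF : e.extend I (f y) ∈ F := (hF _ hye).1 ⟨y, rfl⟩
  -- The map `pr ∘ e` serves as a coordinate system on `S` that is defined and smooth on the ambient
  -- space, so the section is smooth there too.
  obtain ⟨pr, hpr⟩ := Submodule.ClosedComplemented.of_finiteDimensional F
  have heS : ContMDiffAt I 𝓘(ℝ, V) ∞ (e.extend I) (f y) :=
    e.contMDiffAt_extend he hye
  set κ := extChartAt J y with hκ
  have hy0 : κ.symm (κ y) = y := extChartAt_to_inv y
  have hκs : ContMDiffAt 𝓘(ℝ, W) J ∞ κ.symm (κ y) :=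
    (contMDiffOn_extChartAt_symm y).contMDiffAt (extChartAt_target_mem_nhds y)
  have hpes : ContMDiffAt I 𝓘(ℝ, F) ∞ (fun q => pr (e.extend I q)) (f y) :=
    pr.contMDiff.contMDiffAt.comp (f y) heS
  set G : W → F := fun z => pr (e.extend I (f (κ.symm z))) with hG
  have hGs : ContDiffAt ℝ ∞ G (κ y) := by
    have h1 : ContMDiffAt J 𝓘(ℝ, F) ∞ (fun y' => pr (e.extend I (f y'))) (κ.symm (κ y)) := by
      rw [hy0]; exact hpes.comp y (hf y)
    exact (h1.comp (κ y) hκs).contDiffAt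
  have hG0 : G (κ y) = pr (e.extend I (f y)) := by simp only [hG, hy0]
  obtain ⟨A, hA⟩ : ∃ A : V →L[ℝ] V, HasMFDerivAt I 𝓘(ℝ, V) (e.extend I) (f y) A :=
    ⟨_, (heS.mdifferentiableAt (by simp)).hasMFDerivAt⟩
  have hsurj : Function.Surjective (fderiv ℝ G (κ y)) := by
    intro w
    -- A line in the slice shows that every `w ∈ F` represents a tangent vector of `S`, which the
    -- submersion hypothesis lifts to `N`.
    set ℓ : ℝ → V := fun s => e.extend I (f y) + s • (w : V) with hℓ
    have hℓd : ContDiff ℝ ∞ ℓ := by fun_prop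
    have hℓ0 : ℓ 0 = e.extend I (f y) := by simp [hℓ]
    have hℓT : ∀ᶠ s in 𝓝 0, ℓ s ∈ (e.extend I).target :=
      hℓd.continuous.continuousAt.preimage_mem_nhds (hto.mem_nhds (by
        rw [hℓ0]; exact (e.extend I).map_source hys))
    set γ : ℝ → M := fun s => (e.extend I).symm (ℓ s) with hγ
    have hγ0 : γ 0 = f y := by simp only [hγ, hℓ0]; exact (e.extend I).left_inv hys
    have hγs : ContMDiffAt 𝓘(ℝ, ℝ) I ∞ γ 0 := by
      have h7 : ContMDiffAt 𝓘(ℝ, V) I ∞ (e.extend I).symm (ℓ 0) := by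
        have h8 := contMDiffOn_extend_symm (n := ∞) (I := I) he
        rw [I.image_eq] at h8
        refine h8.contMDiffAt ?_
        rw [I.range_eq_univ, inter_univ]
        have := hℓT.self_of_nhds
        rw [e.extend_target] at this
        exact (e.open_target.preimage I.continuous_symm).mem_nhds this.1
      exact h7.comp (0 : ℝ) hℓd.contMDiff.contMDiffAt
    obtain ⟨B, hB⟩ : ∃ B : ℝ →L[ℝ] V, HasMFDerivAt 𝓘(ℝ, ℝ) I γ 0 B :=
      ⟨_, (hγs.mdifferentiableAt (by simp)).hasMFDerivAt⟩
    have hB1 : B = ContinuousLinearMap.toSpanSingleton ℝ (B 1) := by ext; simp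
    obtain ⟨u, hu⟩ := hsub (B 1 : V) ⟨γ, hγ0, hγs, hℓT.mono fun s hs => by
      have h4 := (e.extend I).map_target hs
      rw [e.extend_source] at h4
      rw [hF _ h4, (e.extend I).right_inv hs]
      exact F.add_mem hyF (F.smul_mem s w.2), by rw [hB1] at hB; exact hB⟩
    have hA' : HasMFDerivAt I 𝓘(ℝ, V) (e.extend I) (γ 0) A := by rw [hγ0]; exact hA
    have h1 : HasMFDerivAt 𝓘(ℝ, ℝ) 𝓘(ℝ, V) (e.extend I ∘ γ) 0
        (ContinuousLinearMap.toSpanSingleton ℝ (w : V)) := by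
      have h2 : HasDerivAt ℓ (w : V) 0 := by
        simpa only [id, one_smul] using
          ((hasDerivAt_id (0 : ℝ)).smul_const (w : V)).const_add (e.extend I (f y))
      refine h2.hasFDerivAt.hasMFDerivAt.congr_of_eventuallyEq ?_
      filter_upwards [hℓT] with s hs
      exact (e.extend I).right_inv hs
    have h3 : A (B 1) = w :=
      (DFunLike.congr_fun (hasMFDerivAt_unique (hA'.comp (0 : ℝ) hB) h1) (1 : ℝ)).trans
        (one_smul ℝ (w : V))
    have h4 : HasMFDerivAt 𝓘(ℝ, W) 𝓘(ℝ, F) G (κ y) (fderiv ℝ G (κ y)) :=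
      (hGs.differentiableAt (by simp)).hasFDerivAt.hasMFDerivAt
    have h5 : HasMFDerivAt J 𝓘(ℝ, W) κ y _ :=
      (mdifferentiableAt_extChartAt (mem_chart_source H' y)).hasMFDerivAt
    have h6 : HasMFDerivAt J I f y _ := ((hf y).mdifferentiableAt (by simp)).hasMFDerivAt
    have h7 : HasMFDerivAt J 𝓘(ℝ, F) (fun y' => pr (e.extend I (f y'))) y _ :=
      (pr.hasMFDerivAt (x := e.extend I (f y))).comp y (hA.comp y h6)
    have h8 := (h4.comp y h5).congr_of_eventuallyEq
      (f₁ := fun y' => pr (e.extend I (f y'))) (by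
        filter_upwards [extChartAt_source_mem_nhds (I := J) y] with y' hy'
        simp only [hG, Function.comp_apply, κ.left_inv hy'])
    have h9 := DFunLike.congr_fun (hasMFDerivAt_unique h8 h7) u
    refine ⟨(mfderiv J 𝓘(ℝ, W) κ y u : W), h9.trans ?_⟩
    refine (congrArg (fun v : V => pr (A v)) hu).trans ?_
    simp only [h3, hpr]
  obtain ⟨r, hr, hr0, hrG⟩ := hGs.exists_rightInverse hsurj
  rw [hG0] at hr hr0 hrG
  have hss : ContMDiffAt I J ∞ (fun q => κ.symm (r (pr (e.extend I q)))) (f y) := by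
    have h1 : ContMDiffAt 𝓘(ℝ, W) J ∞ κ.symm (r (pr (e.extend I (f y)))) := by
      rw [hr0]; exact hκs
    exact h1.comp (f y) (hr.contMDiffAt.comp (f y) hpes)
  have hs0 : κ.symm (r (pr (e.extend I (f y)))) = y := by rw [hr0, hy0]
  refine ⟨fun q => κ.symm (r (pr (e.extend I q))), hss, hs0, ?_⟩
  have h1 : ∀ᶠ q in 𝓝 (f y), f (κ.symm (r (pr (e.extend I q)))) ∈ e.source := by
    have h2 : ContinuousAt (fun q => f (κ.symm (r (pr (e.extend I q))))) (f y) :=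
      (hf.continuous.continuousAt).comp hss.continuousAt
    refine h2.preimage_mem_nhds (e.open_source.mem_nhds ?_)
    simp only [hs0]
    exact hye
  filter_upwards [mem_nhdsWithin_of_mem_nhds h1,
    mem_nhdsWithin_of_mem_nhds (e.open_source.mem_nhds hye),
    mem_nhdsWithin_of_mem_nhds (hpes.continuousAt.eventually hrG), self_mem_nhdsWithin]
    with q hq1 hq2 hq3 hq4
  -- The right inverse gives equality only after `pr`. Both `f (s q)` and `q` lie in `S`, so their
  -- coordinates lie in `F`, where `pr` loses nothing.
  have hinj : ∀ v ∈ F, ∀ v' ∈ F, pr v = pr v' → v = v' := by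
    intro v hv v' hv' h
    rw [hpr ⟨v, hv⟩, hpr ⟨v', hv'⟩] at h
    exact congrArg Subtype.val h
  have h3 := hinj _ ((hF _ hq1).1 ⟨_, rfl⟩) _ ((hF _ hq2).1 hq4) hq3
  exact (e.extend I).injOn (by rwa [e.extend_source]) (by rwa [e.extend_source]) h3

end LocalSections

/-! ### Smoothness of the extended Legendre map and of the Hamiltonian section -/

section LegendreSmooth

variable {n m : ℕ} {E : Type*} [TopologicalSpace E] [ChartedSpace (ℝ × Vec n) E]
  [IsManifold 𝓘(ℝ, ℝ × Vec n) ∞ E] {π : E → ℝ} [IsFibredOverReal n π]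

/-- Changes of natural charts preserve vertical vectors (`inr_verticalCoordChange`), so restricting
a covector to them commutes with passing to fibre coordinates. -/
theorem reducedTrivialization_reducedProj {α₀ α : CotangentBundle (JetCoord n m) (Jet n π m)}
    (hα : α.1 ∈ (chartAt (JetCoord n m) α₀.1).source) :
    (trivializationAt ((Fin (m + 1) → Vec n) →L[ℝ] ℝ) (reducedDualCore n π m).Fiber α₀.1
      (reducedProj α)).2 =
    (extChartAt (cotangentModel (JetCoord n m)) α₀ α).2.comp
      (ContinuousLinearMap.inr ℝ ℝ (Fin (m + 1) → Vec n)) := by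
  refine ContinuousLinearMap.ext fun v => ?_
  have h1 := cotangentChart_snd_apply (α := α₀) (β := α) ((0, v) : JetCoord n m)
  refine Eq.trans ?_ h1.symm
  have h2 := DFunLike.congr_fun (TangentBundle.symmL_trivializationAt_eq_core
    (I := 𝓘(ℝ, JetCoord n m)) hα) ((0, v) : JetCoord n m)
  have h3 := inr_verticalCoordChange (achart (JetCoord n m) α₀.1) (achart (JetCoord n m) α.1)
    hα (mem_chart_source (JetCoord n m) α.1) v
  exact congrArg (α.2 : JetCoord n m →L[ℝ] ℝ) (h3.trans h2.symm)

/-- The extended map is written in a chart chosen separately at each point, so its defining formula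
does not show smoothness. But its graph lies in `W_o`, where the covector is a smooth function of
the jet and of the vertical momenta in one fixed chart. The latter are the fibre coordinates of
`FL`. -/
theorem contMDiff_extendedLegendre {L : Jet n π (m + 1) → ℝ}
    (hL : ContMDiff 𝓘(ℝ, JetCoord n (m + 1)) 𝓘(ℝ, ℝ) ∞ L)
    (hFL : ContMDiff 𝓘(ℝ, JetCoord n (2 * m + 1)) (reducedDualModel n m) ∞
      (restrictedLegendre L)) :
    ContMDiff 𝓘(ℝ, JetCoord n (2 * m + 1)) (cotangentModel (JetCoord n m)) ∞
      (extendedLegendre L) := by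
  intro y₀
  set w₀ : UnifiedSpace n π m := (y₀, extendedLegendre L y₀) with hw₀
  have hpt : ∀ y, (extendedLegendre L y).1.point = y.point := fun y => Jet.point_proj (by omega) y
  have hsrc0 : y₀ ∈ (natChart (n := n) π (2 * m + 1) y₀.point).source :=
    mem_adaptedChart_source π y₀.point
  have hev : ∀ᶠ y in 𝓝 y₀, y.point ∈ (adaptedChart (n := n) π y₀.point).source :=
    (natChart π (2 * m + 1) y₀.point).open_source.mem_nhds hsrc0
  have hz : ContMDiffAt 𝓘(ℝ, JetCoord n (2 * m + 1)) 𝓘(ℝ, JetCoord n (2 * m + 1)) ∞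
      (natChart π (2 * m + 1) y₀.point) y₀ :=
    (contMDiffOn_natChart y₀.point).contMDiffAt
      ((natChart π (2 * m + 1) y₀.point).open_source.mem_nhds hsrc0)
  rw [Bundle.contMDiffAt_totalSpace]
  refine ⟨(contMDiff_jet_proj (by omega)) y₀, ?_⟩
  have hβ := (Bundle.contMDiffAt_totalSpace.1 (hFL y₀)).2
  have h2 := (contDiffOn_unifiedParam hL y₀.point).contDiffAt
    (((natChart π (2 * m + 1) y₀.point).open_target.prod isOpen_univ).mem_nhds
      (x := (natChart π (2 * m + 1) y₀.point y₀,
      (trivializationAt ((Fin (m + 1) → Vec n) →L[ℝ] ℝ) (reducedDualCore n π m).Fiber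
        (restrictedLegendre L y₀).1 (restrictedLegendre L y₀)).2))
      ⟨(natChart π (2 * m + 1) y₀.point).map_source hsrc0, trivial⟩)
  have h3 : ContDiffAt ℝ ∞ (fun p => (unifiedParam L y₀.point p).2.2) _ :=
    (contDiff_snd.comp contDiff_snd).contDiffAt.comp _ h2
  have h4 := h3.contMDiffAt.comp y₀ (hz.prodMk_space hβ)
  refine h4.congr_of_eventuallyEq ?_
  filter_upwards [hev] with y hy
  have hs : ((y, extendedLegendre L y) : UnifiedSpace n π m) ∈
      (extChartAt (unifiedModel n m) w₀).source :=
    mem_unifiedChart_source (hpt y₀).symm (mem_hamiltonianSubmanifold_extendedLegendre L y) hy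
  have h5 := (mem_hamiltonianSubmanifold_iff L (hpt y₀).symm hs).1
    (mem_hamiltonianSubmanifold_extendedLegendre L y)
  rw [unifiedChart_apply] at h5
  have h6 : (extendedLegendre L y).1 ∈ (chartAt (JetCoord n m) (extendedLegendre L y₀).1).source := by
    rw [chartAt_jet, natChart_source, mem_ofPred_eq, hpt, hpt]
    exact hy
  have h7 := reducedTrivialization_reducedProj h6
  have h8 := congrArg (fun p => p.2.2) h5
  simp only [hw₀] at h8
  rw [← h7] at h8
  exact h8

/-- Near a point of `P` it equals the extended map composed with a smooth local section of `FL`. -/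
theorem IsAlmostRegular.contMDiffOn_hamiltonianSection {L : Jet n π (m + 1) → ℝ}
    (hL : ContMDiff 𝓘(ℝ, JetCoord n (m + 1)) 𝓘(ℝ, ℝ) ∞ L) (hreg : IsAlmostRegular L) :
    ContMDiffOn (reducedDualModel n m) (cotangentModel (JetCoord n m)) ∞ (hamiltonianSection L)
      (range (restrictedLegendre L)) := by
  rintro _ ⟨y, rfl⟩
  obtain ⟨s, hs, hs0, hsq⟩ := hreg.isEmbeddedSubmanifold_range.exists_section
    hreg.contMDiff y (hreg.isSubmersion y)
  have h1 : ContMDiffAt (reducedDualModel n m) (cotangentModel (JetCoord n m)) ∞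
      (fun q => extendedLegendre L (s q)) (restrictedLegendre L y) :=
    (contMDiff_extendedLegendre hL hreg.contMDiff _).comp _ hs
  refine h1.contMDiffWithinAt.congr_of_eventuallyEq ?_ ?_
  · filter_upwards [hsq] with q hq
    rw [← hreg.hamiltonianSection_restrictedLegendre hL, hq]
  · rw [hs0, hreg.hamiltonianSection_restrictedLegendre hL]

end LegendreSmooth

/-! ### From the unified equation to the Hamilton equation -/

section HamiltonEquation

variable {n m : ℕ} {E : Type*} [TopologicalSpace E] [ChartedSpace (ℝ × Vec n) E]
  [IsManifold 𝓘(ℝ, ℝ × Vec n) ∞ E] {π : E → ℝ} [IsFibredOverReal n π]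

set_option maxHeartbeats 2000000 in
/-- Every tangent vector of the graph of the extended Legendre map is the value of a vector field
on `W_o`. -/
theorem exists_isVectorFieldOn_of_mem_legendreGraph [T2Space E] {L : Jet n π (m + 1) → ℝ}
    (hL : ContMDiff 𝓘(ℝ, JetCoord n (m + 1)) 𝓘(ℝ, ℝ) ∞ L)
    (hFL : ContMDiff 𝓘(ℝ, JetCoord n (2 * m + 1)) (cotangentModel (JetCoord n m)) ∞
      (extendedLegendre L)) {w : UnifiedSpace n π m} (hw : w ∈ legendreGraph L)
    (u : JetCoord n (2 * m + 1)) :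
    ∃ Y : ∀ w : UnifiedSpace n π m, TangentSpace (unifiedModel n m) w,
      IsVectorFieldOn (unifiedModel n m) (hamiltonianSubmanifold L) Y ∧
      (mfderiv (unifiedModel n m) (cotangentModel (JetCoord n m))
        (Prod.snd : UnifiedSpace n π m → _) w (Y w) : JetCoord n m × (JetCoord n m →L[ℝ] ℝ)) =
      mfderiv 𝓘(ℝ, JetCoord n (2 * m + 1)) (cotangentModel (JetCoord n m))
        (extendedLegendre L) w.1 u := by
  obtain ⟨y, α⟩ := w
  obtain rfl : α = extendedLegendre L y := hw
  set w : UnifiedSpace n π m := (y, extendedLegendre L y) with hwdef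
  have h₀ : w.1.point = w.2.1.point := (Jet.point_proj (by omega) y).symm
  have hmem : w ∈ hamiltonianSubmanifold L := mem_hamiltonianSubmanifold_extendedLegendre L y
  obtain ⟨K, hK⟩ : ∃ K : JetCoord n (2 * m + 1) × (JetCoord n m × (JetCoord n m →L[ℝ] ℝ)) →L[ℝ]
      JetCoord n (2 * m + 1) × (JetCoord n m × (JetCoord n m →L[ℝ] ℝ)),
      mfderiv (unifiedModel n m)
        𝓘(ℝ, JetCoord n (2 * m + 1) × (JetCoord n m × (JetCoord n m →L[ℝ] ℝ)))
        (extChartAt (unifiedModel n m) w) w = K := ⟨_, rfl⟩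
  have hKd : HasMFDerivAt (unifiedModel n m)
      𝓘(ℝ, JetCoord n (2 * m + 1) × (JetCoord n m × (JetCoord n m →L[ℝ] ℝ)))
      (extChartAt (unifiedModel n m) w) w K := by
    rw [← hK]
    exact (mdifferentiableAt_extChartAt (mem_chart_source _ w)).hasMFDerivAt
  have hKinj : Function.Injective K := by
    have h1 := (isInvertible_mfderiv_extChartAt (I := unifiedModel n m) (x := w)
      (mem_extChartAt_source w)).injective
    rw [hK] at h1
    exact h1
  set g : Jet n π (2 * m + 1) → UnifiedSpace n π m := fun y' => (y', extendedLegendre L y') with hg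
  have hgs : ContMDiff 𝓘(ℝ, JetCoord n (2 * m + 1)) (unifiedModel n m) ∞ g :=
    contMDiff_id.prodMk hFL
  obtain ⟨D, hD⟩ : ∃ D : JetCoord n (2 * m + 1) →L[ℝ]
      JetCoord n (2 * m + 1) × (JetCoord n m × (JetCoord n m →L[ℝ] ℝ)),
      HasMFDerivAt 𝓘(ℝ, JetCoord n (2 * m + 1)) (unifiedModel n m) g y D :=
    ⟨_, ((hgs y).mdifferentiableAt (by simp)).hasMFDerivAt⟩
  have hx : w.1.point ∈ (adaptedChart (n := n) π w.1.point).source := mem_adaptedChart_source π _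
  set κ := extChartAt (unifiedModel n m) w with hκ
  -- The parameters of the graph vector `D u`. As the graph lies in `W_o`, differentiating `κ ∘ g =
  -- Γ ∘ unifiedBase ∘ κ ∘ g` shows that these parameters reproduce `K (D u)`.
  obtain ⟨Y, hY, hYw⟩ := exists_isVectorFieldOn_hamiltonianSubmanifold hL h₀ hmem hx
    (unifiedBase n m (K (D u)))
  refine ⟨Y, hY, ?_⟩
  set Γ := unifiedParam L w.1.point with hΓ
  have hbase : (unifiedBase n m (κ w)).1 ∈ (natChart (n := n) π (2 * m + 1) w.1.point).target := by
    have := κ.map_source (mem_extChartAt_source w)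
    rw [hκ, unifiedChart_target] at this
    exact this.1
  have hΓd : HasFDerivAt Γ (fderiv ℝ Γ (unifiedBase n m (κ w))) (unifiedBase n m (κ w)) :=
    (((contDiffOn_unifiedParam hL w.1.point).contDiffAt
      (((natChart π (2 * m + 1) w.1.point).open_target.prod isOpen_univ).mem_nhds
        ⟨hbase, trivial⟩)).differentiableAt (by simp)).hasFDerivAt
  have h1 : HasMFDerivAt 𝓘(ℝ, JetCoord n (2 * m + 1))
      𝓘(ℝ, JetCoord n (2 * m + 1) × (JetCoord n m × (JetCoord n m →L[ℝ] ℝ)))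
      (fun y' => κ (g y')) y (K.comp D) := HasMFDerivAt.comp y (g := κ) hKd hD
  have h2 := (HasFDerivAt.comp (κ w) (f := unifiedBase n m) hΓd
    (unifiedBase n m).hasFDerivAt).hasMFDerivAt
  have h3 : HasMFDerivAt 𝓘(ℝ, JetCoord n (2 * m + 1))
      𝓘(ℝ, JetCoord n (2 * m + 1) × (JetCoord n m × (JetCoord n m →L[ℝ] ℝ)))
      (fun y' => Γ (unifiedBase n m (κ (g y')))) y _ := HasMFDerivAt.comp y h2 h1
  have h4 : (fun y' => κ (g y')) =ᶠ[𝓝 y] fun y' => Γ (unifiedBase n m (κ (g y'))) := by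
    filter_upwards [hgs.continuous.continuousAt.preimage_mem_nhds
      (extChartAt_source_mem_nhds (I := unifiedModel n m) w)] with y' hy'
    exact ((mem_hamiltonianSubmanifold_iff' L h₀ hy').1
      (mem_hamiltonianSubmanifold_extendedLegendre L y')).symm
  have h5 := DFunLike.congr_fun (hasMFDerivAt_unique h1 (h3.congr_of_eventuallyEq h4)) u
  have h6 : K (Y w) = K (D u) := by
    refine (DFunLike.congr_fun hK.symm (Y w)).trans (hYw.trans h5.symm)
  have h7 : (Y w : JetCoord n (2 * m + 1) × (JetCoord n m × (JetCoord n m →L[ℝ] ℝ))) = D u :=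
    hKinj h6
  have h8 : HasMFDerivAt (unifiedModel n m) (cotangentModel (JetCoord n m))
      (Prod.snd : UnifiedSpace n π m → _) w _ :=
    (mdifferentiableAt_snd (I := 𝓘(ℝ, JetCoord n (2 * m + 1)))
      (I' := cotangentModel (JetCoord n m))).hasMFDerivAt
  have h9 : HasMFDerivAt 𝓘(ℝ, JetCoord n (2 * m + 1)) (cotangentModel (JetCoord n m))
      (extendedLegendre L) y _ := HasMFDerivAt.comp y (f := g) h8 hD
  have h10 : HasMFDerivAt 𝓘(ℝ, JetCoord n (2 * m + 1)) (cotangentModel (JetCoord n m))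
      (extendedLegendre L) y _ := ((hFL y).mdifferentiableAt (by simp)).hasMFDerivAt
  refine (congrArg (fun a : JetCoord n (2 * m + 1) × (JetCoord n m × (JetCoord n m →L[ℝ] ℝ)) =>
    (mfderiv (unifiedModel n m) (cotangentModel (JetCoord n m))
        (Prod.snd : UnifiedSpace n π m → _) w a : JetCoord n m × (JetCoord n m →L[ℝ] ℝ)))
        h7).trans ?_
  exact DFunLike.congr_fun (hasMFDerivAt_unique h9 h10) u

/-- Tangent spaces at different points are different types. With vectors taken in the model space,
the base point can be replaced by an equal one. -/
theorem canonicalTwoForm_congr {V M : Type*} [NormedAddCommGroup V] [NormedSpace ℝ V]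
    [FiniteDimensional ℝ V] [TopologicalSpace M] [ChartedSpace V M] [IsManifold 𝓘(ℝ, V) ∞ M]
    {α β : CotangentBundle V M} (h : α = β) (u v : V × (V →L[ℝ] ℝ)) :
    canonicalTwoForm α u v = canonicalTwoForm β u v := by
  subst h
  rfl

/-- A solution of the unified equation with values in the graph of the extended Legendre map
projects to a solution of the Hamilton equation. -/
theorem SolvesUnifiedEquation.solvesHamiltonEquation [T2Space E] {L : Jet n π (m + 1) → ℝ}
    (hL : ContMDiff 𝓘(ℝ, JetCoord n (m + 1)) 𝓘(ℝ, ℝ) ∞ L) (hreg : IsAlmostRegular L)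
    {ψ : ℝ → UnifiedSpace n π m} (hψ : IsUnifiedSection L ψ) (hsol : SolvesUnifiedEquation L ψ)
    (hgr : ∀ t, ψ t ∈ legendreGraph L) :
    SolvesHamiltonEquation L (fun t => restrictedLegendre L (ψ t).1) := by
  intro Y hY t τ
  have hFL := contMDiff_extendedLegendre hL hreg.contMDiff
  have hh := hreg.hamiltonianSection_restrictedLegendre hL
  obtain ⟨u, hu⟩ := hreg.isSubmersion (ψ t).1 _ (hY.tangent _ ⟨(ψ t).1, rfl⟩)
  obtain ⟨Z, hZ, hZt⟩ := exists_isVectorFieldOn_of_mem_legendreGraph hL hFL (hgr t) u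
  -- A derivative within `P` need not be unique, but its values on velocities of maps into `P` are
  -- forced by the chain rule. Only such values are used.
  obtain ⟨A, hA⟩ : ∃ A : JetCoord n m × ((Fin (m + 1) → Vec n) →L[ℝ] ℝ) →L[ℝ]
      JetCoord n m × (JetCoord n m →L[ℝ] ℝ),
      mfderivWithin (reducedDualModel n m) (cotangentModel (JetCoord n m)) (hamiltonianSection L)
        (range (restrictedLegendre L)) (restrictedLegendre L (ψ t).1) = A := ⟨_, rfl⟩
  have hAd : HasMFDerivWithinAt (reducedDualModel n m) (cotangentModel (JetCoord n m))
      (hamiltonianSection L) (range (restrictedLegendre L)) (restrictedLegendre L (ψ t).1) A := by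
    rw [← hA]
    exact ((hreg.contMDiffOn_hamiltonianSection hL _ ⟨_, rfl⟩).mdifferentiableWithinAt
      (by simp)).hasMFDerivWithinAt
  have h1 : HasMFDerivAt 𝓘(ℝ, JetCoord n (2 * m + 1)) (reducedDualModel n m)
      (restrictedLegendre L) (ψ t).1 _ :=
    ((hreg.contMDiff (ψ t).1).mdifferentiableAt (by simp)).hasMFDerivAt
  have h2 : HasMFDerivAt 𝓘(ℝ, JetCoord n (2 * m + 1)) (cotangentModel (JetCoord n m))
      (extendedLegendre L) (ψ t).1 _ := ((hFL _).mdifferentiableAt (by simp)).hasMFDerivAt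
  have h3 := hasMFDerivWithinAt_univ.1 (hAd.comp (ψ t).1 (hasMFDerivWithinAt_univ.2 h1)
    (fun y _ => ⟨y, rfl⟩))
  have h4 := DFunLike.congr_fun (hasMFDerivAt_unique
    (h3.congr_of_eventuallyEq (Eventually.of_forall fun y => (hh y).symm)) h2) u
  have hσ : ContMDiff 𝓘(ℝ, ℝ) (reducedDualModel n m) ∞ (fun t => restrictedLegendre L (ψ t).1) :=
    hreg.contMDiff.comp (contMDiff_fst.comp hψ.contMDiff)
  have h5 : HasMFDerivAt 𝓘(ℝ, ℝ) (reducedDualModel n m)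
      (fun t => restrictedLegendre L (ψ t).1) t _ :=
    ((hσ t).mdifferentiableAt (by simp)).hasMFDerivAt
  have h6 := hasMFDerivWithinAt_univ.1 (HasMFDerivWithinAt.comp t
    (f := fun t => restrictedLegendre L (ψ t).1) hAd (hasMFDerivWithinAt_univ.2 h5)
    (fun s _ => ⟨(ψ s).1, rfl⟩))
  have h7 : HasMFDerivAt 𝓘(ℝ, ℝ) (unifiedModel n m) ψ t _ :=
    ((hψ.contMDiff t).mdifferentiableAt (by simp)).hasMFDerivAt
  have h8 : HasMFDerivAt (unifiedModel n m) (cotangentModel (JetCoord n m))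
      (Prod.snd : UnifiedSpace n π m → _) (ψ t) _ :=
    (mdifferentiableAt_snd (I := 𝓘(ℝ, JetCoord n (2 * m + 1)))
      (I' := cotangentModel (JetCoord n m))).hasMFDerivAt
  -- Since `ψ` lies in the Legendre graph, its cotangent component is `h` composed with the
  -- projected section. The velocities correspond accordingly.
  have h9 := DFunLike.congr_fun (hasMFDerivAt_unique
    (h6.congr_of_eventuallyEq (f₁ := Prod.snd ∘ ψ) (Eventually.of_forall fun s =>
      (hgr s).trans (hh (ψ s).1).symm)) (h8.comp t h7)) τ
  have hu' : A (Y (restrictedLegendre L (ψ t).1)) =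
      mfderiv (unifiedModel n m) (cotangentModel (JetCoord n m))
        (Prod.snd : UnifiedSpace n π m → _) (ψ t) (Z (ψ t)) :=
    (congrArg A hu.symm).trans (h4.trans hZt.symm)
  have hpt : hamiltonianSection L (restrictedLegendre L (ψ t).1) = (ψ t).2 :=
    (hh _).trans (hgr t).symm
  refine Eq.trans ?_ (hsol Z hZ t τ)
  refine (canonicalTwoForm_congr hpt _ _).trans ?_
  refine congrArg₂ (fun a b : JetCoord n m × (JetCoord n m →L[ℝ] ℝ) =>
    canonicalTwoForm (ψ t).2 a b) ?_ ?_
  · exact (DFunLike.congr_fun hA _).trans hu'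
  · exact (DFunLike.congr_fun hA _).trans h9

theorem isPhaseSpaceSection_restrictedLegendre {L : Jet n π (m + 1) → ℝ}
    (hreg : IsAlmostRegular L) {ψ : ℝ → UnifiedSpace n π m} (hψ : IsUnifiedSection L ψ) :
    IsPhaseSpaceSection L (fun t => restrictedLegendre L (ψ t).1) where
  contMDiff := hreg.contMDiff.comp (contMDiff_fst.comp hψ.contMDiff)
  mem t := ⟨_, rfl⟩
  time_eq t := (Jet.time_proj (by omega) (ψ t).1).trans (hψ.time_eq t)

end HamiltonEquation

/-! ### The theorem: the holonomic alternative is reduced to the graph alternative -/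

theorem mainTheorem12 {n m : ℕ} {E : Type*} [TopologicalSpace E] [T2Space E]
    [SecondCountableTopology E] [ChartedSpace (ℝ × Vec n) E]
    [IsManifold 𝓘(ℝ, ℝ × Vec n) ∞ E] {π : E → ℝ} [IsFibredOverReal n π]
    (L : Jet n π (m + 1) → ℝ)
    (hL : ContMDiff 𝓘(ℝ, JetCoord n (m + 1)) 𝓘(ℝ, ℝ) ∞ L)
    (hreg : IsAlmostRegular L)
    (ψ : ℝ → UnifiedSpace n π m) (hψ : IsUnifiedSection L ψ)
    (hsol : SolvesUnifiedEquation L ψ)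
    (hhol : IsHolonomic n π (fun t => (ψ t).1) ∨ ∀ t, ψ t ∈ legendreGraph L) :
    (∀ y, hamiltonianSection L (restrictedLegendre L y) = extendedLegendre L y) ∧
    ContMDiffOn (reducedDualModel n m) (cotangentModel (JetCoord n m)) ∞ (hamiltonianSection L)
      (range (restrictedLegendre L)) ∧
    IsPhaseSpaceSection L (fun t => restrictedLegendre L (ψ t).1) ∧
    SolvesHamiltonEquation L (fun t => restrictedLegendre L (ψ t).1) :=
  ⟨hreg.hamiltonianSection_restrictedLegendre hL, hreg.contMDiffOn_hamiltonianSection hL,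
    isPhaseSpaceSection_restrictedLegendre hreg hψ,
    hsol.solvesHamiltonEquation hL hreg hψ fun t =>
      hhol.elim (fun h => hsol.mem_legendreGraph hL hψ h t) fun h => h t⟩
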